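/- Let $k=\mathbb R$ or $\mathbb C$, and let $(\mathfrak g=\bigoplus_{i\in\mathbb Z}\mathfrak g^i,d,[\,,\,])$ be a differential graded Lie algebra over $k$ in which every $\mathfrak g^i$ is a normed space and $d:\mathfrak g^i\to\mathfrak g^{i+1}$, $[\,,\,]:\mathfrak g^i\times\mathfrak g^j\to\mathfrak g^{i+j}$ are continuous. Suppose there is a Hodge decomposition $\mathrm{Id}=P_{\mathbf H}+d\eta+\eta d$, where $P_{\mathbf H}$ is a projection of degree $0$ onto a space $\mathbf H$ of cocycles and $\eta$ is linear of degree $-1$ and continuous on each $\mathfrak g^i$ (so that the decomposition passes to the completions). Then every class in $H^i(\mathfrak g)=\mathrm{Ker}\,d/\mathrm{Im}\,d$ has exactly one representative in $\mathbf H$; we identify $H^*(\mathfrak g)$ with $\mathbf H$. Put $\mu_1=d$, $\mu_2=(d\eta+\eta d)[\,,\,]$ and, for $n\ge 3$, $\mu_n(v_1,\dots,v_n)=(-1)^n\sum_{\sigma}(-1)^{\sigma}e(\sigma)\,\eta[\mu_{n-1}(v_{\sigma(1)},\dots,v_{\sigma(n-1)}),v_{\sigma(n)}]$, where $\sigma$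 runs over the permutations with $\sigma(1)<\dots<\sigma(n-1)$ and $e(\sigma)$ is the Koszul sign. For a $\mathbb Z$-graded, graded-commutative, finite-dimensional local $k$-algebra $B$ with maximal ideal $m_B$ and residue field $k$, extend all operations to $\mathfrak g\otimes B$ and let $\mathrm{MDef}^{\mathbb Z}_{\mathfrak g}(B)$ be the set of solutions $\Gamma\in(\mathfrak g\otimes m_B)^1$ of $$\sum_{k\ge1}\frac{(-1)^{k(k+1)/2}}{k!}\mu_k(\Gamma,\dots,\Gamma)=0 \qquad (\mathrm{MC})$$ modulo gauge equivalence (generated by polynomial paths $\Gamma(s)$ of solutions with $\Gamma'(s)=d_{\Gamma(s)}\alpha(s)$, $\alpha(s)\in(\mathfrak g\otimes m_B)^0$, where $d_\Gamma v=-\sum_{k\ge1}\frac{(-1)^{k(k+1)/2}}{(k-1)!}\mu_k(\Gamma,\dots,\Gamma,v)$); alternatively, instead of taking the quotient, only the solutions in $(C\otimes m_B)^1$ are admitted, where $C$ is a graded complement to $\mathrm{Im}\,d$ in $\mathfrak g$. Let $\mathrm{MDef}^{0}_{\mathfrak g}$ be the restriction of this functor to algebras $B$ concentrated in degree $0$.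 Let $K(\Gamma)=\Gamma+\tfrac12\eta[\Gamma,\Gamma]$ be the Kuranishi map, and $\kappa=P_{\mathbf H}\circ K$, where $P_{\mathbf H}=\mathrm{Id}-d\eta-\eta d$ also on $\mathfrak g\otimes B$ and on completions. **(iii)** Let $H^*(\mathfrak g)$ be finite-dimensional, with a homogeneous basis $(\gamma_\alpha)$ and corresponding coordinates $t_\alpha$ of degree $1-|\gamma_\alpha|$. For both versions of $\mathrm{MDef}^{\mathbb Z}_{\mathfrak g}$ (and, for the second one, every $C$), $\mathrm{MDef}^{\mathbb Z}_{\mathfrak g}$ is represented by the analytic germ $\mathcal O_0=k\{t_\alpha:\ t_\alpha\text{ even}\}\otimes\Lambda(t_\alpha:\ t_\alpha\text{ odd})$ of the linear supermanifold $H^*(\mathfrak g)[1]$ at $0$: there are bijections, natural in $B$, from the local homomorphisms of graded algebras $\varphi:\mathcal O_0\to B$ to $\mathrm{MDef}^{\mathbb Z}_{\mathfrak g}(B)$, under which $\varphi$ corresponds to $\Gamma$ exactly when $\kappa(\Gamma)=\sum_\alpha\gamma_\alpha\otimes\varphi(t_\alpha)$. Suppose moreover that $d,[\,,\,],\eta$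 are continuous for the norm $\|\sum x_i\|=\sum\|x_i\|$ on $\mathfrak g$ (as is automatic if only finitely many $\mathfrak g^i$ are nonzero), and let $\hat{\mathfrak g}$ be the completion. Then there are open neighbourhoods $U,V$ of $0$ in $\hat{\mathfrak g}$ such that, for all $B$ as above, the set $\mathcal M^{\mathbb Z}(B)$ of solutions $\Gamma$ of (MC) (as a convergent series) in the part of odd total parity of $\hat{\mathfrak g}\otimes B$ with $d\eta\Gamma=0$ and with body (the image under $B\to k$) in $U$ is mapped by $\kappa$ bijectively, analytically and with analytic inverse onto the set of elements of odd total parity of $H^*(\mathfrak g)\otimes B$ with body in $V$, and the inverse is tangent to the identity at $0$. So the moduli superspace $\mathcal M^{\mathbb Z}$ is smooth, analytically isomorphic through the Kuranishi map to a neighbourhood of $0$ in $H^*(\mathfrak g)[1]$, with tangent space $H^*(\mathfrak g)$ at $0$. The points of $\mathcal M^{\mathbb Z}(B)$ of total $\mathbb Z$-degree one with coefficients in $m_B$ are exactly the elements of $\mathrm{MDef}^{\mathbb Z}_{\mathfrak g}(B)$ (version with $C=\mathrm{Ker}\,d\eta$). **(i)** Let $H^1(\mathfrak g)$ be finite-dimensional,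 with basis $(\gamma_\alpha)$ and coordinates $t_\alpha$. In the same sense, for both versions and through $\kappa$, $\mathrm{MDef}^0_{\mathfrak g}$ is represented by the algebra $k\{t_\alpha\}$ of convergent power series, the analytic germ of $H^1(\mathfrak g)$ at $0$. There are open neighbourhoods $U,V$ of $0$ in the completion $\hat{\mathfrak g}^1$ such that the set $\mathcal M^0$ of the $\Gamma\in U$ with $d\eta\Gamma=0$ that satisfy (MC) is mapped by $\kappa$ bijectively, analytically and with analytic inverse onto $V\cap H^1(\mathfrak g)$, and the inverse is tangent to the identity at $0$. So $\mathcal M^0$ is smooth, with tangent space $H^1(\mathfrak g)$ at $0$. **Tangent spaces.** If $i+j=1$ and $B=k[\varepsilon]$ with $\varepsilon^2=0$ and $|\varepsilon|=j$, then $[z]\mapsto[z\otimes\varepsilon]$ is a bijection from $H^i(\mathfrak g)$ to $\mathrm{MDef}^{\mathbb Z}_{\mathfrak g}(k[\varepsilon])$ (gauge version). In total, the tangent space of $\mathrm{MDef}^{\mathbb Z}_{\mathfrak g}$ is $H^*(\mathfrak g)$, and that of $\mathrm{MDef}^0_{\mathfrak g}$ (the case $j=0$) is $H^1(\mathfrak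 g)$. -/

import Mathlib

open scoped TensorProduct DirectSum Topology
open Filter
open UniformSpace (Completion)

universe u v w x

namespace Kuranishi

/-! ### Operations and the higher brackets built from them -/

section Ops

variable {𝕜 : Type*} [Field 𝕜] {A : Type*} [AddCommGroup A] [Module 𝕜 A]

/-- A differential `d`, a bracket `br` and a homotopy `η` on the total space `A` of a graded
vector space. (Only the raw operations; the axioms are in `NormedDGLA` and `Hodge`.) -/
structure Ops (𝕜 : Type*) (A : Type*) [Field 𝕜] [AddCommGroup A] [Module 𝕜 A] where
  d : A →ₗ[𝕜] A
  br : A →ₗ[𝕜] A →ₗ[𝕜] A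
  η : A →ₗ[𝕜] A

/-- For homogeneous `v₁, …, vₙ` of degrees `δ₁, …, δₙ`: the sign `(-1)^σ e(σ)` of the unshuffle `σ`
that moves `vⱼ` to the last place. Passing `vᵢ` costs `-(-1)^(δᵢ δⱼ)`. -/
def unshuffleSign {n : ℕ} (δ : Fin n → ℤ) (j : Fin n) : ℤˣ :=
  ∏ i ∈ Finset.univ.filter (fun i => j < i), (-(δ j * δ i).negOnePow)

/-- The higher brackets `μₙ(v₁, …, vₙ)` on homogeneous elements `vᵢ` of degree `δᵢ`:
`μ₁ = d`, `μ₂ = (dη + ηd)[ , ]` and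
`μₙ = (-1)ⁿ ∑_{σ ∈ Sh(n-1,n)} (-1)^σ e(σ) η[μₙ₋₁(v_σ(1), …, v_σ(n-1)), v_σ(n)]` for `n ≥ 3`;
the unshuffle `σ` is determined by `j = σ(n)`. -/
def Ops.mu (o : Ops 𝕜 A) : (n : ℕ) → (Fin n → ℤ) → (Fin n → A) → A
  | 0, _, _ => 0
  | 1, _, v => o.d (v 0)
  | 2, _, v => o.d (o.η (o.br (v 0) (v 1))) + o.η (o.d (o.br (v 0) (v 1)))
  | n + 3, δ, v => (-1 : ℤˣ) ^ (n + 3) • ∑ j : Fin (n + 3), unshuffleSign δ j •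
      o.η (o.br (o.mu (n + 2) (fun i => δ (j.succAbove i)) (fun i => v (j.succAbove i))) (v j))

/-- The `k`-th term `(-1)^(k(k+1)/2) / k! · μₖ(Γ, …, Γ)` of the Maurer–Cartan series of an
element `Γ` of degree one (the term with `k = 0` is zero). -/
noncomputable def Ops.mcTerm (o : Ops 𝕜 A) (Γ : A) (k : ℕ) : A :=
  ((-1 : 𝕜) ^ (k * (k + 1) / 2) / (k.factorial : 𝕜)) • o.mu k (fun _ => 1) (fun _ => Γ)

/-- The term with index `k + 1` of the `Γ`-deformed differential
`d_Γ v = -∑_{k ≥ 1} (-1)^(k(k+1)/2) / (k-1)! · μₖ(Γ, …, Γ, v)` for `Γ` of degree one and `v` of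
degree zero. -/
noncomputable def Ops.twistTerm (o : Ops 𝕜 A) (Γ v : A) (k : ℕ) : A :=
  (-((-1 : 𝕜) ^ ((k + 1) * (k + 2) / 2) / (k.factorial : 𝕜))) •
    o.mu (k + 1) (Fin.snoc (α := fun _ => ℤ) (fun _ => 1) 0)
      (Fin.snoc (α := fun _ => A) (fun _ => Γ) v)

/-- The Kuranishi map `Γ ↦ K₁(Γ) + K₂(Γ, Γ)/2 = Γ + η[Γ, Γ]/2` on elements of degree one. -/
noncomputable def Ops.kur (o : Ops 𝕜 A) (Γ : A) : A := Γ + (2⁻¹ : 𝕜) • o.η (o.br Γ Γ)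

/-- The harmonic projection `Id - dη - ηd` of a Hodge decomposition. -/
def Ops.harm (o : Ops 𝕜 A) (x : A) : A := x - o.d (o.η x) - o.η (o.d x)

/-- The Kuranishi map followed by the harmonic projection. -/
noncomputable def Ops.kappa (o : Ops 𝕜 A) (Γ : A) : A := o.harm (o.kur Γ)

/-- Extension of the operations from `A` to `A ⊗ B`, where `B` is a graded algebra. Here `σ` and `τ`
are the parity involutions `x ↦ (-1)^|x| x` of `A` and of `B`, and
`[a ⊗ x, b ⊗ y] = (-1)^(|x| |b|) [a, b] ⊗ x y`; the two summands are the cases of even and of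
odd `b`. -/
noncomputable def Ops.tensor [CharZero 𝕜] (o : Ops 𝕜 A) (σ : A →ₗ[𝕜] A)
    (B : Type*) [Ring B] [Algebra 𝕜 B] (τ : B →ₗ[𝕜] B) : Ops 𝕜 (A ⊗[𝕜] B) where
  d := o.d.rTensor B
  η := o.η.rTensor B
  br :=
    TensorProduct.map₂ (o.br.compl₂ ((2⁻¹ : 𝕜) • (LinearMap.id + σ))) (LinearMap.mul 𝕜 B) +
    TensorProduct.map₂ (o.br.compl₂ ((2⁻¹ : 𝕜) • (LinearMap.id - σ))) ((LinearMap.mul 𝕜 B) ∘ₗ τ)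

variable {A' : Type*} [AddCommGroup A'] [Module 𝕜 A']

theorem Ops.map_mu (o : Ops 𝕜 A) (o' : Ops 𝕜 A') (h : A →ₗ[𝕜] A')
    (hd : ∀ x, h (o.d x) = o'.d (h x)) (hη : ∀ x, h (o.η x) = o'.η (h x))
    (hb : ∀ x y, h (o.br x y) = o'.br (h x) (h y)) :
    ∀ (n : ℕ) (δ : Fin n → ℤ) (v : Fin n → A), h (o.mu n δ v) = o'.mu n δ (fun i => h (v i))
  | 0, _, _ => by simp [Ops.mu]
  | 1, _, v => by simp [Ops.mu, hd]
  | 2, _, v => by simp [Ops.mu, hd, hη, hb]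
  | n + 3, δ, v => by
      have ih := Ops.map_mu o o' h hd hη hb (n + 2)
      have hu : ∀ (s : ℤˣ) (x : A), h (s • x) = s • h x := fun s x => by
        rw [Units.smul_def, Units.smul_def, map_zsmul]
      simp only [Ops.mu, hu, map_sum, hη, hb, ih]

end Ops

/-- The parity involution `x ↦ (-1)^|x| x` of a graded vector space. -/
noncomputable def parity {𝕜 : Type*} [Field 𝕜] {A : Type*} [AddCommGroup A] [Module 𝕜 A]
    (𝒜 : ℤ → Submodule 𝕜 A) [DirectSum.Decomposition 𝒜] : A →ₗ[𝕜] A :=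
  (DirectSum.toModule 𝕜 ℤ A fun i => ((i.negOnePow : ℤˣ) : ℤ) • (𝒜 i).subtype) ∘ₗ
    (DirectSum.decomposeLinearEquiv 𝒜).toLinearMap

theorem parity_of_mem {𝕜 : Type*} [Field 𝕜] {A : Type*} [AddCommGroup A] [Module 𝕜 A]
    (𝒜 : ℤ → Submodule 𝕜 A) [DirectSum.Decomposition 𝒜] {i : ℤ} {a : A} (ha : a ∈ 𝒜 i) :
    parity 𝒜 a = (i.negOnePow : ℤˣ) • a := by
  lift a to 𝒜 i using ha
  simp [parity, Units.smul_def]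

/-! ### Graded Artin local algebras -/

/-- A `ℤ`-graded, graded-commutative, finite-dimensional local `𝕜`-algebra with residue field `𝕜`:
`aug` is the residue map, and its kernel, the maximal ideal, is nilpotent. -/
structure GradedArtin (𝕜 : Type u) [Field 𝕜] where
  carrier : Type v
  [ring : Ring carrier]
  [algebra : Algebra 𝕜 carrier]
  gr : ℤ → Submodule 𝕜 carrier
  [graded : GradedAlgebra gr]
  [finite : Module.Finite 𝕜 carrier]
  comm : ∀ i j : ℤ, ∀ a ∈ gr i, ∀ b ∈ gr j, a * b = (i * j).negOnePow • (b * a)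
  aug : carrier →ₐ[𝕜] 𝕜
  nilp : ∃ N : ℕ, (LinearMap.ker aug.toLinearMap) ^ N = ⊥

attribute [instance] GradedArtin.ring GradedArtin.algebra GradedArtin.graded GradedArtin.finite

instance {𝕜 : Type u} [Field 𝕜] : CoeSort (GradedArtin.{u, v} 𝕜) (Type v) := ⟨GradedArtin.carrier⟩

namespace GradedArtin

variable {𝕜 : Type u} [Field 𝕜]

/-- The maximal ideal. -/
def max (B : GradedArtin.{u, v} 𝕜) : Submodule 𝕜 B := LinearMap.ker B.aug.toLinearMap

/-- The algebra is concentrated in degree zero. -/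
def DegreeZero (B : GradedArtin.{u, v} 𝕜) : Prop := B.gr 0 = ⊤

/-- Homomorphisms of graded algebras (automatically local, see `Hom.map_max`). -/
structure Hom (B B' : GradedArtin.{u, v} 𝕜) where
  toAlgHom : B →ₐ[𝕜] B'
  map_gr : ∀ i, ∀ b ∈ B.gr i, toAlgHom b ∈ B'.gr i

theorem Hom.map_max {B B' : GradedArtin.{u, v} 𝕜} (f : Hom B B') {b : B} (hb : b ∈ B.max) :
    f.toAlgHom b ∈ B'.max := by
  obtain ⟨N, hN⟩ := B.nilp
  have h1 : b ^ N = 0 := by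
    have := Submodule.pow_mem_pow B.max hb N
    rw [max, hN] at this
    simpa using this
  have h2 : (B'.aug (f.toAlgHom b)) ^ N = 0 := by rw [← map_pow, ← map_pow, h1, map_zero, map_zero]
  exact eq_zero_of_pow_eq_zero h2

theorem Hom.map_parity {B B' : GradedArtin.{u, v} 𝕜} (f : Hom B B') (b : B) :
    f.toAlgHom (parity B.gr b) = parity B'.gr (f.toAlgHom b) := by
  induction b using DirectSum.Decomposition.inductionOn B.gr with
  | zero => simp
  | @homogeneous i m =>
      rw [parity_of_mem B.gr m.2, parity_of_mem B'.gr (f.map_gr i _ m.2), Units.smul_def,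
        Units.smul_def, map_zsmul]
  | add x y hx hy => simp [hx, hy]

end GradedArtin

/-! ### Normed differential graded Lie algebras with a Hodge decomposition -/

section DGLA

variable {𝕜 : Type u} [RCLike 𝕜] {G : Type w} [NormedAddCommGroup G] [NormedSpace 𝕜 G]

/-- A normed differential graded Lie algebra `𝔤 = ⨁ᵢ 𝔤ⁱ`, `𝔤ⁱ = 𝒢 i`. Each `𝔤ⁱ` is a normed space,
and the differential `𝔤ⁱ → 𝔤ⁱ⁺¹` and the bracket `𝔤ⁱ × 𝔤ʲ → 𝔤ⁱ⁺ʲ` are continuous (bounds may depend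
on the degrees). The norms of the `𝔤ⁱ` are put together to the norm `‖∑ xᵢ‖ = ∑ ‖xᵢ‖` of `𝔤`. -/
structure NormedDGLA (𝕜 : Type u) [RCLike 𝕜] {G : Type w} [NormedAddCommGroup G]
    [NormedSpace 𝕜 G] (𝒢 : ℤ → Submodule 𝕜 G) [DirectSum.Decomposition 𝒢] where
  d : G →ₗ[𝕜] G
  br : G →ₗ[𝕜] G →ₗ[𝕜] G
  d_mem : ∀ i, ∀ x ∈ 𝒢 i, d x ∈ 𝒢 (i + 1)
  br_mem : ∀ i j, ∀ x ∈ 𝒢 i, ∀ y ∈ 𝒢 j, br x y ∈ 𝒢 (i + j)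
  d_d : ∀ x, d (d x) = 0
  leibniz : ∀ i, ∀ x ∈ 𝒢 i, ∀ y, d (br x y) = br (d x) y + i.negOnePow • br x (d y)
  antisymm : ∀ i j, ∀ x ∈ 𝒢 i, ∀ y ∈ 𝒢 j, br x y = -((i * j).negOnePow • br y x)
  jacobi : ∀ i j, ∀ x ∈ 𝒢 i, ∀ y ∈ 𝒢 j, ∀ z,
    br x (br y z) = br (br x y) z + (i * j).negOnePow • br y (br x z)
  norm_eq : ∀ x, ‖x‖ = ∑ᶠ i, ‖(DirectSum.decompose 𝒢 x i : G)‖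
  bound_d : ∀ i, ∃ C : ℝ, ∀ x ∈ 𝒢 i, ‖d x‖ ≤ C * ‖x‖
  bound_br : ∀ i j, ∃ C : ℝ, ∀ x ∈ 𝒢 i, ∀ y ∈ 𝒢 j, ‖br x y‖ ≤ C * ‖x‖ * ‖y‖

/-- A Hodge decomposition `Id = P + dη + ηd`: `P` is a projection of degree zero onto a space of
cocycles (the harmonic space), and `η` has degree `-1` and is continuous in each degree, so that the
decomposition passes to the completions. -/
structure Hodge {𝒢 : ℤ → Submodule 𝕜 G} [DirectSum.Decomposition 𝒢] (D : NormedDGLA 𝕜 𝒢) where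
  P : G →ₗ[𝕜] G
  η : G →ₗ[𝕜] G
  P_mem : ∀ i, ∀ x ∈ 𝒢 i, P x ∈ 𝒢 i
  η_mem : ∀ i, ∀ x ∈ 𝒢 i, η x ∈ 𝒢 (i - 1)
  P_P : ∀ x, P (P x) = P x
  d_P : ∀ x, D.d (P x) = 0
  decomp : ∀ x, x = P x + D.d (η x) + η (D.d x)
  bound_η : ∀ i, ∃ C : ℝ, ∀ x ∈ 𝒢 i, ‖η x‖ ≤ C * ‖x‖

variable {𝒢 : ℤ → Submodule 𝕜 G} [DirectSum.Decomposition 𝒢] {D : NormedDGLA 𝕜 𝒢}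

/-- The cohomology `Hⁱ(𝔤) = Ker d / Im d` in degree `i`. -/
abbrev NormedDGLA.Cohomology (D : NormedDGLA 𝕜 𝒢) (i : ℤ) : Type w :=
  ↥(𝒢 i ⊓ LinearMap.ker D.d) ⧸ (LinearMap.range D.d).comap (𝒢 i ⊓ LinearMap.ker D.d).subtype

/-- The cohomology class of a cocycle of degree `i`. -/
def NormedDGLA.cls (D : NormedDGLA 𝕜 𝒢) {i : ℤ} (z : ↥(𝒢 i ⊓ LinearMap.ker D.d)) :
    D.Cohomology i :=
  Submodule.Quotient.mk z

namespace Hodge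

/-- The harmonic space, the image of `P`, in which the cohomology `H*(𝔤)` is realised. -/
def harmonic (S : Hodge D) : Submodule 𝕜 G := LinearMap.range S.P

/-- Every class in `Hⁱ(𝔤)` has exactly one representative in the harmonic space. -/
def HarmonicRepresents (S : Hodge D) (i : ℤ) : Prop :=
  ∀ c : D.Cohomology i, ∃! z : ↥(𝒢 i ⊓ LinearMap.ker D.d), (z : G) ∈ S.harmonic ∧ D.cls z = c

/-- The operations of `𝔤`. -/
def ops (S : Hodge D) : Ops 𝕜 G := ⟨D.d, D.br, S.η⟩

variable (S : Hodge D) (B B' : GradedArtin.{u, v} 𝕜)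

/-- The operations of `𝔤 ⊗ B`. -/
noncomputable def opsT : Ops 𝕜 (G ⊗[𝕜] B) := S.ops.tensor (parity 𝒢) B (parity B.gr)

/-- The part `(𝔤 ⊗ m_B)ⁿ = ∑ᵢ 𝔤ⁱ ⊗ m_Bⁿ⁻ⁱ` of total degree `n`. -/
noncomputable def deg (_S : Hodge D) (B : GradedArtin.{u, v} 𝕜) (n : ℤ) :
    Submodule 𝕜 (G ⊗[𝕜] B) :=
  ⨆ i : ℤ, LinearMap.range (TensorProduct.mapIncl (𝒢 i) (B.gr (n - i) ⊓ B.max))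

/-- Solutions of the Maurer–Cartan equation `∑ₖ (-1)^(k(k+1)/2) / k! · μₖ(Γ, …, Γ) = 0` in
`(𝔤 ⊗ m_B)¹`. The terms with large `k` vanish, as `m_B` is nilpotent. -/
def MC : Set (G ⊗[𝕜] B) :=
  {Γ | Γ ∈ S.deg B 1 ∧ ∀ᶠ n in atTop, ∑ k ∈ Finset.range n, (S.opsT B).mcTerm Γ k = 0}

/-- The value at `s` of the polynomial path `∑ᵢ sⁱ cᵢ`. -/
noncomputable def path {M : Type*} [AddCommGroup M] [Module 𝕜 M] (c : ℕ →₀ M) (s : 𝕜) : M :=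
  c.sum fun i x => s ^ i • x

/-- The derivative at `s` of the polynomial path `∑ᵢ sⁱ cᵢ`. -/
noncomputable def pathDeriv {M : Type*} [AddCommGroup M] [Module 𝕜 M] (c : ℕ →₀ M) (s : 𝕜) : M :=
  c.sum fun i x => ((i : 𝕜) * s ^ (i - 1)) • x

/-- Natural gauge equivalence: `Γ₀` and `Γ₁` are joined by a path `Γ(s)` of Maurer–Cartan elements
that is tangent to the distribution of the vectors `d_Γ α`, `α ∈ (𝔤 ⊗ m_B)⁰`, that is,
`Γ'(s) = d_{Γ(s)} α(s)`. -/
def Gauge (Γ₀ Γ₁ : S.MC B) : Prop :=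
  ∃ c a : ℕ →₀ (G ⊗[𝕜] B), (∀ i, c i ∈ S.deg B 1) ∧ (∀ i, a i ∈ S.deg B 0) ∧
    path (𝕜 := 𝕜) c 0 = Γ₀ ∧ path (𝕜 := 𝕜) c 1 = Γ₁ ∧
    ∀ s : 𝕜, path c s ∈ S.MC B ∧
      ∀ᶠ n in atTop, ∑ k ∈ Finset.range n, (S.opsT B).twistTerm (path c s) (path a s) k =
        pathDeriv c s

/-- The value `MDef_𝔤(B)` of the deformation functor: Maurer–Cartan elements in `(𝔤 ⊗ m_B)¹` up to
gauge equivalence. On all `B` this is `MDef^ℤ`, on those concentrated in degree zero `MDef⁰`. -/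
def MDef : Type _ := Quot (S.Gauge B)

/-- A graded complement `C` to the coboundaries in `𝔤`. -/
structure IsComplement (_S : Hodge D) (C : Submodule 𝕜 G) : Prop where
  homogeneous : ∀ x ∈ C, ∀ i, (DirectSum.decompose 𝒢 x i : G) ∈ C
  isCompl : IsCompl C (LinearMap.range D.d)

/-- The version of `MDef_𝔤(B)` with a complement instead of a gauge equivalence: Maurer–Cartan
elements in `C(𝔤 ⊗ m_B)¹ = (C ⊗ m_B)¹`, a complement to `d(𝔤 ⊗ m_B)⁰` in `(𝔤 ⊗ m_B)¹`. -/
def MDefC (C : Submodule 𝕜 G) : Set (G ⊗[𝕜] B) :=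
  S.MC B ∩ LinearMap.range (TensorProduct.mapIncl C B.max)

variable {B B'}

/-- The map `𝔤 ⊗ B → 𝔤 ⊗ B'` induced by `B → B'`. -/
noncomputable def tmap (_S : Hodge D) (f : GradedArtin.Hom B B') : G ⊗[𝕜] B →ₗ[𝕜] G ⊗[𝕜] B' :=
  f.toAlgHom.toLinearMap.lTensor G

theorem tmap_mu (f : GradedArtin.Hom B B') (n : ℕ) (δ : Fin n → ℤ) (x : Fin n → G ⊗[𝕜] B) :
    S.tmap f ((S.opsT B).mu n δ x) = (S.opsT B').mu n δ (fun i => S.tmap f (x i)) := by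
  apply Ops.map_mu
  · intro x
    induction x with
    | zero => simp
    | tmul a b => simp [tmap, opsT, Ops.tensor]
    | add x y hx hy => simp [hx, hy]
  · intro x
    induction x with
    | zero => simp
    | tmul a b => simp [tmap, opsT, Ops.tensor]
    | add x y hx hy => simp [hx, hy]
  · intro x y
    induction x with
    | zero => simp
    | add x y hx hy => simp [hx, hy]
    | tmul a b =>
      induction y with
      | zero => simp
      | add x y hx hy => simp [hx, hy]
      | tmul a' b' => simp [tmap, opsT, Ops.tensor, f.map_parity]

theorem tmap_deg (f : GradedArtin.Hom B B') (n : ℤ) {x : G ⊗[𝕜] B} (hx : x ∈ S.deg B n) :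
    S.tmap f x ∈ S.deg B' n := by
  suffices h : S.deg B n ≤ (S.deg B' n).comap (S.tmap f) from h hx
  refine iSup_le fun i => ?_
  rintro _ ⟨t, rfl⟩
  induction t with
  | zero => simp
  | add x y hx hy => rw [map_add]; exact add_mem hx hy
  | tmul a b =>
    refine Submodule.mem_iSup_of_mem i ⟨a ⊗ₜ ⟨f.toAlgHom b, f.map_gr _ _ b.2.1, f.map_max b.2.2⟩, ?_⟩
    simp [tmap, TensorProduct.mapIncl]

theorem tmap_MC (f : GradedArtin.Hom B B') {Γ : G ⊗[𝕜] B} (hΓ : Γ ∈ S.MC B) :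
    S.tmap f Γ ∈ S.MC B' := by
  refine ⟨S.tmap_deg f 1 hΓ.1, hΓ.2.mono fun n hn => ?_⟩
  have := congrArg (S.tmap f) hn
  simpa [Ops.mcTerm, tmap_mu] using this

theorem tmap_range (f : GradedArtin.Hom B B') (C : Submodule 𝕜 G) {x : G ⊗[𝕜] B}
    (hx : x ∈ LinearMap.range (TensorProduct.mapIncl C B.max)) :
    S.tmap f x ∈ LinearMap.range (TensorProduct.mapIncl C B'.max) := by
  obtain ⟨t, rfl⟩ := hx
  induction t with
  | zero => simp
  | add x y hx hy => rw [map_add, map_add]; exact add_mem hx hy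
  | tmul a b => exact ⟨a ⊗ₜ ⟨f.toAlgHom b, f.map_max b.2⟩, by simp [tmap, TensorProduct.mapIncl]⟩

theorem tmap_gauge (f : GradedArtin.Hom B B') {Γ₀ Γ₁ : S.MC B} (h : S.Gauge B Γ₀ Γ₁) :
    S.Gauge B' ⟨S.tmap f Γ₀, S.tmap_MC f Γ₀.2⟩ ⟨S.tmap f Γ₁, S.tmap_MC f Γ₁.2⟩ := by
  obtain ⟨c, a, hc, ha, h0, h1, h2⟩ := h
  have hp : ∀ (c : ℕ →₀ (G ⊗[𝕜] B)) (s : 𝕜),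
      path (c.mapRange (S.tmap f) (map_zero _)) s = S.tmap f (path c s) := fun c s => by
    simp only [path]
    rw [Finsupp.sum_mapRange_index (by simp), map_finsuppSum]
    simp
  have hq : ∀ (c : ℕ →₀ (G ⊗[𝕜] B)) (s : 𝕜),
      pathDeriv (c.mapRange (S.tmap f) (map_zero _)) s = S.tmap f (pathDeriv c s) := fun c s => by
    simp only [pathDeriv]
    rw [Finsupp.sum_mapRange_index (by simp), map_finsuppSum]
    simp
  refine ⟨c.mapRange (S.tmap f) (map_zero _), a.mapRange (S.tmap f) (map_zero _),
    fun i => S.tmap_deg f 1 (hc i), fun i => S.tmap_deg f 0 (ha i), by rw [hp, h0], by rw [hp, h1],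
    fun s => ⟨by rw [hp]; exact S.tmap_MC f (h2 s).1, (h2 s).2.mono fun n hn => ?_⟩⟩
  rw [hp, hp, hq, ← hn, map_sum]
  refine Finset.sum_congr rfl fun k _ => ?_
  simp only [Ops.twistTerm, map_smul, tmap_mu]
  congr 2
  funext i
  refine Fin.lastCases ?_ (fun j => ?_) i <;> simp

/-- The functor `MDef` on morphisms. -/
noncomputable def MDef.map (f : GradedArtin.Hom B B') : S.MDef B → S.MDef B' :=
  Quot.map (fun Γ => ⟨S.tmap f Γ, S.tmap_MC f Γ.2⟩) fun _ _ h => S.tmap_gauge f h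

/-- The functor `MDefC` on morphisms. -/
noncomputable def MDefC.map (C : Submodule 𝕜 G) (f : GradedArtin.Hom B B') (Γ : S.MDefC B C) :
    S.MDefC B' C :=
  ⟨S.tmap f Γ, S.tmap_MC f Γ.2.1, S.tmap_range f C Γ.2.2⟩

end Hodge

end DGLA

/-! ### Analytic germs of linear (super)spaces -/

section Germ

variable (𝕜 : Type u) [RCLike 𝕜]

theorem conv_add {σ : Type*} {f g : MvPowerSeries σ 𝕜}
    (hf : ∃ r : ℝ, 0 < r ∧ Summable fun m => ‖MvPowerSeries.coeff m f‖ * r ^ m.degree)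
    (hg : ∃ r : ℝ, 0 < r ∧ Summable fun m => ‖MvPowerSeries.coeff m g‖ * r ^ m.degree) :
    ∃ r : ℝ, 0 < r ∧ (Summable fun m => ‖MvPowerSeries.coeff m f‖ * r ^ m.degree) ∧
      Summable fun m => ‖MvPowerSeries.coeff m g‖ * r ^ m.degree := by
  obtain ⟨r, hr, h⟩ := hf
  obtain ⟨s, hs, h'⟩ := hg
  refine ⟨min r s, lt_min hr hs, ?_, ?_⟩
  · refine Summable.of_nonneg_of_le (fun m => by positivity) (fun m => ?_) h
    gcongr
    exact min_le_left _ _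
  · refine Summable.of_nonneg_of_le (fun m => by positivity) (fun m => ?_) h'
    gcongr
    exact min_le_right _ _

open Classical in
theorem summable_antidiagonal {σ : Type*} {F F' : (σ →₀ ℕ) → ℝ} (h : Summable F)
    (h' : Summable F') (h0 : ∀ m, 0 ≤ F m) (h0' : ∀ m, 0 ≤ F' m) :
    Summable fun m => ∑ p ∈ Finset.HasAntidiagonal.antidiagonal m, F p.1 * F' p.2 :=
  summable_sum_mul_antidiagonal_of_summable_mul (f := F) (g := F') (h.mul_of_nonneg h' h0 h0')

theorem conv_mul {σ : Type*} {f g : MvPowerSeries σ 𝕜}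
    (hf : ∃ r : ℝ, 0 < r ∧ Summable fun m => ‖MvPowerSeries.coeff m f‖ * r ^ m.degree)
    (hg : ∃ r : ℝ, 0 < r ∧ Summable fun m => ‖MvPowerSeries.coeff m g‖ * r ^ m.degree) :
    ∃ r : ℝ, 0 < r ∧ Summable fun m => ‖MvPowerSeries.coeff m (f * g)‖ * r ^ m.degree := by
  classical
  obtain ⟨r, hr, h, h'⟩ := conv_add 𝕜 hf hg
  have hs := summable_antidiagonal h h' (fun m => by positivity) (fun m => by positivity)
  refine ⟨r, hr, Summable.of_nonneg_of_le (fun m => by positivity) (fun m => ?_) hs⟩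
  have h1 : ‖MvPowerSeries.coeff m (f * g)‖ ≤ ∑ p ∈ Finset.HasAntidiagonal.antidiagonal m,
      ‖MvPowerSeries.coeff p.1 f‖ * ‖MvPowerSeries.coeff p.2 g‖ := by
    rw [MvPowerSeries.coeff_mul]
    exact (norm_sum_le _ _).trans (Finset.sum_le_sum fun p _ => norm_mul_le _ _)
  refine (mul_le_mul_of_nonneg_right h1 (by positivity)).trans (le_of_eq ?_)
  rw [Finset.sum_mul]
  refine Finset.sum_congr rfl fun p hp => ?_
  have h2 : m.degree = p.1.degree + p.2.degree := by
    rw [← Finset.HasAntidiagonal.mem_antidiagonal.mp hp, map_add]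
  rw [h2, pow_add]
  ring

/-- The algebra of convergent power series in the variables `σ`, the local ring `𝒪₀` of analytic
functions on `𝕜^σ` at the origin. -/
def Conv (σ : Type*) : Subalgebra 𝕜 (MvPowerSeries σ 𝕜) where
  carrier := {f | ∃ r : ℝ, 0 < r ∧ Summable fun m => ‖MvPowerSeries.coeff m f‖ * r ^ m.degree}
  add_mem' {f g} hf hg := by
    obtain ⟨r, hr, h, h'⟩ := conv_add 𝕜 hf hg
    refine ⟨r, hr, Summable.of_nonneg_of_le (fun m => by positivity) (fun m => ?_) (h.add h')⟩
    rw [map_add, ← add_mul]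
    gcongr
    exact norm_add_le _ _
  mul_mem' {_ _} hf hg := conv_mul 𝕜 hf hg
  algebraMap_mem' c := by
    classical
    refine ⟨1, one_pos, summable_of_hasFiniteSupport ((Set.finite_singleton 0).subset fun m hm => ?_)⟩
    by_contra h
    apply hm
    simp only [Set.mem_singleton_iff] at h
    simp [MvPowerSeries.algebraMap_apply, MvPowerSeries.coeff_C, h]

/-- The coordinate functions. -/
noncomputable def Conv.X {σ : Type*} (i : σ) : Conv 𝕜 σ :=
  ⟨MvPowerSeries.X i, by
    classical
    refine ⟨1, one_pos, summable_of_hasFiniteSupport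
      ((Set.finite_singleton (Finsupp.single i 1)).subset fun m hm => ?_)⟩
    by_contra h
    apply hm
    simp only [Set.mem_singleton_iff] at h
    simp [MvPowerSeries.coeff_X, h]⟩

variable {ι : Type*} (δ : ι → ℤ)

/-- The analytic germ at `0` of the linear supermanifold `V[1]`, where `V` is a graded vector space
with a basis `(γ_α)` of degrees `δ α`. The coordinate `t_α` has degree `1 - δ α`. So `t_α` is even if
`δ α` is odd, and the germ is `𝕜{t_α : δ α odd} ⊗ Λ(t_α : δ α even)`. -/
abbrev SuperGerm : Type _ :=
  ExteriorAlgebra (Conv 𝕜 {α // Odd (δ α)}) ({α // ¬ Odd (δ α)} → Conv 𝕜 {α // Odd (δ α)})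

open Classical in
/-- The coordinates `t_α`. -/
noncomputable def SuperGerm.t (α : ι) : SuperGerm 𝕜 δ :=
  if h : Odd (δ α) then algebraMap (Conv 𝕜 {α // Odd (δ α)}) _ (Conv.X 𝕜 ⟨α, h⟩)
  else ExteriorAlgebra.ι _ (Pi.single ⟨α, h⟩ 1)

variable {𝕜}

/-- `B`-points of the germ: local homomorphisms of graded algebras from `SuperGerm 𝕜 δ` to `B`. -/
def SuperPoint (B : GradedArtin.{u, v} 𝕜) : Type _ :=
  {φ : SuperGerm 𝕜 δ →ₐ[𝕜] B // ∀ α, φ (SuperGerm.t 𝕜 δ α) ∈ B.gr (1 - δ α) ⊓ B.max}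

/-- Functoriality of `SuperPoint`. -/
noncomputable def SuperPoint.map {B B' : GradedArtin.{u, v} 𝕜} (f : GradedArtin.Hom B B') (φ : SuperPoint δ B) :
    SuperPoint δ B' :=
  ⟨f.toAlgHom.comp φ.1, fun α => ⟨f.map_gr _ _ (φ.2 α).1, f.map_max (φ.2 α).2⟩⟩

/-- `B`-points of the germ `(𝕜^ι, 0)` for `B` in degree zero: local homomorphisms from the algebra
of convergent power series to `B`. -/
def GermPoint (ι : Type*) (B : GradedArtin.{u, v} 𝕜) : Type _ :=
  {φ : Conv 𝕜 ι →ₐ[𝕜] B // ∀ α, φ (Conv.X 𝕜 α) ∈ B.max}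

/-- Functoriality of `GermPoint`. -/
noncomputable def GermPoint.map {ι : Type*} {B B' : GradedArtin.{u, v} 𝕜} (f : GradedArtin.Hom B B')
    (φ : GermPoint ι B) : GermPoint ι B' :=
  ⟨f.toAlgHom.comp φ.1, fun α => f.map_max (φ.2 α)⟩

end Germ

/-! ### Completions -/

section Analytic

variable {𝕜 : Type u} [RCLike 𝕜] {G : Type w} [NormedAddCommGroup G] [NormedSpace 𝕜 G]

/-- Extension of a continuous bilinear map to the completions. -/
noncomputable def complBilin {E F K : Type*} [NormedAddCommGroup E] [NormedSpace 𝕜 E]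
    [NormedAddCommGroup F] [NormedSpace 𝕜 F] [NormedAddCommGroup K] [NormedSpace 𝕜 K]
    (b : E →L[𝕜] F →L[𝕜] K) : Completion E →L[𝕜] Completion F →L[𝕜] Completion K :=
  let b₁ : E →L[𝕜] F →L[𝕜] Completion K :=
    (ContinuousLinearMap.compL 𝕜 F K (Completion K) Completion.toComplL).comp b
  ((b₁.extend (Completion.toComplL : E →L[𝕜] Completion E)).flip.extend
    (Completion.toComplL : F →L[𝕜] Completion F)).flip

theorem complBilin_coe {E F K : Type*} [NormedAddCommGroup E] [NormedSpace 𝕜 E]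
    [NormedAddCommGroup F] [NormedSpace 𝕜 F] [NormedAddCommGroup K] [NormedSpace 𝕜 K]
    (b : E →L[𝕜] F →L[𝕜] K) (x : E) (y : F) :
    complBilin b (x : Completion E) (y : Completion F) = (b x y : Completion K) := by
  have hE : DenseRange (Completion.toComplL : E →L[𝕜] Completion E) := Completion.denseRange_coe
  have hF : DenseRange (Completion.toComplL : F →L[𝕜] Completion F) := Completion.denseRange_coe
  have iE : IsUniformInducing (Completion.toComplL : E →L[𝕜] Completion E) :=
    Completion.isUniformInducing_coe E
  have iF : IsUniformInducing (Completion.toComplL : F →L[𝕜] Completion F) :=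
    Completion.isUniformInducing_coe F
  have e1 := fun f : F →L[𝕜] (Completion E →L[𝕜] Completion K) =>
    ContinuousLinearMap.extend_eq f hF iF y
  have e2 := fun f : E →L[𝕜] (F →L[𝕜] Completion K) => ContinuousLinearMap.extend_eq f hE iE x
  simp only [Completion.coe_toComplL] at e1 e2
  simp only [complBilin, ContinuousLinearMap.flip_apply, e1, e2]
  simp

/-- The norm on `E ⊗ B`, for a Banach space `E` and a finite-dimensional `B`, of the coordinates
with respect to a basis of `B` (another basis gives an equivalent norm). -/
noncomputable def tensorCoord (E : Type*) [NormedAddCommGroup E] [NormedSpace 𝕜 E]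
    (B : GradedArtin.{u, v} 𝕜) :
    E ⊗[𝕜] B ≃ₗ[𝕜] (Fin (Module.finrank 𝕜 B) → E) :=
  (TensorProduct.equivFinsuppOfBasisRight (Module.finBasis 𝕜 B)).trans
    (Finsupp.linearEquivFunOnFinite 𝕜 E _)

noncomputable instance (E : Type*) [NormedAddCommGroup E] [NormedSpace 𝕜 E]
    (B : GradedArtin.{u, v} 𝕜) : NormedAddCommGroup (E ⊗[𝕜] B) :=
  NormedAddCommGroup.induced _ _ (tensorCoord E B) (tensorCoord E B).injective

noncomputable instance (E : Type*) [NormedAddCommGroup E] [NormedSpace 𝕜 E]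
    (B : GradedArtin.{u, v} 𝕜) : NormedSpace 𝕜 (E ⊗[𝕜] B) :=
  NormedSpace.induced 𝕜 _ _ (tensorCoord E B)

/-- `κ` maps `M` bijectively onto `N`, is analytic near `M`, and has an analytic inverse `N → M`
which is tangent to the identity at the base point `0`: so `M` is a smooth analytic space, `κ` is an
analytic isomorphism onto `N`, and the tangent space of `M` at `0` is that of `N`. -/
structure IsAnalyticChart (𝕜 : Type u) [RCLike 𝕜] {E : Type*} [NormedAddCommGroup E]
    [NormedSpace 𝕜 E] (κ : E → E) (M N : Set E) : Prop where
  base : (0 : E) ∈ M ∧ (0 : E) ∈ N ∧ κ 0 = 0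
  bijOn : Set.BijOn κ M N
  analytic : AnalyticOnNhd 𝕜 κ M
  inverse : ∃ ψ : E → E, AnalyticOn 𝕜 ψ N ∧ Set.InvOn ψ κ M N ∧
    HasFDerivWithinAt ψ (ContinuousLinearMap.id 𝕜 E) N 0

variable {𝒢 : ℤ → Submodule 𝕜 G} [DirectSum.Decomposition 𝒢] {D : NormedDGLA 𝕜 𝒢}

namespace Hodge

variable (S : Hodge D)

/-- The operations `d`, `[ , ]`, `η` are continuous on `𝔤` with its norm `‖∑ xᵢ‖ = ∑ ‖xᵢ‖`, so that
they extend to the completion of `𝔤`. This is automatic if only finitely many `𝔤ⁱ` are nonzero. -/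
structure ContinuousOps (S : Hodge D) : Prop where
  d : ∃ C : ℝ, ∀ x, ‖D.d x‖ ≤ C * ‖x‖
  br : ∃ C : ℝ, ∀ x y, ‖D.br x y‖ ≤ C * ‖x‖ * ‖y‖
  η : ∃ C : ℝ, ∀ x, ‖S.η x‖ ≤ C * ‖x‖

/-- Extension of a bounded linear map to the completion. -/
noncomputable def extendHat (f : G →ₗ[𝕜] G) : Completion G →ₗ[𝕜] Completion G :=
  (LinearMap.extendOfNorm ((Completion.toComplL : G →L[𝕜] Completion G).toLinearMap ∘ₗ f)
    (Completion.toComplL : G →L[𝕜] Completion G).toLinearMap).toLinearMap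

/-- The operations on the completion of `𝔤`. -/
noncomputable def opsHat {S : Hodge D} (h : S.ContinuousOps) : Ops 𝕜 (Completion G) where
  d := extendHat D.d
  br := ContinuousLinearMap.toLinearMap₁₂
    (complBilin (LinearMap.mkContinuousOfExistsBound₂ D.br h.br))
  η := extendHat S.η

/-- The operations on `ĝ ⊗ B`, where `ĝ` is the completion of `𝔤`. -/
noncomputable def opsHatT {S : Hodge D} (h : S.ContinuousOps) (B : GradedArtin.{u, v} 𝕜) :
    Ops 𝕜 (Completion G ⊗[𝕜] B) :=
  (opsHat h).tensor (extendHat (parity 𝒢)) B (parity B.gr)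

/-- The body `ĝ ⊗ B → ĝ` of a `B`-point. -/
noncomputable def body (E : Type*) [AddCommGroup E] [Module 𝕜 E] (B : GradedArtin.{u, v} 𝕜) :
    E ⊗[𝕜] B →ₗ[𝕜] E :=
  (TensorProduct.rid 𝕜 E).toLinearMap ∘ₗ B.aug.toLinearMap.lTensor E

/-- The `B`-points of the linear superspace `ĝ[1]`: the elements of `ĝ ⊗ B` of odd total parity. -/
def OddPoints (𝒢 : ℤ → Submodule 𝕜 G) [DirectSum.Decomposition 𝒢] (B : GradedArtin.{u, v} 𝕜) :
    Set (Completion G ⊗[𝕜] B) :=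
  {Γ | TensorProduct.map (extendHat (parity 𝒢)) (parity B.gr) Γ = -Γ}

/-- The moduli superspace `M^ℤ` as the functor of points `B ↦ M^ℤ(B)`: the solutions
of the Maurer–Cartan equation in the part of odd total parity of `ĝ ⊗ B`, in the slice
`Ker dη` (the complement of the coboundaries `Im d = Im dη` given by the Hodge decomposition), with
body in the open set `U`. The supermanifold is `ℤ/2`-graded, so only the parity of `B` enters. -/
def ModZ {S : Hodge D} (h : S.ContinuousOps) (U : Set (Completion G)) (B : GradedArtin.{u, v} 𝕜) :
    Set (Completion G ⊗[𝕜] B) :=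
  {Γ | Γ ∈ OddPoints 𝒢 B ∧ body _ B Γ ∈ U ∧ (opsHatT h B).d ((opsHatT h B).η Γ) = 0 ∧
    HasSum ((opsHatT h B).mcTerm Γ) 0}

/-- The `B`-points, with body in `V`, of the linear superspace `H*(𝔤)[1]`. -/
def HarmZ (S : Hodge D) (V : Set (Completion G)) (B : GradedArtin.{u, v} 𝕜) :
    Set (Completion G ⊗[𝕜] B) :=
  {x | x ∈ LinearMap.range (((Completion.toComplL : G →L[𝕜] Completion G).toLinearMap ∘ₗ
      S.harmonic.subtype).rTensor B) ∧ x ∈ OddPoints 𝒢 B ∧ body _ B x ∈ V}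

/-- The part `(ĝ ⊗ m_B)¹` of total `ℤ`-degree one. -/
noncomputable def degHat (_S : Hodge D) (B : GradedArtin.{u, v} 𝕜) :
    Submodule 𝕜 (Completion G ⊗[𝕜] B) :=
  ⨆ i : ℤ, LinearMap.range (TensorProduct.mapIncl
    ((𝒢 i).map (Completion.toComplL : G →L[𝕜] Completion G).toLinearMap).topologicalClosure
    (B.gr (1 - i) ⊓ B.max))

/-- The differential `𝔤ⁱ → 𝔤ⁱ⁺¹`. -/
noncomputable def dDeg (_S : Hodge D) (i : ℤ) : 𝒢 i →L[𝕜] 𝒢 (i + 1) :=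
  LinearMap.mkContinuousOfExistsBound (D.d.restrict (D.d_mem i)) <| by
    obtain ⟨C, hC⟩ := D.bound_d i
    exact ⟨C, fun x => hC x x.2⟩

/-- The homotopy `𝔤ⁱ → 𝔤ⁱ⁻¹`. -/
noncomputable def ηDeg (S : Hodge D) (i : ℤ) : 𝒢 i →L[𝕜] 𝒢 (i - 1) :=
  LinearMap.mkContinuousOfExistsBound (S.η.restrict (S.η_mem i)) <| by
    obtain ⟨C, hC⟩ := S.bound_η i
    exact ⟨C, fun x => hC x x.2⟩

/-- The bracket `𝔤ⁱ × 𝔤ʲ → 𝔤ⁱ⁺ʲ`. -/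
noncomputable def brDeg (_S : Hodge D) (i j : ℤ) : 𝒢 i →L[𝕜] 𝒢 j →L[𝕜] 𝒢 (i + j) :=
  LinearMap.mkContinuousOfExistsBound₂
    (LinearMap.mk₂ 𝕜 (fun (x : 𝒢 i) (y : 𝒢 j) => (⟨D.br x y, D.br_mem i j x x.2 y y.2⟩ : 𝒢 (i + j)))
      (fun _ _ _ => Subtype.ext (by simp)) (fun _ _ _ => Subtype.ext (by simp))
      (fun _ _ _ => Subtype.ext (by simp)) (fun _ _ _ => Subtype.ext (by simp))) <| by
    obtain ⟨C, hC⟩ := D.bound_br i j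
    exact ⟨C, fun x y => hC x x.2 y y.2⟩

/-- The direct sum `⨁ᵢ ĝⁱ` of the completions of the normed spaces `𝔤ⁱ`. -/
abbrev GrHat (𝒢 : ℤ → Submodule 𝕜 G) : Type w := ⨁ i : ℤ, Completion (𝒢 i)

/-- The operations on `⨁ᵢ ĝⁱ`. -/
noncomputable def opsGr (S : Hodge D) : Ops 𝕜 (GrHat 𝒢) where
  d := DirectSum.toModule 𝕜 ℤ _ fun i =>
    DirectSum.lof 𝕜 ℤ (fun i => Completion (𝒢 i)) (i + 1) ∘ₗ (S.dDeg i).completion.toLinearMap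
  br := DirectSum.toModule 𝕜 ℤ _ fun i => LinearMap.flip <| DirectSum.toModule 𝕜 ℤ _ fun j =>
    LinearMap.flip <| (ContinuousLinearMap.toLinearMap₁₂ (complBilin (S.brDeg i j))).compr₂
      (DirectSum.lof 𝕜 ℤ (fun i => Completion (𝒢 i)) (i + j))
  η := DirectSum.toModule 𝕜 ℤ _ fun i =>
    DirectSum.lof 𝕜 ℤ (fun i => Completion (𝒢 i)) (i - 1) ∘ₗ (S.ηDeg i).completion.toLinearMap

/-- An element of `ĝ¹` in `⨁ᵢ ĝⁱ`. -/
noncomputable def inOne (Γ : Completion (𝒢 1)) : GrHat 𝒢 :=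
  DirectSum.lof 𝕜 ℤ (fun i => Completion (𝒢 i)) 1 Γ

/-- The moduli space `M⁰`: the solutions `Γ ∈ U ⊆ ĝ¹` of the Maurer–Cartan equation (in `ĝ²`) in
the slice `Ker dη`. -/
def Mod0 (S : Hodge D) (U : Set (Completion (𝒢 1))) : Set (Completion (𝒢 1)) :=
  {Γ | Γ ∈ U ∧ S.opsGr.d (S.opsGr.η (inOne Γ)) = 0 ∧
    HasSum (fun k => S.opsGr.mcTerm (inOne Γ) k 2) 0}

/-- The Kuranishi map followed by the harmonic projection, on `ĝ¹`. -/
noncomputable def kappa0 (S : Hodge D) (Γ : Completion (𝒢 1)) : Completion (𝒢 1) :=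
  S.opsGr.kappa (inOne Γ) 1

/-- The part in `V` of `H¹(𝔤)`, realised as the harmonic part of `𝔤¹ ⊆ ĝ¹`. -/
def Harm0 (S : Hodge D) (V : Set (Completion (𝒢 1))) : Set (Completion (𝒢 1)) :=
  {x | x ∈ V ∧ ∃ y : 𝒢 1, (y : G) ∈ S.harmonic ∧ x = (y : Completion (𝒢 1))}

end Hodge

end Analytic

end Kuranishi

/-!
Throughout, `σ` denotes a parity involution `x ↦ (-1)^|x| x`.

**The Maurer–Cartan equation is `dK(Γ) = 0`.** The partial sums `Pₙ` of the Maurer–Cartan series of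
an odd element `Γ` satisfy a first order recursion: `Pₙ₊₁ - η[Pₙ, Γ] = -dK(Γ)`, where `K(Γ) = Γ +
½η[Γ, Γ]` (`Ops.IsSuper.sum_mcTerm`). It uses only that `d` is an odd derivation of the bracket with
`d² = 0`, the graded antisymmetry, and the relations `dηd = d` and `dη²d = 0` of the Hodge
decomposition; the Jacobi identity plays no role. Hence, whenever `x ↦ η[x, Γ]` is nilpotent or, up
to a nilpotent operator, a contraction, the series converges, and it converges to zero if and only
if `dK(Γ) = 0` (`Hodge.mem_MC_iff` on `𝔤 ⊗ m_B`; `hasSum_mcTerm_iff` on completions). The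
identities needed are collected in `Ops.IsSuper`, with all signs expressed through `σ`. In this form
they are identities of multilinear maps, so they pass to `𝔤 ⊗ B`, to the completion of `𝔤` and to
the sum of the completions of the `𝔤ⁱ`.

**The functors.** On `𝔤 ⊗ m_B` the map `K` is a bijection, and it carries the solutions of the
Maurer–Cartan equation to the cocycles of degree one. Its derivative at a solution `Γ` carries `d_Γ
v` to `d(v + η[Γ, v])`, and `v ↦ v + η[Γ, v]` is bijective, so gauge paths become paths of cocycles
whose velocity is a coboundary. Consequently the gauge classes are the cohomology classes, and `κ`
identifies them with the harmonic elements of degree one (`Hodge.mdefEquiv`). For a graded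
complement `C` of `Im d`, each harmonic `h` is `κ(Γ)` for exactly one solution `Γ` in `C`, because
`Γ` is determined by a fixed-point equation whose nonlinear part raises the filtration by powers of
`m_B` (`Hodge.bijective_kappa_mdefC`). Finally a local homomorphism from the analytic germ to `B` is
the same thing as a choice of the images of the coordinates, in `m_B` and of the right degrees:
convergence is immaterial, since a power of the maximal ideal of the germ is mapped to zero. These
images are exactly the coordinates of a harmonic element of `𝔤 ⊗ m_B` of degree one
(`Hodge.exists_superPoint_equiv`, `Hodge.exists_germPoint_equiv`). For `B = k[ε]` the harmonic
elements of degree one are the `z ⊗ ε`, which gives the tangent spaces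
(`Hodge.exists_tangent_equiv`).

**The moduli spaces.** On the slice `dηΓ = 0`, the equations `dK(Γ) = 0` and `κ(Γ) = h` together are
the single equation `Γ + Q(Γ, Γ) = h` with the bounded quadratic term `Q = ½(1 - dη)η[ , ]`
(harmonic `h`). On the completion the inverse function theorem solves it analytically near zero
(`exists_quadratic_inverse`). With coefficients in `B` one solves first for the body; the remaining
equation for the part with coefficients in `m_B` is solved by finitely many Newton steps, each an
analytic operation, because its linear part is invertible modulo the filtration (`NewtonData`,
`exists_sliceChart`). The points of degree one over the base point have body zero, and
such solutions lie in `𝔤 ⊗ m_B`, because the harmonic space is finite-dimensional and so is not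
enlarged by completion.
-/

namespace Kuranishi

/-! ### Super operations and the Maurer–Cartan series -/

section Super

variable {𝕜 : Type*} [Field 𝕜] {A : Type*} [AddCommGroup A] [Module 𝕜 A]

/-- The identities between `d`, `[ , ]`, `η` and the parity involution `σ` that the Kuranishi map
rests on. Signs are expressed through `σ`, and graded antisymmetry is polarised, so that every field
is an identity between multilinear maps; such identities pass to tensor products and completions.
The Jacobi identity is not among them. -/
structure Ops.IsSuper (o : Ops 𝕜 A) (σ : A →ₗ[𝕜] A) : Prop where
  σ_σ : ∀ x, σ (σ x) = x
  σ_d : ∀ x, σ (o.d x) = -o.d (σ x)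
  σ_η : ∀ x, σ (o.η x) = -o.η (σ x)
  σ_br : ∀ x y, σ (o.br x y) = o.br (σ x) (σ y)
  d_d : ∀ x, o.d (o.d x) = 0
  d_η_d : ∀ x, o.d (o.η (o.d x)) = o.d x
  d_η_η_d : ∀ x, o.d (o.η (o.η (o.d x))) = 0
  leibniz : ∀ x y, o.d (o.br x y) = o.br (o.d x) y + o.br (σ x) (o.d y)
  symm : ∀ x y, (2 : 𝕜) • o.br x y =
    -(o.br y x + o.br (σ y) x + o.br y (σ x) - o.br (σ y) (σ x))

/-- The harmonic projection `Id - dη - ηd` as a linear map. -/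
def Ops.harmL (o : Ops 𝕜 A) : A →ₗ[𝕜] A := LinearMap.id - o.d ∘ₗ o.η - o.η ∘ₗ o.d

theorem Ops.harmL_apply (o : Ops 𝕜 A) (x : A) : o.harmL x = o.harm x := rfl

theorem Ops.map_harm {A' : Type*} [AddCommGroup A'] [Module 𝕜 A'] (o : Ops 𝕜 A) (o' : Ops 𝕜 A')
    (h : A →ₗ[𝕜] A') (hd : ∀ x, h (o.d x) = o'.d (h x)) (hη : ∀ x, h (o.η x) = o'.η (h x)) (x : A) :
    h (o.harm x) = o'.harm (h x) := by
  simp [Ops.harm, hd, hη]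

theorem Ops.map_kur {A' : Type*} [AddCommGroup A'] [Module 𝕜 A'] (o : Ops 𝕜 A) (o' : Ops 𝕜 A')
    (h : A →ₗ[𝕜] A') (hη : ∀ x, h (o.η x) = o'.η (h x))
    (hb : ∀ x y, h (o.br x y) = o'.br (h x) (h y)) (x : A) :
    h (o.kur x) = o'.kur (h x) := by
  simp [Ops.kur, hη, hb]

theorem Ops.map_kappa {A' : Type*} [AddCommGroup A'] [Module 𝕜 A'] (o : Ops 𝕜 A) (o' : Ops 𝕜 A')
    (h : A →ₗ[𝕜] A') (hd : ∀ x, h (o.d x) = o'.d (h x)) (hη : ∀ x, h (o.η x) = o'.η (h x))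
    (hb : ∀ x y, h (o.br x y) = o'.br (h x) (h y)) (x : A) :
    h (o.kappa x) = o'.kappa (h x) := by
  rw [Ops.kappa, Ops.map_harm o o' h hd hη, Ops.map_kur o o' h hη hb, Ops.kappa]

namespace Ops.IsSuper

variable {o : Ops 𝕜 A} {σ : A →ₗ[𝕜] A}

theorem harm_d (H : o.IsSuper σ) (x : A) : o.harm (o.d x) = 0 := by
  simp [Ops.harm, H.d_d, H.d_η_d]

theorem d_harm (H : o.IsSuper σ) (x : A) : o.d (o.harm x) = 0 := by
  simp [Ops.harm, H.d_d, H.d_η_d]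

theorem d_η_harm (H : o.IsSuper σ) (x : A) : o.d (o.η (o.harm x)) = 0 := by
  simp [Ops.harm, H.d_η_η_d, H.d_η_d]

theorem harm_harm (H : o.IsSuper σ) (x : A) : o.harm (o.harm x) = o.harm x := by
  conv_lhs => rw [Ops.harm, H.d_harm, H.d_η_harm]
  simp

theorem σ_d_odd (H : o.IsSuper σ) {x : A} (hx : σ x = -x) : σ (o.d x) = o.d x := by
  rw [H.σ_d, hx, map_neg, neg_neg]

variable [CharZero 𝕜]

theorem br_comm_odd (H : o.IsSuper σ) {x y : A} (hx : σ x = -x) (hy : σ y = -y) :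
    o.br x y = o.br y x := by
  have h := H.symm x y
  rw [hx, hy] at h
  have h2 : (2 : 𝕜) • (o.br x y - o.br y x) = 0 := by
    rw [smul_sub, h]; simp; module
  exact sub_eq_zero.mp ((smul_eq_zero.mp h2).resolve_left two_ne_zero)

theorem br_comm_even (H : o.IsSuper σ) {x : A} (y : A) (hx : σ x = x) :
    o.br x y = -o.br y x := by
  have h := H.symm x y
  rw [hx] at h
  have h2 : (2 : 𝕜) • (o.br x y + o.br y x) = 0 := by
    rw [smul_add, h]; module
  exact eq_neg_of_add_eq_zero_left ((smul_eq_zero.mp h2).resolve_left two_ne_zero)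

/-- For odd `Γ` the differential of the bracket square is twice a bracket, whence
`½ ηd[Γ, Γ] = η[dΓ, Γ]`. -/
theorem half_d_br_self (H : o.IsSuper σ) {Γ : A} (hΓ : σ Γ = -Γ) :
    (2⁻¹ : 𝕜) • o.d (o.br Γ Γ) = o.br (o.d Γ) Γ := by
  rw [H.leibniz, hΓ, map_neg, LinearMap.neg_apply, H.br_comm_even Γ (H.σ_d_odd hΓ)]
  module

end Ops.IsSuper

/-! ### Recursions for the Maurer–Cartan series and the deformed differential -/

theorem unshuffleSign_one {n : ℕ} (j : Fin n) : unshuffleSign (fun _ => 1) j = 1 := by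
  simp [unshuffleSign]

theorem unshuffleSign_snoc_last {n : ℕ} :
    unshuffleSign (Fin.snoc (α := fun _ => ℤ) (fun _ : Fin n => 1) 0) (Fin.last n) = 1 := by
  refine Finset.prod_eq_one fun i hi => ?_
  exact absurd (Finset.mem_filter.mp hi).2 (Fin.le_last i).not_gt

theorem unshuffleSign_snoc_castSucc {n : ℕ} (j : Fin n) :
    unshuffleSign (Fin.snoc (α := fun _ => ℤ) (fun _ : Fin n => 1) 0) j.castSucc = -1 := by
  rw [unshuffleSign, Finset.prod_filter, Fin.prod_univ_castSucc]
  simp [Fin.castSucc_lt_last]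

theorem snoc_comp_succAbove_castSucc {α : Type*} {n : ℕ} (a b : α) (j : Fin (n + 1)) :
    (fun i => Fin.snoc (α := fun _ => α) (fun _ : Fin (n + 1) => a) b (j.castSucc.succAbove i)) =
      Fin.snoc (α := fun _ => α) (fun _ : Fin n => a) b := by
  funext i
  refine Fin.lastCases ?_ (fun i => ?_) i
  · have : j.castSucc.succAbove (Fin.last n) = Fin.last (n + 1) := by
      rw [Fin.succAbove_of_lt_succ _ _ (by simp [Fin.lt_def]; omega), Fin.succ_last]
    rw [this]; simp
  · rw [Fin.castSucc_succAbove_castSucc]; simp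

theorem snoc_comp_succAbove_last {α : Type*} {n : ℕ} (a b : α) :
    (fun i => Fin.snoc (α := fun _ => α) (fun _ : Fin n => a) b ((Fin.last n).succAbove i)) =
      fun _ => a := by
  funext i
  simp

theorem neg_one_pow_tri_succ (R : Type*) [CommRing R] (k : ℕ) :
    (-1 : R) ^ ((k + 1) * (k + 2) / 2) = (-1) ^ (k + 1) * (-1) ^ (k * (k + 1) / 2) := by
  rw [← pow_add]
  congr 1
  have : (k + 1) * (k + 2) = k * (k + 1) + (k + 1) * 2 := by ring
  rw [this, Nat.add_mul_div_right _ _ two_pos, add_comm]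

theorem neg_one_pow_mul_self (R : Type*) [CommRing R] (k : ℕ) : (-1 : R) ^ k * (-1) ^ k = 1 := by
  rw [← mul_pow]; simp

theorem units_pow_smul (𝕜 : Type*) [Field 𝕜] {A : Type*} [AddCommGroup A] [Module 𝕜 A] (n : ℕ)
    (x : A) : ((-1 : ℤˣ) ^ n) • x = ((-1 : 𝕜) ^ n) • x := by
  rcases Nat.even_or_odd n with h | h <;> simp [h.neg_one_pow]

theorem Ops.mu_const (o : Ops 𝕜 A) (Γ : A) (n : ℕ) :
    o.mu (n + 3) (fun _ => 1) (fun _ => Γ) =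
      ((-1 : 𝕜) ^ (n + 3) * (n + 3 : ℕ)) •
        o.η (o.br (o.mu (n + 2) (fun _ => 1) (fun _ => Γ)) Γ) := by
  simp only [Ops.mu, unshuffleSign_one, one_smul, Finset.sum_const, Finset.card_univ,
    Fintype.card_fin]
  rw [units_pow_smul 𝕜, mul_smul, Nat.cast_smul_eq_nsmul]

theorem Ops.mu_snoc (o : Ops 𝕜 A) (Γ v : A) (n : ℕ) :
    o.mu (n + 3) (Fin.snoc (α := fun _ => ℤ) (fun _ => 1) 0)
        (Fin.snoc (α := fun _ => A) (fun _ => Γ) v) =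
      ((-1 : 𝕜) ^ (n + 3)) • (o.η (o.br (o.mu (n + 2) (fun _ => 1) (fun _ => Γ)) v) -
        ((n + 2 : ℕ) : 𝕜) • o.η (o.br (o.mu (n + 2) (Fin.snoc (α := fun _ => ℤ) (fun _ => 1) 0)
          (Fin.snoc (α := fun _ => A) (fun _ => Γ) v)) Γ)) := by
  rw [Ops.mu, units_pow_smul 𝕜, Fin.sum_univ_castSucc]
  simp only [unshuffleSign_snoc_castSucc, unshuffleSign_snoc_last, snoc_comp_succAbove_castSucc,
    snoc_comp_succAbove_last, Fin.snoc_castSucc, Fin.snoc_last, Finset.sum_const, Finset.card_univ,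
    Fintype.card_fin, one_smul]
  rw [Nat.cast_smul_eq_nsmul]
  congr 1
  rw [add_comm, sub_eq_add_neg, ← smul_neg]
  simp [Units.smul_def]

theorem Ops.mcTerm_zero (o : Ops 𝕜 A) (Γ : A) : o.mcTerm Γ 0 = 0 := by simp [Ops.mcTerm, Ops.mu]

theorem Ops.mcTerm_one (o : Ops 𝕜 A) (Γ : A) : o.mcTerm Γ 1 = -o.d Γ := by
  simp [Ops.mcTerm, Ops.mu]

theorem Ops.mcTerm_two (o : Ops 𝕜 A) (Γ : A) :
    o.mcTerm Γ 2 = -(2⁻¹ : 𝕜) • (o.d (o.η (o.br Γ Γ)) + o.η (o.d (o.br Γ Γ))) := by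
  simp only [Ops.mcTerm, Ops.mu]
  congr 1
  norm_num [neg_div]

theorem Ops.twistTerm_zero (o : Ops 𝕜 A) (Γ v : A) : o.twistTerm Γ v 0 = o.d v := by
  simp [Ops.twistTerm, Ops.mu, Fin.snoc]

theorem Ops.twistTerm_one (o : Ops 𝕜 A) (Γ v : A) :
    o.twistTerm Γ v 1 = o.d (o.η (o.br Γ v)) + o.η (o.d (o.br Γ v)) := by
  simp [Ops.twistTerm, Ops.mu, Fin.snoc, Odd.neg_one_pow (show Odd 3 by decide)]

variable [CharZero 𝕜]

theorem Ops.mcTerm_succ (o : Ops 𝕜 A) (Γ : A) (n : ℕ) :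
    o.mcTerm Γ (n + 3) = o.η (o.br (o.mcTerm Γ (n + 2)) Γ) := by
  simp only [Ops.mcTerm, o.mu_const, map_smul, LinearMap.smul_apply, smul_smul]
  congr 1
  have h3 : ((n + 3 : ℕ) : 𝕜) ≠ 0 := Nat.cast_ne_zero.mpr (by omega)
  have h4 : (((n + 2).factorial : ℕ) : 𝕜) ≠ 0 := Nat.cast_ne_zero.mpr (Nat.factorial_ne_zero _)
  rw [neg_one_pow_tri_succ 𝕜 (n + 2), show n + 2 + 1 = n + 3 from rfl, Nat.factorial_succ (n + 2),
    show n + 2 + 1 = n + 3 from rfl, Nat.cast_mul, div_mul_eq_mul_div, div_eq_div_iff (by positivity) h4]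
  linear_combination (((n + 3 : ℕ) : 𝕜) * ((n + 2).factorial : 𝕜) * (-1) ^ ((n + 2) * (n + 3) / 2)) *
    neg_one_pow_mul_self 𝕜 (n + 3)

theorem Ops.twistTerm_succ (o : Ops 𝕜 A) (Γ v : A) (n : ℕ) :
    o.twistTerm Γ v (n + 2) =
      -o.η (o.br (o.mcTerm Γ (n + 2)) v) - o.η (o.br (o.twistTerm Γ v (n + 1)) Γ) := by
  simp only [Ops.twistTerm, Ops.mcTerm]
  have key : o.mu (n + 2 + 1) (Fin.snoc (α := fun _ => ℤ) (fun _ => 1) 0)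
      (Fin.snoc (α := fun _ => A) (fun _ => Γ) v) = _ := o.mu_snoc Γ v n
  rw [key]
  simp only [map_smul, LinearMap.smul_apply, smul_smul, smul_sub]
  have h2 : ((n + 2 : ℕ) : 𝕜) ≠ 0 := Nat.cast_ne_zero.mpr (by omega)
  have h4 : (((n + 1).factorial : ℕ) : 𝕜) ≠ 0 := Nat.cast_ne_zero.mpr (Nat.factorial_ne_zero _)
  have h5 : (((n + 2).factorial : ℕ) : 𝕜) = ((n + 2 : ℕ) : 𝕜) * ((n + 1).factorial : 𝕜) := by
    rw [Nat.factorial_succ (n + 1), Nat.cast_mul]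
  have e := neg_one_pow_tri_succ 𝕜 (n + 2)
  rw [show n + 2 + 1 = n + 3 from rfl, show n + 2 + 2 = n + 4 from rfl] at e
  have hs := neg_one_pow_mul_self 𝕜 (n + 3)
  rw [← neg_smul]
  congr 1
  · congr 1
    rw [show n + 2 + 1 = n + 3 from rfl, show n + 2 + 2 = n + 4 from rfl, e]
    linear_combination (-((-1) ^ ((n + 2) * (n + 3) / 2) / ((n + 2).factorial : 𝕜))) * hs
  · congr 1
    rw [show n + 2 + 1 = n + 3 from rfl, show n + 2 + 2 = n + 4 from rfl,
      show n + 1 + 1 = n + 2 from rfl, show n + 1 + 2 = n + 3 from rfl, e, h5]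
    generalize ((n + 2 : ℕ) : 𝕜) = c at h2
    generalize (-1 : 𝕜) ^ (n + 3) = a at hs
    generalize (-1 : 𝕜) ^ ((n + 2) * (n + 3) / 2) = T
    generalize (((n + 1).factorial : ℕ) : 𝕜) = F at h4
    rw [show -(a * T / (c * F)) * (a * c) = -((a * a) * T * c / (c * F)) by ring, hs]
    field_simp

namespace Ops.IsSuper

variable {o : Ops 𝕜 A} {σ : A →ₗ[𝕜] A}

/-- The partial sums `Pₙ` of the Maurer–Cartan series satisfy `Pₙ₊₁ - η[Pₙ, Γ] = -dK(Γ)`, where `K`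
is the Kuranishi map. This turns the Maurer–Cartan equation into `dK(Γ) = 0`. -/
theorem sum_mcTerm (H : o.IsSuper σ) {Γ : A} (hΓ : σ Γ = -Γ) (n : ℕ) :
    ∑ k ∈ Finset.range (n + 3), o.mcTerm Γ k -
      o.η (o.br (∑ k ∈ Finset.range (n + 2), o.mcTerm Γ k) Γ) = -o.d (o.kur Γ) := by
  induction n with
  | zero =>
    have h := congrArg o.η (H.half_d_br_self hΓ)
    rw [map_smul] at h
    simp only [Finset.sum_range_succ, Finset.sum_range_zero, o.mcTerm_zero, o.mcTerm_one,
      o.mcTerm_two, Ops.kur, map_add, map_smul, zero_add, map_neg, LinearMap.neg_apply, ← h]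
    module
  | succ n ih =>
    rw [Finset.sum_range_succ, ← ih, Finset.sum_range_succ _ (n + 2), o.mcTerm_succ]
    simp only [map_add, LinearMap.add_apply]
    abel

/-- The partial sums `Uₙ` of the deformed differential `d_Γ v` satisfy
`Uₙ₊₁ + η[Uₙ, Γ] + η[Pₙ₊₁, v] = d(v + η[Γ, v])`, where `Pₙ` are those of the Maurer–Cartan series.
So on solutions the Kuranishi map transports `d_Γ` to `d`. -/
theorem sum_twistTerm (H : o.IsSuper σ) {Γ v : A} (hΓ : σ Γ = -Γ) (hv : σ v = v) (n : ℕ) :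
    ∑ k ∈ Finset.range (n + 2), o.twistTerm Γ v k +
        o.η (o.br (∑ k ∈ Finset.range (n + 1), o.twistTerm Γ v k) Γ) +
        o.η (o.br (∑ k ∈ Finset.range (n + 2), o.mcTerm Γ k) v) =
      o.d (v + o.η (o.br Γ v)) := by
  induction n with
  | zero =>
    have h1 : σ (o.d v) = -o.d v := by rw [H.σ_d, hv]
    have h := H.leibniz Γ v
    rw [hΓ, map_neg, LinearMap.neg_apply, H.br_comm_odd hΓ h1] at h
    simp only [Finset.sum_range_succ, Finset.sum_range_zero, o.mcTerm_zero, o.mcTerm_one,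
      o.twistTerm_zero, o.twistTerm_one, map_add, zero_add, map_neg, LinearMap.neg_apply, h]
    abel
  | succ n ih =>
    rw [Finset.sum_range_succ, ← ih, Finset.sum_range_succ _ (n + 1),
      Finset.sum_range_succ _ (n + 2), o.twistTerm_succ]
    simp only [map_add, LinearMap.add_apply]
    abel

end Ops.IsSuper

/-! ### Tensor products with supercommutative algebras -/

section Tensor

variable {B : Type*} [Ring B] [Algebra 𝕜 B]

omit [CharZero 𝕜] in
/-- In a vector space with an involution, a property that is closed under sums holds everywhere if it
holds for eigenvectors. -/
theorem involution_induction [NeZero (2 : 𝕜)] {σ : A →ₗ[𝕜] A} (hσ : ∀ x, σ (σ x) = x) {p : A → Prop}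
    (add : ∀ x y, p x → p y → p (x + y)) (even : ∀ x, σ x = x → p x)
    (odd : ∀ x, σ x = -x → p x) (x : A) : p x := by
  have h2 : (2 : 𝕜) ≠ 0 := NeZero.ne _
  have h : x = (2⁻¹ : 𝕜) • (x + σ x) + (2⁻¹ : 𝕜) • (x - σ x) := by
    rw [← smul_add, show x + σ x + (x - σ x) = (2 : 𝕜) • x by rw [two_smul]; abel, smul_smul,
      inv_mul_cancel₀ h2, one_smul]
  rw [h]
  exact add _ _ (even _ (by simp [hσ, add_comm])) (odd _ (by simp [hσ, ← smul_neg]))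

/-- The axioms of a supercommutative algebra with parity involution `τ`. -/
structure IsSuperComm (τ : B →ₗ[𝕜] B) : Prop where
  τ_τ : ∀ x, τ (τ x) = x
  map_mul : ∀ x y, τ (x * y) = τ x * τ y
  comm_even : ∀ x y, τ x = x → x * y = y * x
  comm_odd : ∀ x y, τ x = -x → τ y = -y → x * y = -(y * x)

theorem tensor_br_even (o : Ops 𝕜 A) (σ : A →ₗ[𝕜] A) (τ : B →ₗ[𝕜] B) (a b : A) (x y : B)
    (hb : σ b = b) : (o.tensor σ B τ).br (a ⊗ₜ x) (b ⊗ₜ y) = o.br a b ⊗ₜ (x * y) := by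
  have e : (2⁻¹ : 𝕜) • b + (2⁻¹ : 𝕜) • b = b := by module
  simp [Ops.tensor, hb, e]

theorem tensor_br_odd (o : Ops 𝕜 A) (σ : A →ₗ[𝕜] A) (τ : B →ₗ[𝕜] B) (a b : A) (x y : B)
    (hb : σ b = -b) : (o.tensor σ B τ).br (a ⊗ₜ x) (b ⊗ₜ y) = o.br a b ⊗ₜ (τ x * y) := by
  have e : (2⁻¹ : 𝕜) • b + (2⁻¹ : 𝕜) • b = b := by module
  simp [Ops.tensor, hb, e]

omit [CharZero 𝕜] in
/-- Induction on `A ⊗ B` along elements that are homogeneous with respect to two involutions. -/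
theorem tensor_super_induction [NeZero (2 : 𝕜)] {σ : A →ₗ[𝕜] A} {τ : B →ₗ[𝕜] B}
    (hσ : ∀ x, σ (σ x) = x) (hτ : ∀ x, τ (τ x) = x) {p : A ⊗[𝕜] B → Prop}
    (add : ∀ x y, p x → p y → p (x + y))
    (tmul : ∀ a x, (σ a = a ∨ σ a = -a) → (τ x = x ∨ τ x = -x) → p (a ⊗ₜ x)) (t : A ⊗[𝕜] B) :
    p t := by
  induction t with
  | zero => simpa using tmul 0 0 (by simp) (by simp)
  | add x y hx hy => exact add x y hx hy
  | tmul a x =>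
    refine involution_induction hσ (p := fun a => p (a ⊗ₜ x)) (fun a b ha hb => ?_)
      (fun a ha => ?_) (fun a ha => ?_) a
    · rw [TensorProduct.add_tmul]; exact add _ _ ha hb
    all_goals
      refine involution_induction hτ (p := fun x => p (a ⊗ₜ x)) (fun x y hx hy => ?_)
        (fun x hx => tmul a x (by tauto) (by tauto)) (fun x hx => tmul a x (by tauto) (by tauto)) x
      rw [TensorProduct.tmul_add]; exact add _ _ hx hy

theorem Ops.IsSuper.tensor {o : Ops 𝕜 A} {σ : A →ₗ[𝕜] A} (H : o.IsSuper σ) {τ : B →ₗ[𝕜] B}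
    (hτ : IsSuperComm τ) : (o.tensor σ B τ).IsSuper (TensorProduct.map σ τ) := by
  have hd : ∀ a x, (o.tensor σ B τ).d (a ⊗ₜ x) = o.d a ⊗ₜ x := fun a x => rfl
  have hη : ∀ a x, (o.tensor σ B τ).η (a ⊗ₜ x) = o.η a ⊗ₜ x := fun a x => rfl
  have lin1 : ∀ {f g : A ⊗[𝕜] B →ₗ[𝕜] A ⊗[𝕜] B}, (∀ a x, f (a ⊗ₜ x) = g (a ⊗ₜ x)) →
      ∀ t, f t = g t := fun {f g} h t => by
    rw [TensorProduct.ext' h]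
  have lin2 : ∀ {p : A ⊗[𝕜] B → A ⊗[𝕜] B → Prop}, (∀ x y z, p x z → p y z → p (x + y) z) →
      (∀ x y z, p x y → p x z → p x (y + z)) →
      (∀ a x b y, (σ a = a ∨ σ a = -a) → (τ x = x ∨ τ x = -x) → (σ b = b ∨ σ b = -b) →
        (τ y = y ∨ τ y = -y) → p (a ⊗ₜ x) (b ⊗ₜ y)) → ∀ s t, p s t := fun {p} h1 h2 h3 s t => by
    refine tensor_super_induction H.σ_σ hτ.τ_τ (p := fun s => p s t) (fun x y => h1 x y t)
      (fun a x ha hx => ?_) s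
    exact tensor_super_induction H.σ_σ hτ.τ_τ (p := fun t => p (a ⊗ₜ x) t) (fun y z => h2 _ y z)
      (fun b y hb hy => h3 a x b y ha hx hb hy) t
  refine ⟨?_, ?_, ?_, ?_, ?_, ?_, ?_, ?_, ?_⟩
  · exact lin1 (f := TensorProduct.map σ τ ∘ₗ TensorProduct.map σ τ) (g := LinearMap.id)
      fun a x => by simp [H.σ_σ, hτ.τ_τ]
  · exact lin1 (f := TensorProduct.map σ τ ∘ₗ (o.tensor σ B τ).d)
      (g := -((o.tensor σ B τ).d ∘ₗ TensorProduct.map σ τ))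
      fun a x => by simp [hd, H.σ_d, TensorProduct.neg_tmul]
  · exact lin1 (f := TensorProduct.map σ τ ∘ₗ (o.tensor σ B τ).η)
      (g := -((o.tensor σ B τ).η ∘ₗ TensorProduct.map σ τ))
      fun a x => by simp [hη, H.σ_η, TensorProduct.neg_tmul]
  · refine lin2 (fun x y z h h' => by simp only [map_add, LinearMap.add_apply, h, h'])
      (fun x y z h h' => by simp only [map_add, h, h']) fun a x b y ha hx hb hy => ?_
    rcases hb with hb | hb
    · rw [tensor_br_even _ _ _ _ _ _ _ hb]
      simp [tensor_br_even, hb, H.σ_br, hτ.map_mul]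
    · rw [tensor_br_odd _ _ _ _ _ _ _ hb]
      simp [tensor_br_odd, hb, H.σ_br, hτ.map_mul, hτ.τ_τ]
  · exact lin1 (f := (o.tensor σ B τ).d ∘ₗ (o.tensor σ B τ).d) (g := 0)
      fun a x => by simp [hd, H.d_d]
  · exact lin1 (f := (o.tensor σ B τ).d ∘ₗ (o.tensor σ B τ).η ∘ₗ (o.tensor σ B τ).d)
      (g := (o.tensor σ B τ).d) fun a x => by simp [hd, hη, H.d_η_d]
  · exact lin1 (f := (o.tensor σ B τ).d ∘ₗ (o.tensor σ B τ).η ∘ₗ (o.tensor σ B τ).η ∘ₗ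
      (o.tensor σ B τ).d) (g := 0) fun a x => by simp [hd, hη, H.d_η_η_d]
  · refine lin2 (fun x y z h h' => ?_) (fun x y z h h' => ?_) fun a x b y ha hx hb hy => ?_
    · simp only [map_add, LinearMap.add_apply, h, h']; abel
    · simp only [map_add, h, h']; abel
    have hdb : ∀ b, σ b = b → σ (o.d b) = -o.d b := fun b hb => by rw [H.σ_d, hb]
    have hdb' : ∀ b, σ b = -b → σ (o.d b) = o.d b := fun b hb => H.σ_d_odd hb
    rcases hb with hb | hb
    · rw [tensor_br_even _ _ _ _ _ _ _ hb, hd, hd, hd, TensorProduct.map_tmul,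
        tensor_br_even _ _ _ _ _ _ _ hb, tensor_br_odd _ _ _ _ _ _ _ (hdb b hb), hτ.τ_τ,
        H.leibniz, TensorProduct.add_tmul]
    · rw [tensor_br_odd _ _ _ _ _ _ _ hb, hd, hd, hd, TensorProduct.map_tmul,
        tensor_br_odd _ _ _ _ _ _ _ hb, tensor_br_even _ _ _ _ _ _ _ (hdb' b hb),
        H.leibniz, TensorProduct.add_tmul]
  · refine lin2 (fun x y z h h' => ?_) (fun x y z h h' => ?_) fun a x b y ha hx hb hy => ?_
    · simp only [map_add, LinearMap.add_apply, smul_add, h, h']; abel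
    · simp only [map_add, LinearMap.add_apply, smul_add, h, h']; abel
    have e1 := fun a b (ha : σ a = a) => H.br_comm_even b ha
    have e2 := fun a b (ha : σ a = -a) (hb : σ b = -b) => H.br_comm_odd ha hb
    simp only [TensorProduct.map_tmul]
    have two : ∀ t : A ⊗[𝕜] B, (2 : 𝕜) • t = t + t := fun t => two_smul 𝕜 t
    rcases ha with ha | ha <;> rcases hx with hx | hx <;> rcases hb with hb | hb <;>
      rcases hy with hy | hy <;>
      simp only [ha, hx, hb, hy, tensor_br_even, tensor_br_odd, TensorProduct.neg_tmul,
        TensorProduct.tmul_neg, map_neg, LinearMap.neg_apply, two, neg_mul] <;>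
      (first | rw [e1 a b ha] | rw [eq_neg_of_add_eq_zero_left (a := o.br a b) (b := o.br b a)
        (by rw [e1 b a hb]; simp)] | rw [e2 a b ha hb]) <;>
      (first | rw [hτ.comm_even x y hx] | rw [← hτ.comm_even y x hy] | rw [hτ.comm_odd x y hx hy]) <;>
      (try simp only [TensorProduct.neg_tmul, TensorProduct.tmul_neg]) <;> abel

end Tensor

end Super

/-! ### Parity and the filtration by powers of the maximal ideal -/

section Parity

variable {𝕜 : Type*} [Field 𝕜] {A : Type*} [AddCommGroup A] [Module 𝕜 A]
  (𝒜 : ℤ → Submodule 𝕜 A) [DirectSum.Decomposition 𝒜]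

theorem parity_parity (x : A) : parity 𝒜 (parity 𝒜 x) = x := by
  induction x using DirectSum.Decomposition.inductionOn 𝒜 with
  | zero => simp
  | @homogeneous i m => simp [parity_of_mem 𝒜 m.2, Units.smul_def, smul_smul, ← Units.val_mul]
  | add x y hx hy => simp [hx, hy]

theorem decomposition_induction₂ {p : A → A → Prop} (h1 : ∀ x y z, p x z → p y z → p (x + y) z)
    (h2 : ∀ x y z, p x y → p x z → p x (y + z))
    (h : ∀ i j, ∀ x ∈ 𝒜 i, ∀ y ∈ 𝒜 j, p x y) (x y : A) : p x y := by
  induction x using DirectSum.Decomposition.inductionOn 𝒜 with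
  | zero =>
    induction y using DirectSum.Decomposition.inductionOn 𝒜 with
    | zero => exact h 0 0 0 (zero_mem _) 0 (zero_mem _)
    | @homogeneous i m => exact h 0 i 0 (zero_mem _) _ m.2
    | add x y hx hy => exact h2 _ _ _ hx hy
  | @homogeneous j n =>
    induction y using DirectSum.Decomposition.inductionOn 𝒜 with
    | zero => exact h j 0 n n.2 0 (zero_mem _)
    | @homogeneous i m => exact h j i n n.2 _ m.2
    | add x y hx hy => exact h2 _ _ _ hx hy
  | add x z hx hz => exact h1 _ _ _ hx hz

end Parity

namespace GradedArtin

variable {𝕜 : Type u} [Field 𝕜] (B : GradedArtin.{u, v} 𝕜)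

theorem isSuperComm [CharZero 𝕜] : IsSuperComm (parity B.gr) := by
  have hp : ∀ i, ∀ x ∈ B.gr i, parity B.gr x = ((i.negOnePow : ℤˣ) : ℤ) • x := fun i x hx => by
    rw [parity_of_mem B.gr hx, Units.smul_def]
  have h1 : ∀ x y : B, (x + parity B.gr x) * y = y * (x + parity B.gr x) := by
    refine decomposition_induction₂ B.gr (fun x y z h h' => ?_) (fun x y z h h' => ?_)
      fun i j x hx y hy => ?_
    · rw [map_add, add_add_add_comm, add_mul, mul_add, h, h']
    · rw [mul_add, h, h', ← add_mul]
    · rw [hp i x hx]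
      rcases Int.even_or_odd i with hi | hi
      · simp [Int.negOnePow_even i hi, add_mul, mul_add, B.comm i j x hx y hy,
          Int.negOnePow_even _ (hi.mul_right j)]
      · simp [Int.negOnePow_odd i hi]
  have h2 : ∀ x y : B, (x - parity B.gr x) * (y - parity B.gr y) =
      -((y - parity B.gr y) * (x - parity B.gr x)) := by
    refine decomposition_induction₂ B.gr (fun x y z h h' => ?_) (fun x y z h h' => ?_)
      fun i j x hx y hy => ?_
    · rw [map_add, add_sub_add_comm, add_mul, mul_add, h, h', neg_add]
    · rw [map_add, add_sub_add_comm, add_mul, mul_add, h, h', neg_add]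
    · rw [hp i x hx, hp j y hy]
      rcases Int.even_or_odd i with hi | hi
      · simp [Int.negOnePow_even i hi]
      rcases Int.even_or_odd j with hj | hj
      · simp [Int.negOnePow_even j hj]
      · simp [Int.negOnePow_odd i hi, Int.negOnePow_odd j hj, add_mul, mul_add,
          B.comm i j x hx y hy, Int.negOnePow_odd _ (hi.mul hj)]
  refine ⟨parity_parity B.gr, ?_, fun x y hx => ?_, fun x y hx hy => ?_⟩
  · refine decomposition_induction₂ B.gr (fun x y z h h' => ?_) (fun x y z h h' => ?_)
      fun i j x hx y hy => ?_
    · simp [add_mul, h, h']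
    · simp [mul_add, h, h']
    · rw [hp i x hx, hp j y hy, hp (i + j) _ (SetLike.mul_mem_graded hx hy), Int.negOnePow_add]
      rw [smul_mul_assoc, mul_smul_comm, smul_smul, Units.val_mul]
  · have h := h1 x y
    rw [hx, ← two_smul 𝕜 x, smul_mul_assoc, mul_smul_comm] at h
    exact (smul_right_injective B (two_ne_zero : (2 : 𝕜) ≠ 0)) h
  · have h := h2 x y
    rw [hx, hy, sub_neg_eq_add, sub_neg_eq_add, ← two_smul 𝕜 x, ← two_smul 𝕜 y] at h
    simp only [smul_mul_assoc, mul_smul_comm, smul_smul, ← smul_neg] at h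
    exact (smul_right_injective B (by norm_num : (2 * 2 : 𝕜) ≠ 0)) h

theorem aug_of_odd [CharZero 𝕜] {x : B} (hx : parity B.gr x = -x) : B.aug x = 0 := by
  have h := B.isSuperComm.comm_odd x x hx hx
  have h2 : B.aug x * B.aug x = 0 := by
    have := congrArg B.aug h
    rw [map_neg, map_mul] at this
    exact self_eq_neg.mp this
  simpa using h2

theorem aug_parity [CharZero 𝕜] (x : B) : B.aug (parity B.gr x) = B.aug x := by
  have h : B.aug (x - parity B.gr x) = 0 := B.aug_of_odd (by rw [map_sub, parity_parity]; abel)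
  rw [map_sub, sub_eq_zero] at h
  exact h.symm

theorem mem_max {x : B} : x ∈ B.max ↔ B.aug x = 0 := Iff.rfl

theorem mul_mem_max_left (x : B) {y : B} (hy : y ∈ B.max) : x * y ∈ B.max := by
  rw [mem_max] at *; simp [hy]

theorem mul_mem_max_right {x : B} (y : B) (hx : x ∈ B.max) : x * y ∈ B.max := by
  rw [mem_max] at *; simp [hx]

theorem parity_mem_max [CharZero 𝕜] {x : B} (hx : x ∈ B.max) : parity B.gr x ∈ B.max := by
  rw [mem_max] at *; rw [aug_parity, hx]

/-- The powers of the maximal ideal, with the whole algebra as the power with exponent `0`. -/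
def fil (n : ℕ) : Submodule 𝕜 B := B.max ^ n * ⊤

theorem fil_zero : B.fil 0 = ⊤ := by simp [fil]

theorem exists_fil_eq_bot : ∃ N, B.fil N = ⊥ := by
  obtain ⟨N, hN⟩ := B.nilp
  exact ⟨N, by rw [fil, max, hN, Submodule.bot_mul]⟩

theorem fil_succ (n : ℕ) : B.fil (n + 1) = B.max * B.fil n := by
  rw [fil, fil, pow_succ', mul_assoc]

theorem fil_one : B.fil 1 = B.max := by
  rw [fil_succ, fil_zero]
  refine le_antisymm (Submodule.mul_le.mpr fun x hx y _ => B.mul_mem_max_right y hx) fun x hx => ?_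
  rw [← mul_one x]
  exact Submodule.mul_mem_mul hx trivial

theorem top_mul_fil_le (n : ℕ) : ⊤ * B.fil n ≤ B.fil n := by
  cases n with
  | zero => rw [fil_zero]; exact le_top
  | succ n =>
    rw [fil_succ, ← mul_assoc]
    exact mul_le_mul_left (Submodule.mul_le.mpr fun x _ y hy => B.mul_mem_max_left x hy) _

theorem fil_mul_fil_le (m n : ℕ) : B.fil m * B.fil n ≤ B.fil (m + n) := by
  have h : B.fil m * B.fil n = B.max ^ m * (⊤ * B.fil n) := by rw [fil, mul_assoc]
  rw [h]
  refine (mul_le_mul_right (B.top_mul_fil_le n) _).trans ?_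
  rw [fil, fil, ← mul_assoc, pow_add]

theorem mul_mem_fil {m n : ℕ} {x y : B} (hx : x ∈ B.fil m) (hy : y ∈ B.fil n) :
    x * y ∈ B.fil (m + n) := B.fil_mul_fil_le m n (Submodule.mul_mem_mul hx hy)

theorem fil_antitone : Antitone B.fil := antitone_nat_of_succ_le fun n => by
  have h := B.fil_mul_fil_le 1 n
  rw [fil_succ]
  refine (Submodule.mul_le.mpr fun x _ y hy => ?_)
  exact B.top_mul_fil_le n (Submodule.mul_mem_mul trivial hy)

theorem parity_mem_fil [CharZero 𝕜] {n : ℕ} {x : B} (hx : x ∈ B.fil n) :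
    parity B.gr x ∈ B.fil n := by
  induction n generalizing x with
  | zero => rw [fil_zero]; trivial
  | succ n ih =>
    rw [fil_succ] at hx ⊢
    induction hx using Submodule.mul_induction_on' with
    | mem_mul_mem m hm n hn =>
      rw [B.isSuperComm.map_mul]
      exact Submodule.mul_mem_mul (B.parity_mem_max hm) (ih hn)
    | add x _ y _ hx hy => rw [map_add]; exact add_mem hx hy

end GradedArtin

/-! ### Homogeneous parts and the filtration of a tensor product -/

section Filtration

variable {𝕜 : Type u} [Field 𝕜] {A : Type*} [AddCommGroup A] [Module 𝕜 A]
  {A' : Type*} [AddCommGroup A'] [Module 𝕜 A']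

/-- The part of total degree `n` of `A ⊗ m_B`, where the part of degree `i` of `A` is `W i`. -/
noncomputable def degOf (W : ℤ → Submodule 𝕜 A) (B : GradedArtin.{u, v} 𝕜) (n : ℤ) :
    Submodule 𝕜 (A ⊗[𝕜] B) :=
  ⨆ i : ℤ, LinearMap.range (TensorProduct.mapIncl (W i) (B.gr (n - i) ⊓ B.max))

variable {W : ℤ → Submodule 𝕜 A} {W' : ℤ → Submodule 𝕜 A'} {B : GradedArtin.{u, v} 𝕜}

theorem tmul_mem_degOf {n i j : ℤ} (hij : i + j = n) {a : A} (ha : a ∈ W i) {x : B}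
    (hx : x ∈ B.gr j) (hx' : x ∈ B.max) : a ⊗ₜ x ∈ degOf W B n := by
  obtain rfl : j = n - i := by omega
  exact Submodule.mem_iSup_of_mem i ⟨(⟨a, ha⟩ : W i) ⊗ₜ (⟨x, hx, hx'⟩ : ↥(B.gr (n - i) ⊓ B.max)),
    by simp [TensorProduct.mapIncl]⟩

theorem degOf_le {n : ℤ} {p : Submodule 𝕜 (A ⊗[𝕜] B)}
    (h : ∀ i, ∀ a ∈ W i, ∀ x ∈ B.gr (n - i), x ∈ B.max → a ⊗ₜ x ∈ p) : degOf W B n ≤ p := by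
  refine iSup_le fun i => ?_
  rintro _ ⟨t, rfl⟩
  induction t with
  | zero => simp
  | add x y hx hy => rw [map_add]; exact add_mem hx hy
  | tmul a b => simpa [TensorProduct.mapIncl] using h i a a.2 b b.2.1 b.2.2

theorem rTensor_mem_degOf {f : A →ₗ[𝕜] A'} {k : ℤ} (hf : ∀ i, ∀ a ∈ W i, f a ∈ W' (i + k))
    {n m : ℤ} (hm : n + k = m) {t : A ⊗[𝕜] B} (ht : t ∈ degOf W B n) :
    f.rTensor B t ∈ degOf W' B m := by
  suffices h : degOf W B n ≤ (degOf W' B m).comap (f.rTensor B) from h ht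
  refine degOf_le fun i a ha x hx hx' => ?_
  exact tmul_mem_degOf (by omega) (hf i a ha) hx hx'

theorem map_parity_of_mem_degOf {σ : A →ₗ[𝕜] A}
    (hσ : ∀ i, ∀ a ∈ W i, σ a = ((i.negOnePow : ℤˣ) : ℤ) • a) {n : ℤ} {t : A ⊗[𝕜] B}
    (ht : t ∈ degOf W B n) :
    TensorProduct.map σ (parity B.gr) t = ((n.negOnePow : ℤˣ) : ℤ) • t := by
  suffices h : degOf W B n ≤ LinearMap.eqLocus (TensorProduct.map σ (parity B.gr))
    (((n.negOnePow : ℤˣ) : ℤ) • LinearMap.id) from h ht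
  refine degOf_le fun i a ha x hx hx' => ?_
  have e : ((n.negOnePow : ℤˣ) : ℤ) = ((n - i).negOnePow : ℤˣ) * ((i.negOnePow : ℤˣ) : ℤ) := by
    rw [← Units.val_mul, ← Int.negOnePow_add, sub_add_cancel]
  simp only [LinearMap.mem_eqLocus, TensorProduct.map_tmul, hσ i a ha, parity_of_mem B.gr hx,
    Units.smul_def, LinearMap.smul_apply, LinearMap.id_apply]
  rw [← TensorProduct.smul_tmul', TensorProduct.tmul_smul, smul_smul, e, mul_comm]

theorem tensor_br_mem_degOf [CharZero 𝕜] {o : Ops 𝕜 A} {σ : A →ₗ[𝕜] A}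
    (hσ : ∀ i, ∀ a ∈ W i, σ a = ((i.negOnePow : ℤˣ) : ℤ) • a)
    (hbr : ∀ i j, ∀ a ∈ W i, ∀ b ∈ W j, o.br a b ∈ W (i + j)) {m n k : ℤ} (hk : m + n = k)
    {s t : A ⊗[𝕜] B} (hs : s ∈ degOf W B m) (ht : t ∈ degOf W B n) :
    (o.tensor σ B (parity B.gr)).br s t ∈ degOf W B k := by
  suffices h : degOf W B m ≤ (degOf W B k).comap ((o.tensor σ B (parity B.gr)).br.flip t) from h hs
  refine degOf_le fun i a ha x hx hx' => ?_
  suffices h : degOf W B n ≤ (degOf W B k).comap ((o.tensor σ B (parity B.gr)).br (a ⊗ₜ x)) from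
    h ht
  refine degOf_le fun j b hb y hy hy' => ?_
  have hxy : x * y ∈ B.gr ((m - i) + (n - j)) := SetLike.mul_mem_graded hx hy
  have hd : i + j + ((m - i) + (n - j)) = k := by omega
  have h0 := tmul_mem_degOf hd (hbr i j a ha b hb) hxy (B.mul_mem_max_left _ hy')
  rw [Submodule.mem_comap]
  have hb' := hσ j b hb
  rcases Int.even_or_odd j with hj | hj
  · rw [tensor_br_even _ _ _ _ _ _ _ (by simpa [Int.negOnePow_even j hj] using hb')]
    exact h0
  · rw [tensor_br_odd _ _ _ _ _ _ _ (by simpa [Int.negOnePow_odd j hj] using hb'),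
      parity_of_mem B.gr hx, Units.smul_def, smul_mul_assoc, TensorProduct.tmul_smul]
    exact (degOf W B k).smul_of_tower_mem _ h0

/-- The filtration of `A ⊗ B` by powers of the maximal ideal. -/
def tfil (A : Type*) [AddCommGroup A] [Module 𝕜 A] (B : GradedArtin.{u, v} 𝕜) (n : ℕ) :
    Submodule 𝕜 (A ⊗[𝕜] B) :=
  Submodule.map₂ (TensorProduct.mk 𝕜 A B) ⊤ (B.fil n)

theorem tmul_mem_tfil {n : ℕ} (a : A) {x : B} (hx : x ∈ B.fil n) : a ⊗ₜ x ∈ tfil A B n :=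
  Submodule.apply_mem_map₂ (TensorProduct.mk 𝕜 A B) trivial hx

theorem tfil_le {n : ℕ} {p : Submodule 𝕜 (A ⊗[𝕜] B)} (h : ∀ a : A, ∀ x ∈ B.fil n, a ⊗ₜ x ∈ p) :
    tfil A B n ≤ p :=
  Submodule.map₂_le.mpr fun a _ x hx => h a x hx

theorem tfil_zero : tfil A B 0 = ⊤ := by
  rw [tfil, GradedArtin.fil_zero, TensorProduct.map₂_mk_top_top_eq_top]

theorem tfil_antitone : Antitone (tfil A B) := fun _ _ h =>
  tfil_le fun a _ hx => tmul_mem_tfil a (B.fil_antitone h hx)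

variable (A B) in
theorem exists_tfil_eq_bot : ∃ N, tfil A B N = ⊥ := by
  obtain ⟨N, hN⟩ := B.exists_fil_eq_bot
  exact ⟨N, by rw [tfil, hN, Submodule.map₂_bot_right]⟩

theorem rTensor_mem_tfil (f : A →ₗ[𝕜] A') {n : ℕ} {t : A ⊗[𝕜] B} (ht : t ∈ tfil A B n) :
    f.rTensor B t ∈ tfil A' B n := by
  suffices h : tfil A B n ≤ (tfil A' B n).comap (f.rTensor B) from h ht
  exact tfil_le fun a x hx => tmul_mem_tfil (f a) hx

theorem tensor_br_mem_tfil [CharZero 𝕜] (o : Ops 𝕜 A) (σ : A →ₗ[𝕜] A) {m n k : ℕ} (hk : m + n = k)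
    {s t : A ⊗[𝕜] B} (hs : s ∈ tfil A B m) (ht : t ∈ tfil A B n) :
    (o.tensor σ B (parity B.gr)).br s t ∈ tfil A B k := by
  subst hk
  suffices h : tfil A B m ≤ (tfil A B (m + n)).comap ((o.tensor σ B (parity B.gr)).br.flip t) from
    h hs
  refine tfil_le fun a x hx => ?_
  suffices h : tfil A B n ≤ (tfil A B (m + n)).comap ((o.tensor σ B (parity B.gr)).br (a ⊗ₜ x)) from
    h ht
  refine tfil_le fun b y hy => ?_
  simp only [Ops.tensor, Submodule.mem_comap, LinearMap.add_apply, TensorProduct.map₂_apply_tmul]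
  exact add_mem (tmul_mem_tfil _ (B.mul_mem_fil hx hy))
    (tmul_mem_tfil _ (B.mul_mem_fil (B.parity_mem_fil hx) hy))

theorem degOf_le_tfil_one (n : ℤ) : degOf W B n ≤ tfil A B 1 :=
  degOf_le fun i a _ x _ hx => tmul_mem_tfil a (by rwa [B.fil_one])

end Filtration

/-! ### Newton iteration in filtered modules -/

section Newton

variable {𝕜 : Type*} [Field 𝕜] {T : Type*} [AddCommGroup T] [Module 𝕜 T]

/-- The data for solving `Γ + Q(Γ, Γ) = h` near an approximate solution `Γ₀`: a decreasing
multiplicative filtration `F` with `F N = 0`, a submodule `O` in which the solution is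
sought, and an inverse `R` on `O` of the derivative `e ↦ e + Q(Γ₀, e) + Q(e, Γ₀)`. -/
structure NewtonData (F : ℕ → Submodule 𝕜 T) (O : Submodule 𝕜 T) (N : ℕ)
    (Q : T →ₗ[𝕜] T →ₗ[𝕜] T) (R : T →ₗ[𝕜] T) (Γ₀ : T) : Prop where
  anti : Antitone F
  F_N : F N = ⊥
  F_zero : F 0 = ⊤
  Q_F : ∀ m n, ∀ s ∈ F m, ∀ t ∈ F n, Q s t ∈ F (m + n)
  Q_O : ∀ s ∈ O, ∀ t ∈ O, Q s t ∈ O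
  R_F : ∀ n, ∀ s ∈ F n, R s ∈ F n
  R_O : ∀ s ∈ O, R s ∈ O
  right : ∀ e ∈ O, R e + Q Γ₀ (R e) + Q (R e) Γ₀ = e
  left : ∀ e ∈ O, R (e + Q Γ₀ e + Q e Γ₀) = e
  base : Γ₀ ∈ O

/-- The `n`-th iterate of `Γ ↦ Γ - R(Γ + Q(Γ, Γ) - h)`, starting with `Γ₀`. -/
def newton (Q : T →ₗ[𝕜] T →ₗ[𝕜] T) (R : T →ₗ[𝕜] T) (Γ₀ h : T) : ℕ → T
  | 0 => Γ₀
  | n + 1 => newton Q R Γ₀ h n -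
      R (newton Q R Γ₀ h n + Q (newton Q R Γ₀ h n) (newton Q R Γ₀ h n) - h)

namespace NewtonData

variable {F : ℕ → Submodule 𝕜 T} {O : Submodule 𝕜 T} {N : ℕ}
    {Q : T →ₗ[𝕜] T →ₗ[𝕜] T} {R : T →ₗ[𝕜] T} {Γ₀ : T}

theorem newton_spec (H : NewtonData F O N Q R Γ₀) {h : T} (hO : h ∈ O)
    (h0 : Γ₀ + Q Γ₀ Γ₀ - h ∈ F 1) (n : ℕ) :
    newton Q R Γ₀ h n ∈ O ∧ newton Q R Γ₀ h n - Γ₀ ∈ F 1 ∧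
      newton Q R Γ₀ h n + Q (newton Q R Γ₀ h n) (newton Q R Γ₀ h n) - h ∈ F (n + 1) := by
  induction n with
  | zero => exact ⟨H.base, by simp [newton], h0⟩
  | succ n ih =>
    obtain ⟨h1, h2, h3⟩ := ih
    rw [newton]
    set Γ := newton Q R Γ₀ h n
    set e := Γ + Q Γ Γ - h with he
    have heO : e ∈ O := sub_mem (add_mem h1 (H.Q_O _ h1 _ h1)) hO
    have hR := H.R_F _ _ h3
    refine ⟨sub_mem h1 (H.R_O _ heO), ?_, ?_⟩
    · rw [sub_right_comm]
      exact sub_mem h2 (H.anti (by omega) hR)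
    · have key : Γ - R e + Q (Γ - R e) (Γ - R e) - h =
          Q (R e) (R e) - Q (Γ - Γ₀) (R e) - Q (R e) (Γ - Γ₀) := by
        have hr := H.right e heO
        have : Γ - R e + Q (Γ - R e) (Γ - R e) - h = e - R e - Q Γ (R e) - Q (R e) Γ
            + Q (R e) (R e) := by
          rw [he]; simp only [map_sub, LinearMap.sub_apply]; abel
        rw [this]
        nth_rewrite 1 [← hr]
        simp only [map_sub, LinearMap.sub_apply]
        abel
      rw [key]
      refine sub_mem (sub_mem ?_ ?_) ?_
      · exact H.anti (by omega) (H.Q_F _ _ _ hR _ hR)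
      · exact H.anti (by omega) (H.Q_F _ _ _ h2 _ hR)
      · exact H.Q_F _ _ _ hR _ h2

theorem newton_eq (H : NewtonData F O N Q R Γ₀) {h : T} (hO : h ∈ O)
    (h0 : Γ₀ + Q Γ₀ Γ₀ - h ∈ F 1) :
    newton Q R Γ₀ h N + Q (newton Q R Γ₀ h N) (newton Q R Γ₀ h N) = h := by
  have := H.anti (Nat.le_succ N) (H.newton_spec hO h0 N).2.2
  rw [H.F_N] at this
  exact sub_eq_zero.mp this

/-- Solutions of `Γ + Q(Γ, Γ) = h` near `Γ₀` are unique. -/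
theorem unique (H : NewtonData F O N Q R Γ₀) {s t : T} (hs : s ∈ O) (ht : t ∈ O)
    (hs0 : s - Γ₀ ∈ F 1) (ht0 : t - Γ₀ ∈ F 1) (hst : s + Q s s = t + Q t t) : s = t := by
  have key : ∀ n, s - t ∈ F n := fun n => by
    induction n with
    | zero => rw [H.F_zero]; trivial
    | succ n ih =>
      rw [← H.left _ (sub_mem hs ht)]
      refine H.R_F _ _ ?_
      have : s - t + Q Γ₀ (s - t) + Q (s - t) Γ₀ =
          -(Q (s - Γ₀) (s - t) + Q (s - t) (t - Γ₀)) := by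
        have h2 : s - t = Q t t - Q s s := by rw [sub_eq_sub_iff_add_eq_add, hst, add_comm]
        have h3 : Q s s - Q t t = Q s (s - t) + Q (s - t) t := by
          simp only [map_sub, LinearMap.sub_apply]; abel
        have h4 : s - t = -(Q s (s - t) + Q (s - t) t) := by rw [← h3, h2]; abel
        nth_rewrite 1 [h4]
        simp only [map_sub, LinearMap.sub_apply]; abel
      rw [this]
      refine neg_mem (add_mem ?_ ?_)
      · exact H.anti (by omega) (H.Q_F _ _ _ hs0 _ ih)
      · exact H.Q_F _ _ _ ih _ ht0
  have := key N
  rw [H.F_N] at this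
  exact sub_eq_zero.mp this

end NewtonData

end Newton

/-! ### Recursions with a nilpotent operator -/

section Nilpotent

variable {𝕜 : Type*} [Field 𝕜] {T : Type*} [AddCommGroup T] [Module 𝕜 T]

theorem iterate_mem_of_raises {F : ℕ → Submodule 𝕜 T} (h0 : F 0 = ⊤) {f : T →ₗ[𝕜] T}
    (hf : ∀ n, ∀ t ∈ F n, f t ∈ F (n + 1)) (n : ℕ) (t : T) : f^[n] t ∈ F n := by
  induction n with
  | zero => rw [h0]; trivial
  | succ n ih => rw [Function.iterate_succ_apply']; exact hf _ _ ih

/-- If `Pₙ₊₁ - f Pₙ` is constant from some point on and `f` is nilpotent, then `Pₙ` tends to `w`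
exactly when the constant is the one belonging to the constant sequence `w`. -/
theorem eventually_eq_iff_of_nilpotent {f : T →ₗ[𝕜] T} {N : ℕ} (hN : ∀ t, f^[N] t = 0)
    {P : ℕ → T} {c w : T} {n₀ : ℕ} (hP : ∀ n ≥ n₀, P (n + 1) - f (P n) = c) :
    (∀ᶠ n in atTop, P n = w) ↔ w - f w = c := by
  constructor
  · intro h
    obtain ⟨n, hn⟩ := eventually_atTop.mp h
    rw [← hP (max n n₀) (le_max_right _ _), hn _ (le_max_left _ _),
      hn _ ((le_max_left n n₀).trans (Nat.le_succ _))]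
  · intro h
    have key : ∀ k, P (n₀ + k) - w = f^[k] (P n₀ - w) := fun k => by
      induction k with
      | zero => rfl
      | succ k ih =>
        rw [Function.iterate_succ_apply', ← ih, map_sub, ← add_assoc, eq_add_of_sub_eq (hP _ (by omega)),
          ← h]
        abel
    refine eventually_atTop.mpr ⟨n₀ + N, fun n hn => ?_⟩
    obtain ⟨k, rfl⟩ := Nat.exists_eq_add_of_le hn
    have := key (N + k)
    rw [← add_assoc, Function.iterate_add_apply, hN, ] at this
    exact sub_eq_zero.mp this

end Nilpotent

/-! ### Polynomial paths -/

section PolyPath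

variable {𝕜 : Type*} [Field 𝕜] {M : Type*} [AddCommGroup M] [Module 𝕜 M]
  {M' : Type*} [AddCommGroup M'] [Module 𝕜 M'] {M'' : Type*} [AddCommGroup M''] [Module 𝕜 M'']

/-- The pairs of a polynomial path in `O` and its derivative, as functions of the parameter. -/
def PolyPath (O : Submodule 𝕜 M) : Submodule 𝕜 ((𝕜 → M) × (𝕜 → M)) :=
  Submodule.span 𝕜 {f | ∃ x ∈ O, ∃ p : Polynomial 𝕜,
    f = (fun s => p.eval s • x, fun s => p.derivative.eval s • x)}

variable {O : Submodule 𝕜 M} {O' : Submodule 𝕜 M'} {O'' : Submodule 𝕜 M''}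

theorem PolyPath.monomial {x : M} (hx : x ∈ O) (p : Polynomial 𝕜) :
    ((fun s => p.eval s • x, fun s => p.derivative.eval s • x) : (𝕜 → M) × (𝕜 → M)) ∈ PolyPath O :=
  Submodule.subset_span ⟨x, hx, p, rfl⟩

theorem PolyPath.const {x : M} (hx : x ∈ O) :
    ((fun _ => x, fun _ => 0) : (𝕜 → M) × (𝕜 → M)) ∈ PolyPath O := by
  simpa using PolyPath.monomial hx (1 : Polynomial 𝕜)

theorem PolyPath.affine {x y : M} (hx : x ∈ O) (hy : y ∈ O) :
    ((fun s => x + s • y, fun _ => y) : (𝕜 → M) × (𝕜 → M)) ∈ PolyPath O := by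
  have h := add_mem (PolyPath.const hx) (PolyPath.monomial hy (Polynomial.X : Polynomial 𝕜))
  convert h using 2
  · funext s; simp
  · funext s; simp

theorem PolyPath.mem {f : (𝕜 → M) × (𝕜 → M)} (hf : f ∈ PolyPath O) (s : 𝕜) :
    f.1 s ∈ O ∧ f.2 s ∈ O := by
  induction hf using Submodule.span_induction with
  | mem f h => obtain ⟨x, hx, p, rfl⟩ := h; exact ⟨O.smul_mem _ hx, O.smul_mem _ hx⟩
  | zero => exact ⟨O.zero_mem, O.zero_mem⟩
  | add f g _ _ hf hg => exact ⟨add_mem hf.1 hg.1, add_mem hf.2 hg.2⟩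
  | smul c f _ hf => exact ⟨O.smul_mem _ hf.1, O.smul_mem _ hf.2⟩

theorem PolyPath.map (L : M →ₗ[𝕜] M') (hL : ∀ x ∈ O, L x ∈ O') {f : (𝕜 → M) × (𝕜 → M)}
    (hf : f ∈ PolyPath O) :
    ((fun s => L (f.1 s), fun s => L (f.2 s)) : (𝕜 → M') × (𝕜 → M')) ∈ PolyPath O' := by
  induction hf using Submodule.span_induction with
  | mem f h => obtain ⟨x, hx, p, rfl⟩ := h; simpa using PolyPath.monomial (hL x hx) p
  | zero => convert zero_mem (PolyPath O') using 2 <;> · funext s; simp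
  | add f g _ _ hf hg =>
    convert add_mem hf hg using 2
    · funext s; simp
    · funext s; simp
  | smul c f _ hf =>
    convert (PolyPath O').smul_mem c hf using 2
    · funext s; simp
    · funext s; simp

/-- The Leibniz rule for polynomial paths. -/
theorem PolyPath.map₂ (Q : M →ₗ[𝕜] M' →ₗ[𝕜] M'') (hQ : ∀ x ∈ O, ∀ y ∈ O', Q x y ∈ O'')
    {f : (𝕜 → M) × (𝕜 → M)} {g : (𝕜 → M') × (𝕜 → M')} (hf : f ∈ PolyPath O)
    (hg : g ∈ PolyPath O') :
    ((fun s => Q (f.1 s) (g.1 s), fun s => Q (f.2 s) (g.1 s) + Q (f.1 s) (g.2 s)) :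
      (𝕜 → M'') × (𝕜 → M'')) ∈ PolyPath O'' := by
  induction hf using Submodule.span_induction with
  | mem f h =>
    obtain ⟨x, hx, p, rfl⟩ := h
    induction hg using Submodule.span_induction with
    | mem g h =>
      obtain ⟨y, hy, q, rfl⟩ := h
      convert PolyPath.monomial (hQ x hx y hy) (p * q) using 2
      · funext s; simp [smul_smul, mul_comm]
      · funext s; simp [smul_smul, add_smul, mul_comm]
    | zero => convert zero_mem (PolyPath O'') using 2 <;> · funext s; simp
    | add f g _ _ hf hg =>
      convert add_mem hf hg using 2
      · funext s; simp
      · funext s; simp; abel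
    | smul c f _ hf =>
      convert (PolyPath O'').smul_mem c hf using 2
      · funext s; simp [smul_comm c]
      · funext s; simp [smul_comm c]
  | zero => convert zero_mem (PolyPath O'') using 2 <;> · funext s; simp
  | add f g _ _ hf hg =>
    convert add_mem hf hg using 2
    · funext s; simp
    · funext s; simp; abel
  | smul c f _ hf =>
    convert (PolyPath O'').smul_mem c hf using 2
    · funext s; simp
    · funext s; simp

end PolyPath

section RealPath

variable {𝕜 : Type u} [RCLike 𝕜] {M : Type*} [AddCommGroup M] [Module 𝕜 M] {O : Submodule 𝕜 M}

theorem PolyPath.of_path {c : ℕ →₀ M} (hc : ∀ i, c i ∈ O) :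
    ((Hodge.path c, Hodge.pathDeriv c) : (𝕜 → M) × (𝕜 → M)) ∈ PolyPath O := by
  have h : ((Hodge.path c, Hodge.pathDeriv c) : (𝕜 → M) × (𝕜 → M)) =
      ∑ i ∈ c.support, ((fun s => (Polynomial.X ^ i : Polynomial 𝕜).eval s • c i,
        fun s => (Polynomial.X ^ i : Polynomial 𝕜).derivative.eval s • c i) :
          (𝕜 → M) × (𝕜 → M)) := by
    refine Prod.ext ?_ ?_
    · rw [Prod.fst_sum]; funext s; simp [Hodge.path, Finsupp.sum]
    · rw [Prod.snd_sum]; funext s; simp [Hodge.pathDeriv, Finsupp.sum, Polynomial.derivative_X_pow]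
  rw [h]
  exact sum_mem fun i _ => PolyPath.monomial (hc i) _

theorem path_add (c c' : ℕ →₀ M) (s : 𝕜) :
    Hodge.path (c + c') s = Hodge.path c s + Hodge.path c' s := by
  classical
  exact Finsupp.sum_add_index' (by simp) (by simp [smul_add])

theorem pathDeriv_add (c c' : ℕ →₀ M) (s : 𝕜) :
    Hodge.pathDeriv (c + c') s = Hodge.pathDeriv c s + Hodge.pathDeriv c' s := by
  classical
  exact Finsupp.sum_add_index' (by simp) (by simp [smul_add])

theorem PolyPath.exists_path {f : (𝕜 → M) × (𝕜 → M)} (hf : f ∈ PolyPath O) :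
    ∃ c : ℕ →₀ M, (∀ i, c i ∈ O) ∧ (∀ s, Hodge.path c s = f.1 s) ∧
      ∀ s, Hodge.pathDeriv c s = f.2 s := by
  classical
  have hadd : ∀ f g : (𝕜 → M) × (𝕜 → M),
      (∃ c : ℕ →₀ M, (∀ i, c i ∈ O) ∧ (∀ s, Hodge.path c s = f.1 s) ∧
        ∀ s, Hodge.pathDeriv c s = f.2 s) →
      (∃ c : ℕ →₀ M, (∀ i, c i ∈ O) ∧ (∀ s, Hodge.path c s = g.1 s) ∧
        ∀ s, Hodge.pathDeriv c s = g.2 s) →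
      ∃ c : ℕ →₀ M, (∀ i, c i ∈ O) ∧ (∀ s, Hodge.path c s = (f + g).1 s) ∧
        ∀ s, Hodge.pathDeriv c s = (f + g).2 s := by
    rintro f g ⟨c, h1, h2, h3⟩ ⟨c', h1', h2', h3'⟩
    exact ⟨c + c', fun i => add_mem (h1 i) (h1' i), fun s => by simp [path_add, h2, h2'],
      fun s => by simp [pathDeriv_add, h3, h3']⟩
  induction hf using Submodule.span_induction with
  | mem f h =>
    obtain ⟨x, hx, p, rfl⟩ := h
    induction p using Polynomial.induction_on' with
    | add p q hp hq =>
      convert hadd _ _ hp hq using 6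
      · simp [add_smul]
      · simp [add_smul]
    | monomial n a =>
      refine ⟨Finsupp.single n (a • x), fun i => ?_, fun s => ?_, fun s => ?_⟩
      · rw [Finsupp.single_apply]
        split_ifs
        · exact O.smul_mem _ hx
        · exact O.zero_mem
      · simp [Hodge.path, smul_smul, mul_comm]
      · simp [Hodge.pathDeriv, Polynomial.derivative_monomial, smul_smul]
        congr 1; ring
  | zero => exact ⟨0, by simp, by simp [Hodge.path], by simp [Hodge.pathDeriv]⟩
  | add f g _ _ hf hg => exact hadd f g hf hg
  | smul a f _ hf =>
    obtain ⟨c, h1, h2, h3⟩ := hf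
    refine ⟨a • c, fun i => O.smul_mem _ (h1 i), fun s => ?_, fun s => ?_⟩
    · simp only [Prod.smul_fst, Pi.smul_apply, ← h2, Hodge.path]
      rw [Finsupp.sum_smul_index' (by simp), Finsupp.smul_sum]
      simp [smul_comm a]
    · simp only [Prod.smul_snd, Pi.smul_apply, ← h3, Hodge.pathDeriv]
      rw [Finsupp.sum_smul_index' (by simp), Finsupp.smul_sum]
      simp [smul_comm a]

theorem PolyPath.hasDerivAt {f : (𝕜 → M) × (𝕜 → M)} (hf : f ∈ PolyPath O) (l : Module.Dual 𝕜 M)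
    (s : 𝕜) : HasDerivAt (fun s => l (f.1 s)) (l (f.2 s)) s := by
  induction hf using Submodule.span_induction with
  | mem f h =>
    obtain ⟨x, hx, p, rfl⟩ := h
    simpa using (p.hasDerivAt s).mul_const (l x)
  | zero => simpa using hasDerivAt_const s (0 : 𝕜)
  | add f g _ _ hf hg =>
    simp only [Prod.fst_add, Prod.snd_add, Pi.add_apply, map_add]
    exact hf.fun_add hg
  | smul a f _ hf => simpa using hf.const_mul a

/-- The derivative of a polynomial path is determined by the path. -/
theorem PolyPath.deriv_unique {f g : (𝕜 → M) × (𝕜 → M)} (hf : f ∈ PolyPath O)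
    (hg : g ∈ PolyPath O) (h : f.1 = g.1) : f.2 = g.2 := by
  funext s
  rw [← sub_eq_zero]
  refine (Module.forall_dual_apply_eq_zero_iff 𝕜 _).mp fun l => ?_
  rw [map_sub, sub_eq_zero]
  have h1 := PolyPath.hasDerivAt hf l s
  rw [h] at h1
  exact h1.unique (PolyPath.hasDerivAt hg l s)

theorem PolyPath.eq_of_deriv_eq_zero {f : (𝕜 → M) × (𝕜 → M)} (hf : f ∈ PolyPath O)
    (h : ∀ s, f.2 s = 0) (s t : 𝕜) : f.1 s = f.1 t := by
  rw [← sub_eq_zero]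
  refine (Module.forall_dual_apply_eq_zero_iff 𝕜 _).mp fun l => ?_
  rw [map_sub, sub_eq_zero]
  exact is_const_of_deriv_eq_zero (fun s => (PolyPath.hasDerivAt hf l s).differentiableAt)
    (fun s => by rw [(PolyPath.hasDerivAt hf l s).deriv, h, map_zero]) s t

end RealPath

/-! ### The deformation functor of a differential graded Lie algebra with a Hodge decomposition -/

section Def

variable {𝕜 : Type u} [RCLike 𝕜] {G : Type w} [NormedAddCommGroup G] [NormedSpace 𝕜 G]
  {𝒢 : ℤ → Submodule 𝕜 G} [DirectSum.Decomposition 𝒢] {D : NormedDGLA 𝕜 𝒢}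

namespace Hodge

variable (S : Hodge D)

theorem ops_harm (x : G) : S.ops.harm x = S.P x := by
  have h := S.decomp x
  rw [Ops.harm]
  simp only [ops]
  nth_rewrite 1 [h]
  abel

theorem parity_apply_of_mem {i : ℤ} {a : G} (ha : a ∈ 𝒢 i) :
    parity 𝒢 a = ((i.negOnePow : ℤˣ) : ℤ) • a := by
  rw [parity_of_mem 𝒢 ha, Units.smul_def]

theorem d_η_d (x : G) : D.d (S.η (D.d x)) = D.d x := by
  have h := S.d_P x
  rw [← S.ops_harm, Ops.harm, map_sub, map_sub] at h
  simp only [ops, D.d_d, sub_zero] at h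
  exact (sub_eq_zero.mp h).symm

@[simp] theorem ops_d : S.ops.d = D.d := rfl
@[simp] theorem ops_η : S.ops.η = S.η := rfl
@[simp] theorem ops_br : S.ops.br = D.br := rfl

theorem ops_isSuper : S.ops.IsSuper (parity 𝒢) := by
  refine ⟨parity_parity 𝒢, fun x => ?_, fun x => ?_, ?_, D.d_d, S.d_η_d, fun x => ?_, ?_, ?_⟩
  · induction x using DirectSum.Decomposition.inductionOn 𝒢 with
    | zero => simp
    | @homogeneous i m =>
      rw [ops_d, parity_apply_of_mem (D.d_mem i m m.2), parity_apply_of_mem m.2, Int.negOnePow_succ]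
      simp
    | add x y hx hy => simp only [map_add, hx, hy, neg_add]
  · induction x using DirectSum.Decomposition.inductionOn 𝒢 with
    | zero => simp
    | @homogeneous i m =>
      rw [ops_η, parity_apply_of_mem (S.η_mem i m m.2), parity_apply_of_mem m.2, Int.negOnePow_sub]
      simp
    | add x y hx hy => simp only [map_add, hx, hy, neg_add]
  · refine decomposition_induction₂ 𝒢 (fun x y z h h' => ?_) (fun x y z h h' => ?_)
      fun i j x hx y hy => ?_
    · simp only [map_add, LinearMap.add_apply, h, h']
    · simp only [map_add, h, h']
    · rw [ops_br, parity_apply_of_mem hx, parity_apply_of_mem hy,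
        parity_apply_of_mem (D.br_mem i j x hx y hy), Int.negOnePow_add, map_zsmul, map_zsmul,
        LinearMap.smul_apply, smul_smul, Units.val_mul, mul_comm]
  · have h := S.P_P (D.d x)
    have e : ∀ x, S.P x = x - D.d (S.η x) - S.η (D.d x) := fun x => by rw [← S.ops_harm]; rfl
    have h2 := S.P_P (S.η (D.d x))
    rw [e (S.η (D.d x)), S.d_η_d, sub_right_comm, sub_self, zero_sub, map_neg, neg_inj, e] at h2
    rw [D.d_d, map_zero, sub_zero, sub_eq_self] at h2
    simp only [ops_d, ops_η]
    rw [← S.d_η_d, h2]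
  · refine decomposition_induction₂ 𝒢 (fun x y z h h' => ?_) (fun x y z h h' => ?_)
      fun i j x hx y hy => ?_
    · simp only [map_add, LinearMap.add_apply, h, h']; abel
    · simp only [map_add, h, h']; abel
    · rw [parity_apply_of_mem hx]
      have h := D.leibniz i x hx y
      rw [Units.smul_def] at h
      rw [ops_d, ops_br, h, map_zsmul, LinearMap.smul_apply]
  · refine decomposition_induction₂ 𝒢 (fun x y z h h' => ?_) (fun x y z h h' => ?_)
      fun i j x hx y hy => ?_
    · simp only [map_add, LinearMap.add_apply, smul_add, h, h']; abel
    · simp only [map_add, LinearMap.add_apply, smul_add, h, h']; abel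
    · rw [parity_apply_of_mem hx, parity_apply_of_mem hy]
      have h := D.antisymm i j x hx y hy
      simp only [ops]
      rw [h]
      rcases Int.even_or_odd i with hi | hi <;> rcases Int.even_or_odd j with hj | hj
      · rw [Int.negOnePow_even i hi, Int.negOnePow_even j hj, Int.negOnePow_even _ (hi.mul_right j)]
        simp; module
      · rw [Int.negOnePow_even i hi, Int.negOnePow_odd j hj, Int.negOnePow_even _ (hi.mul_right j)]
        simp; module
      · rw [Int.negOnePow_odd i hi, Int.negOnePow_even j hj, Int.negOnePow_even _ (hj.mul_left i)]
        simp; module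
      · rw [Int.negOnePow_odd i hi, Int.negOnePow_odd j hj, Int.negOnePow_odd _ (hi.mul hj)]
        simp; module

variable (B : GradedArtin.{u, v} 𝕜)

theorem opsT_isSuper : (S.opsT B).IsSuper (TensorProduct.map (parity 𝒢) (parity B.gr)) :=
  S.ops_isSuper.tensor B.isSuperComm

theorem opsT_harm (t : G ⊗[𝕜] B) : (S.opsT B).harm t = S.P.rTensor B t := by
  induction t with
  | zero => simp [Ops.harm]
  | add x y hx hy => rw [map_add, ← hx, ← hy, ← Ops.harmL_apply, map_add]; rfl
  | tmul a x =>
    rw [LinearMap.rTensor_tmul, ← S.ops_harm]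
    simp [Ops.harm, opsT, Ops.tensor, TensorProduct.sub_tmul]

variable {B}

theorem d_mem_deg {n m : ℤ} (hm : n + 1 = m) {t : G ⊗[𝕜] B} (ht : t ∈ S.deg B n) :
    (S.opsT B).d t ∈ S.deg B m := rTensor_mem_degOf D.d_mem hm ht

theorem η_mem_deg {n m : ℤ} (hm : n - 1 = m) {t : G ⊗[𝕜] B} (ht : t ∈ S.deg B n) :
    (S.opsT B).η t ∈ S.deg B m := rTensor_mem_degOf S.η_mem hm ht

theorem br_mem_deg {m n k : ℤ} (hk : m + n = k) {s t : G ⊗[𝕜] B} (hs : s ∈ S.deg B m)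
    (ht : t ∈ S.deg B n) : (S.opsT B).br s t ∈ S.deg B k :=
  tensor_br_mem_degOf (fun _ _ => parity_apply_of_mem) D.br_mem hk hs ht

theorem harm_mem_deg {n : ℤ} {t : G ⊗[𝕜] B} (ht : t ∈ S.deg B n) :
    (S.opsT B).harm t ∈ S.deg B n := by
  rw [opsT_harm]
  exact rTensor_mem_degOf (k := 0) (fun i a ha => by rw [add_zero]; exact S.P_mem i a ha) (add_zero n) ht

theorem kur_mem_deg {t : G ⊗[𝕜] B} (ht : t ∈ S.deg B 1) : (S.opsT B).kur t ∈ S.deg B 1 :=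
  add_mem ht (Submodule.smul_mem _ _ (S.η_mem_deg (by norm_num) (S.br_mem_deg rfl ht ht)))

theorem odd_of_mem_deg {t : G ⊗[𝕜] B} (ht : t ∈ S.deg B 1) :
    TensorProduct.map (parity 𝒢) (parity B.gr) t = -t := by
  simpa using map_parity_of_mem_degOf (fun _ _ => parity_apply_of_mem) ht

theorem even_of_mem_deg {t : G ⊗[𝕜] B} (ht : t ∈ S.deg B 0) :
    TensorProduct.map (parity 𝒢) (parity B.gr) t = t := by
  simpa using map_parity_of_mem_degOf (fun _ _ => parity_apply_of_mem) ht

/-- The operator `x ↦ η[x, Γ]`. -/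
noncomputable def ad (Γ : G ⊗[𝕜] B) : G ⊗[𝕜] B →ₗ[𝕜] G ⊗[𝕜] B :=
  (S.opsT B).η ∘ₗ (S.opsT B).br.flip Γ

theorem ad_raises {Γ : G ⊗[𝕜] B} (hΓ : Γ ∈ S.deg B 1) (n : ℕ) (t : G ⊗[𝕜] B)
    (ht : t ∈ tfil G B n) : S.ad Γ t ∈ tfil G B (n + 1) :=
  rTensor_mem_tfil _ (tensor_br_mem_tfil _ _ rfl ht (degOf_le_tfil_one 1 hΓ))

theorem ad_nilpotent {Γ : G ⊗[𝕜] B} (hΓ : Γ ∈ S.deg B 1) : ∃ N, ∀ t, (S.ad Γ)^[N] t = 0 := by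
  obtain ⟨N, hN⟩ := exists_tfil_eq_bot G B
  refine ⟨N, fun t => ?_⟩
  have := iterate_mem_of_raises tfil_zero (S.ad_raises hΓ) N t
  rwa [hN] at this

theorem neg_iterate_eq_zero {T : Type*} [AddCommGroup T] [Module 𝕜 T] {f : T →ₗ[𝕜] T} {N : ℕ}
    (h : ∀ t, f^[N] t = 0) (t : T) : (-f)^[N] t = 0 := by
  rw [← Module.End.coe_pow] at *
  rw [neg_pow]
  simp [h]

/-- The Maurer–Cartan equation says that the Kuranishi map takes `Γ` to a cocycle. -/
theorem mem_MC_iff {Γ : G ⊗[𝕜] B} :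
    Γ ∈ S.MC B ↔ Γ ∈ S.deg B 1 ∧ (S.opsT B).d ((S.opsT B).kur Γ) = 0 := by
  refine and_congr_right fun hΓ => ?_
  obtain ⟨N, hN⟩ := S.ad_nilpotent hΓ
  rw [eventually_eq_iff_of_nilpotent hN (n₀ := 2) (c := -(S.opsT B).d ((S.opsT B).kur Γ))]
  · simp [eq_comm]
  · intro n hn
    obtain ⟨k, rfl⟩ := Nat.exists_eq_add_of_le' hn
    exact (S.opsT_isSuper B).sum_mcTerm (S.odd_of_mem_deg hΓ) k

/-- On solutions of the Maurer–Cartan equation, `d_Γ v` is the unique `w` with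
`w + η[w, Γ] = d(v + η[Γ, v])`. -/
theorem eventually_sum_twistTerm_iff {Γ v w : G ⊗[𝕜] B} (hΓ : Γ ∈ S.MC B) (hv : v ∈ S.deg B 0) :
    (∀ᶠ n in atTop, ∑ k ∈ Finset.range n, (S.opsT B).twistTerm Γ v k = w) ↔
      w + (S.opsT B).η ((S.opsT B).br w Γ) = (S.opsT B).d (v + (S.opsT B).η ((S.opsT B).br Γ v)) := by
  obtain ⟨N, hN⟩ := S.ad_nilpotent hΓ.1
  obtain ⟨n₀, hn₀⟩ := eventually_atTop.mp hΓ.2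
  rw [eventually_eq_iff_of_nilpotent (neg_iterate_eq_zero hN) (n₀ := n₀ + 1)
    (c := (S.opsT B).d (v + (S.opsT B).η ((S.opsT B).br Γ v)))]
  · simp [ad]
  · intro n hn
    obtain ⟨k, rfl⟩ := Nat.exists_eq_add_of_le' (show 1 ≤ n by omega)
    have h := (S.opsT_isSuper B).sum_twistTerm (S.odd_of_mem_deg hΓ.1) (S.even_of_mem_deg hv) k
    rw [hn₀ (k + 2) (by omega)] at h
    simpa [ad] using h

/-- `Γ ↦ ½ π η[Γ, Γ]` as a bilinear map. -/
noncomputable def quad (π : G →ₗ[𝕜] G) (B : GradedArtin.{u, v} 𝕜) :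
    G ⊗[𝕜] B →ₗ[𝕜] G ⊗[𝕜] B →ₗ[𝕜] G ⊗[𝕜] B :=
  (S.opsT B).br.compr₂ ((2⁻¹ : 𝕜) • (π.rTensor B ∘ₗ (S.opsT B).η))

theorem quad_apply (π : G →ₗ[𝕜] G) (s t : G ⊗[𝕜] B) :
    S.quad π B s t = (2⁻¹ : 𝕜) • π.rTensor B ((S.opsT B).η ((S.opsT B).br s t)) := rfl

theorem quad_mem_deg {π : G →ₗ[𝕜] G} (hπ : ∀ i, ∀ a ∈ 𝒢 i, π a ∈ 𝒢 i) {s t : G ⊗[𝕜] B}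
    (hs : s ∈ S.deg B 1) (ht : t ∈ S.deg B 1) : S.quad π B s t ∈ S.deg B 1 := by
  refine Submodule.smul_mem _ _ (rTensor_mem_degOf (k := 0) (W := 𝒢) (fun i a ha => ?_) (add_zero 1)
    (S.η_mem_deg (by norm_num) (S.br_mem_deg rfl hs ht)))
  rw [add_zero]
  exact hπ i a ha

theorem exists_newtonData {π : G →ₗ[𝕜] G} (hπ : ∀ i, ∀ a ∈ 𝒢 i, π a ∈ 𝒢 i)
    (B : GradedArtin.{u, v} 𝕜) :
    ∃ N, NewtonData (tfil G B) (S.deg B 1) N (S.quad π B) LinearMap.id 0 := by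
  obtain ⟨N, hN⟩ := exists_tfil_eq_bot G B
  refine ⟨N, tfil_antitone, hN, tfil_zero, fun m n s hs t ht => ?_,
    fun s hs t ht => S.quad_mem_deg hπ hs ht, fun n s hs => hs, fun s hs => hs, by simp, by simp,
    zero_mem _⟩
  exact Submodule.smul_mem _ _ (rTensor_mem_tfil _ (rTensor_mem_tfil _
    (tensor_br_mem_tfil _ _ rfl hs ht)))

theorem exists_quad_eq {π : G →ₗ[𝕜] G} (hπ : ∀ i, ∀ a ∈ 𝒢 i, π a ∈ 𝒢 i) {h : G ⊗[𝕜] B}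
    (hh : h ∈ S.deg B 1) : ∃ Γ ∈ S.deg B 1, Γ + S.quad π B Γ Γ = h := by
  obtain ⟨N, H⟩ := S.exists_newtonData hπ B
  have h0 : (0 : G ⊗[𝕜] B) + S.quad π B 0 0 - h ∈ tfil G B 1 := by
    simpa using degOf_le_tfil_one 1 hh
  exact ⟨_, (H.newton_spec hh h0 N).1, H.newton_eq hh h0⟩

theorem eq_of_quad_eq {π : G →ₗ[𝕜] G} (hπ : ∀ i, ∀ a ∈ 𝒢 i, π a ∈ 𝒢 i) {s t : G ⊗[𝕜] B}
    (hs : s ∈ S.deg B 1) (ht : t ∈ S.deg B 1) (h : s + S.quad π B s s = t + S.quad π B t t) :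
    s = t := by
  obtain ⟨N, H⟩ := S.exists_newtonData hπ B
  exact H.unique hs ht (by simpa using degOf_le_tfil_one 1 hs)
    (by simpa using degOf_le_tfil_one 1 ht) h

theorem kur_eq_quad (Γ : G ⊗[𝕜] B) : (S.opsT B).kur Γ = Γ + S.quad LinearMap.id B Γ Γ := by
  simp [Ops.kur, quad_apply]

/-- The harmonic elements of `(𝔤 ⊗ m_B)¹`. -/
def HarmPts (B : GradedArtin.{u, v} 𝕜) : Set (G ⊗[𝕜] B) :=
  {h | h ∈ S.deg B 1 ∧ (S.opsT B).harm h = h}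

theorem kappa_mem_harmPts {Γ : G ⊗[𝕜] B} (hΓ : Γ ∈ S.deg B 1) :
    (S.opsT B).kappa Γ ∈ S.HarmPts B :=
  ⟨S.harm_mem_deg (S.kur_mem_deg hΓ), (S.opsT_isSuper B).harm_harm _⟩

/-- The Kuranishi map takes a gauge path to a path whose derivative is exact. -/
theorem kappa_eq_of_gauge {Γ₀ Γ₁ : S.MC B} (h : S.Gauge B Γ₀ Γ₁) :
    (S.opsT B).kappa (Γ₀ : G ⊗[𝕜] B) = (S.opsT B).kappa (Γ₁ : G ⊗[𝕜] B) := by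
  obtain ⟨c, a, hc, ha, h0, h1, h2⟩ := h
  have H := S.opsT_isSuper B
  have p0 : ((path c, pathDeriv c) : (𝕜 → G ⊗[𝕜] B) × (𝕜 → G ⊗[𝕜] B)) ∈ PolyPath (S.deg B 1) :=
    PolyPath.of_path hc
  have p1 := PolyPath.map₂ (O'' := S.deg B 1) (S.quad LinearMap.id B)
    (fun x hx y hy => S.quad_mem_deg (fun _ _ h => h) hx hy) p0 p0
  have p2 := PolyPath.map (O' := S.deg B 1) (S.opsT B).harmL
    (fun x hx => S.harm_mem_deg hx) (add_mem p0 p1)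
  have key := PolyPath.eq_of_deriv_eq_zero p2 (fun s => ?_) 0 1
  · simp only [Prod.fst_add, Pi.add_apply, ← S.kur_eq_quad, h0, h1] at key
    exact key
  · obtain ⟨h3, h4⟩ := h2 s
    have ha' : path a s ∈ S.deg B 0 :=
      (PolyPath.mem (PolyPath.of_path (𝕜 := 𝕜) ha) s).1
    have hc' : pathDeriv c s ∈ S.deg B 1 := (PolyPath.mem p0 s).2
    have h5 := (S.eventually_sum_twistTerm_iff h3 ha').mp h4
    have h6 : (S.opsT B).br (path c s) (pathDeriv c s) = (S.opsT B).br (pathDeriv c s) (path c s) :=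
      H.br_comm_odd (S.odd_of_mem_deg h3.1) (S.odd_of_mem_deg hc')
    simp only [Prod.snd_add, Pi.add_apply, quad_apply, h6, LinearMap.rTensor_id,
      LinearMap.id_apply, Ops.harmL_apply]
    rw [show ∀ t : G ⊗[𝕜] B, (2⁻¹ : 𝕜) • t + (2⁻¹ : 𝕜) • t = t from fun t => by module, h5, H.harm_d]

/-- Solutions with the same image under `κ` are joined by the preimage under the Kuranishi map of a
segment of cohomologous cocycles. -/
theorem gauge_of_kappa_eq {Γ₀ Γ₁ : S.MC B}
    (h : (S.opsT B).kappa (Γ₀ : G ⊗[𝕜] B) = (S.opsT B).kappa (Γ₁ : G ⊗[𝕜] B)) :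
    S.Gauge B Γ₀ Γ₁ := by
  have H := S.opsT_isSuper B
  obtain ⟨Γ₀, hΓ₀⟩ := Γ₀
  obtain ⟨Γ₁, hΓ₁⟩ := Γ₁
  obtain ⟨hd₀, hz₀⟩ := S.mem_MC_iff.mp hΓ₀
  obtain ⟨hd₁, hz₁⟩ := S.mem_MC_iff.mp hΓ₁
  simp only at h
  set k₀ := (S.opsT B).kur Γ₀ with hk₀
  set k₁ := (S.opsT B).kur Γ₁ with hk₁
  have hk₀d : k₀ ∈ S.deg B 1 := S.kur_mem_deg hd₀
  have hk₁d : k₁ ∈ S.deg B 1 := S.kur_mem_deg hd₁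
  set β := (S.opsT B).η (k₁ - k₀) with hβ
  have hβd : β ∈ S.deg B 0 := S.η_mem_deg (by norm_num) (sub_mem hk₁d hk₀d)
  have hdβ : (S.opsT B).d β = k₁ - k₀ := by
    have h1 : (S.opsT B).harmL (k₁ - k₀) = 0 := by
      rw [map_sub, Ops.harmL_apply, Ops.harmL_apply, sub_eq_zero]; exact h.symm
    rw [Ops.harmL_apply, Ops.harm, map_sub (S.opsT B).d k₁ k₀, hz₀, hz₁, sub_zero, map_zero, sub_zero,
      sub_eq_zero] at h1
    exact h1.symm
  have hdβd : (S.opsT B).d β ∈ S.deg B 1 := S.d_mem_deg (by norm_num) hβd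
  have hid : ∀ i, ∀ a ∈ 𝒢 i, (LinearMap.id : G →ₗ[𝕜] G) a ∈ 𝒢 i := fun _ _ h => h
  have hQO : ∀ x ∈ S.deg B 1, ∀ y ∈ S.deg B 1, S.quad LinearMap.id B x y ∈ S.deg B 1 :=
    fun x hx y hy => S.quad_mem_deg hid hx hy
  obtain ⟨N, HN⟩ := S.exists_newtonData hid B
  -- the segment from `K(Γ₀)` to `K(Γ₁)`
  set seg : 𝕜 → G ⊗[𝕜] B := fun s => k₀ + s • (S.opsT B).d β with hseg
  have psegP : ((seg, fun _ => (S.opsT B).d β) : (𝕜 → G ⊗[𝕜] B) × (𝕜 → G ⊗[𝕜] B)) ∈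
      PolyPath (S.deg B 1) := PolyPath.affine hk₀d hdβd
  have hsegd : ∀ s, seg s ∈ S.deg B 1 := fun s => (PolyPath.mem psegP s).1
  have hseg0 : ∀ s, (0 : G ⊗[𝕜] B) + S.quad LinearMap.id B 0 0 - seg s ∈ tfil G B 1 := fun s => by
    simpa using degOf_le_tfil_one 1 (hsegd s)
  -- its preimage under the Kuranishi map is a polynomial path
  have pnewton : ∀ n, ∃ g : 𝕜 → G ⊗[𝕜] B,
      ((fun s => newton (S.quad LinearMap.id B) LinearMap.id 0 (seg s) n, g) :
        (𝕜 → G ⊗[𝕜] B) × (𝕜 → G ⊗[𝕜] B)) ∈ PolyPath (S.deg B 1) := fun n => by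
    induction n with
    | zero => exact ⟨_, PolyPath.const (zero_mem _)⟩
    | succ n ih =>
      obtain ⟨g, hg⟩ := ih
      exact ⟨_, sub_mem hg (sub_mem (add_mem hg (PolyPath.map₂ _ hQO hg hg)) psegP)⟩
  obtain ⟨g, hg⟩ := pnewton N
  set γ : 𝕜 → G ⊗[𝕜] B := fun s => newton (S.quad LinearMap.id B) LinearMap.id 0 (seg s) N
  have hγd : ∀ s, γ s ∈ S.deg B 1 := fun s => (PolyPath.mem hg s).1
  have hgd : ∀ s, g s ∈ S.deg B 1 := fun s => (PolyPath.mem hg s).2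
  have hγ : ∀ s, (S.opsT B).kur (γ s) = seg s := fun s => by
    rw [S.kur_eq_quad]; exact HN.newton_eq (hsegd s) (hseg0 s)
  have hγMC : ∀ s, γ s ∈ S.MC B := fun s => S.mem_MC_iff.mpr ⟨hγd s, by
    rw [hγ, hseg]; simp [hz₀, H.d_d]⟩
  have hγ0 : γ 0 = Γ₀ := S.eq_of_quad_eq hid (hγd 0) hd₀ (by
    rw [← S.kur_eq_quad, ← S.kur_eq_quad, hγ, hseg]; simp [hk₀])
  have hγ1 : γ 1 = Γ₁ := S.eq_of_quad_eq hid (hγd 1) hd₁ (by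
    rw [← S.kur_eq_quad, ← S.kur_eq_quad, hγ, hseg]; simp [hdβ, ← hk₁])
  -- differentiating `K(γ(s))` gives the derivative of the segment
  have hderiv : ∀ s, g s + (S.opsT B).η ((S.opsT B).br (g s) (γ s)) = (S.opsT B).d β := fun s => by
    have p1 := add_mem hg (PolyPath.map₂ _ hQO hg hg)
    have h1 := PolyPath.deriv_unique p1 psegP (by
      funext s
      simp only [Prod.fst_add, Pi.add_apply, ← S.kur_eq_quad]
      exact hγ s)
    have h2 := congrFun h1 s
    have h6 : (S.opsT B).br (γ s) (g s) = (S.opsT B).br (g s) (γ s) :=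
      H.br_comm_odd (S.odd_of_mem_deg (hγd s)) (S.odd_of_mem_deg (hgd s))
    simp only [Prod.snd_add, Pi.add_apply, quad_apply, LinearMap.rTensor_id, LinearMap.id_apply] at h2
    rw [show (S.opsT B).br (newton (S.quad LinearMap.id B) LinearMap.id 0 (seg s) N) (g s) =
      (S.opsT B).br (g s) (γ s) from h6] at h2
    rw [← h2]
    congr 1
    module
  -- solving `α + η[γ(s), α] = β` polynomially in `s`
  have hηO : ∀ x ∈ S.deg B 1, ∀ y ∈ S.deg B 0,
      (S.opsT B).br.compr₂ (S.opsT B).η x y ∈ S.deg B 0 := fun x hx y hy =>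
    S.η_mem_deg (by norm_num) (S.br_mem_deg rfl hx hy)
  have palpha : ∀ n, ∃ f ∈ PolyPath (S.deg B 0), ∀ s,
      f.1 s + (S.opsT B).η ((S.opsT B).br (γ s) (f.1 s)) - β ∈ tfil G B n := fun n => by
    induction n with
    | zero => exact ⟨0, zero_mem _, fun s => by rw [tfil_zero]; trivial⟩
    | succ n ih =>
      obtain ⟨f, hf, hf'⟩ := ih
      refine ⟨_, sub_mem (PolyPath.const hβd) (PolyPath.map₂ _ hηO hg hf), fun s => ?_⟩
      have : β - (S.opsT B).η ((S.opsT B).br (γ s) (f.1 s)) +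
          (S.opsT B).η ((S.opsT B).br (γ s) (β - (S.opsT B).η ((S.opsT B).br (γ s) (f.1 s)))) - β =
          -(S.opsT B).η ((S.opsT B).br (γ s)
            (f.1 s + (S.opsT B).η ((S.opsT B).br (γ s) (f.1 s)) - β)) := by
        simp only [map_sub, map_add]; abel
      refine (this ▸ neg_mem ?_ : _ ∈ tfil G B (n + 1))
      exact rTensor_mem_tfil _ (tensor_br_mem_tfil _ _ (add_comm 1 n)
        (degOf_le_tfil_one 1 (hγd s)) (hf' s))
  obtain ⟨f, hf, hf'⟩ := palpha N
  obtain ⟨c, hc, hc1, hc2⟩ := PolyPath.exists_path hg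
  obtain ⟨a, ha, ha1, -⟩ := PolyPath.exists_path hf
  refine ⟨c, a, hc, ha, by rw [hc1]; exact hγ0, by rw [hc1]; exact hγ1, fun s => ?_⟩
  rw [hc1, hc2, ha1]
  refine ⟨hγMC s, (S.eventually_sum_twistTerm_iff (hγMC s) (PolyPath.mem hf s).1).mpr ?_⟩
  have h7 := hf' s
  rw [HN.F_N] at h7
  rw [show f.1 s + (S.opsT B).η ((S.opsT B).br (γ s) (f.1 s)) = β from sub_eq_zero.mp h7]
  exact hderiv s

/-- Gauge classes are classified by `κ`. -/
theorem mk_eq_mk_iff (Γ Γ' : S.MC B) :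
    (Quot.mk (S.Gauge B) Γ = Quot.mk _ Γ') ↔
      (S.opsT B).kappa (Γ : G ⊗[𝕜] B) = (S.opsT B).kappa (Γ' : G ⊗[𝕜] B) := by
  refine ⟨fun h => ?_, fun h => Quot.sound (S.gauge_of_kappa_eq h)⟩
  exact congrArg (Quot.lift (fun Γ : S.MC B => (S.opsT B).kappa (Γ : G ⊗[𝕜] B))
    fun _ _ h => S.kappa_eq_of_gauge h) h

theorem exists_MC_kappa_eq {h : G ⊗[𝕜] B} (hh : h ∈ S.HarmPts B) :
    ∃ Γ : S.MC B, (S.opsT B).kappa (Γ : G ⊗[𝕜] B) = h := by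
  obtain ⟨Γ, hΓ, e⟩ := S.exists_quad_eq (π := LinearMap.id) (fun _ _ h => h) hh.1
  rw [← S.kur_eq_quad] at e
  refine ⟨⟨Γ, S.mem_MC_iff.mpr ⟨hΓ, ?_⟩⟩, ?_⟩
  · rw [e, ← hh.2, (S.opsT_isSuper B).d_harm]
  · rw [Ops.kappa, e, hh.2]

variable (B) in
/-- The map `MDef_𝔤(B) → (H ⊗ m_B)¹` induced by `κ` is a bijection. -/
noncomputable def mdefEquiv : S.MDef B ≃ S.HarmPts B :=
  Equiv.ofBijective
    (Quot.lift (fun Γ : S.MC B => ⟨(S.opsT B).kappa (Γ : G ⊗[𝕜] B), S.kappa_mem_harmPts Γ.2.1⟩)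
      fun _ _ h => Subtype.ext (S.kappa_eq_of_gauge h)) <| by
    constructor
    · rintro ⟨Γ⟩ ⟨Γ'⟩ h
      exact (S.mk_eq_mk_iff Γ Γ').mpr (congrArg Subtype.val h)
    · intro h
      obtain ⟨Γ, hΓ⟩ := S.exists_MC_kappa_eq h.2
      exact ⟨Quot.mk _ Γ, Subtype.ext hΓ⟩

theorem mdefEquiv_mk (Γ : S.MC B) :
    (S.mdefEquiv B (Quot.mk _ Γ) : G ⊗[𝕜] B) = (S.opsT B).kappa (Γ : G ⊗[𝕜] B) := rfl

theorem mdefEquiv_symm_eq_iff (h : S.HarmPts B) (Γ : S.MC B) :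
    (S.mdefEquiv B).symm h = Quot.mk _ Γ ↔ (S.opsT B).kappa (Γ : G ⊗[𝕜] B) = h := by
  refine (Equiv.symm_apply_eq _).trans ?_
  rw [Subtype.ext_iff, S.mdefEquiv_mk, eq_comm]

/-! ### Complements of the coboundaries -/

theorem tmap_ops (B B' : GradedArtin.{u, v} 𝕜) (f : GradedArtin.Hom B B') :
    (∀ x, S.tmap f ((S.opsT B).d x) = (S.opsT B').d (S.tmap f x)) ∧
    (∀ x, S.tmap f ((S.opsT B).η x) = (S.opsT B').η (S.tmap f x)) ∧
    ∀ x y, S.tmap f ((S.opsT B).br x y) = (S.opsT B').br (S.tmap f x) (S.tmap f y) := by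
  refine ⟨fun x => ?_, fun x => ?_, fun x y => ?_⟩
  · induction x with
    | zero => simp
    | tmul a b => simp [tmap, opsT, Ops.tensor]
    | add x y hx hy => simp [hx, hy]
  · induction x with
    | zero => simp
    | tmul a b => simp [tmap, opsT, Ops.tensor]
    | add x y hx hy => simp [hx, hy]
  · induction x with
    | zero => simp
    | add x y hx hy => simp [hx, hy]
    | tmul a b =>
      induction y with
      | zero => simp
      | add x y hx hy => simp [hx, hy]
      | tmul a' b' => simp [tmap, opsT, Ops.tensor, f.map_parity]

theorem tmap_kappa {B B' : GradedArtin.{u, v} 𝕜} (f : GradedArtin.Hom B B') (Γ : G ⊗[𝕜] B) :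
    S.tmap f ((S.opsT B).kappa Γ) = (S.opsT B').kappa (S.tmap f Γ) := by
  obtain ⟨h1, h2, h3⟩ := S.tmap_ops B B' f
  exact Ops.map_kappa _ _ _ h1 h2 h3 Γ

theorem decompose_d (y : G) (i : ℤ) :
    (DirectSum.decompose 𝒢 (D.d y) i : G) = D.d (DirectSum.decompose 𝒢 y (i - 1)) := by
  induction y using DirectSum.Decomposition.inductionOn 𝒢 with
  | zero => simp
  | @homogeneous j m =>
    by_cases h : j = i - 1
    · subst h
      rw [DirectSum.decompose_of_mem_same _ m.2, DirectSum.decompose_of_mem_same]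
      simpa using D.d_mem _ m m.2
    · rw [DirectSum.decompose_of_mem_ne _ m.2 h, map_zero,
        DirectSum.decompose_of_mem_ne _ (D.d_mem _ m m.2) (by omega)]
  | add x y hx hy => simp [DirectSum.decompose_add, hx, hy]

/-- The projection to a graded complement of the coboundaries preserves the degree. -/
theorem IsComplement.exists_proj {S : Hodge D} {C : Submodule 𝕜 G} (hC : S.IsComplement C) :
    ∃ π : G →ₗ[𝕜] G, (∀ i, ∀ a ∈ 𝒢 i, π a ∈ 𝒢 i) ∧ (∀ a, π a ∈ C) ∧ (∀ a ∈ C, π a = a) ∧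
      (∀ a, π (D.d a) = 0) ∧ ∀ a, D.d (π a) = D.d a ∧ S.P (π a) = S.P a := by
  set π := C.projection _ hC.isCompl with hπ
  have hC1 : ∀ a, π a ∈ C := Submodule.projection_apply_mem hC.isCompl
  have hC2 : ∀ a ∈ C, π a = a := fun a ha => Submodule.projection_apply_left hC.isCompl ⟨a, ha⟩
  have hker : ∀ a, ∃ y, D.d y = a - π a := fun a => Submodule.sub_projection_mem hC.isCompl a
  have hd : ∀ y, π (D.d y) = 0 := fun y =>
    (Submodule.projection_apply_eq_zero_iff hC.isCompl).mpr ⟨y, rfl⟩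
  have hPd : ∀ y, S.P (D.d y) = 0 := fun y => by
    rw [← S.ops_harm]; exact S.ops_isSuper.harm_d y
  refine ⟨π, fun i a ha => ?_, hC1, hC2, hd, fun a => ?_⟩
  · obtain ⟨y, hy⟩ := hker a
    have h1 := decompose_d (D := D) y i
    rw [hy, DirectSum.decompose_sub, DirectSum.sub_apply, AddSubgroupClass.coe_sub,
      DirectSum.decompose_of_mem_same _ ha, sub_eq_iff_eq_add] at h1
    have h2 : π a = DirectSum.decompose 𝒢 (π a) i := by
      nth_rewrite 1 [h1]
      rw [map_add, hd, zero_add, hC2 _ (hC.homogeneous _ (hC1 a) i)]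
    rw [h2]
    exact SetLike.coe_mem _
  · obtain ⟨y, hy⟩ := hker a
    rw [eq_sub_iff_add_eq] at hy
    conv => 
      congr
      · rhs; rw [← hy]
      · rhs; rw [← hy]
    simp [D.d_d, hPd]

/-- Every gauge class has exactly one representative in a complement `C` of the coboundaries: with
the projection `π` to `C`, these representatives are the solutions of
`Γ + ½ π η[Γ, Γ] = π h` for harmonic `h`, and `h = κ(Γ)`. -/
theorem bijective_kappa_mdefC {C : Submodule 𝕜 G} (hC : S.IsComplement C)
    (B : GradedArtin.{u, v} 𝕜) :
    Function.Bijective (fun Γ : S.MDefC B C =>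
      (⟨(S.opsT B).kappa (Γ : G ⊗[𝕜] B), S.kappa_mem_harmPts Γ.2.1.1⟩ : S.HarmPts B)) := by
  obtain ⟨π, hπ, hπC, hπC', hπd, hdP⟩ := hC.exists_proj
  have H := S.opsT_isSuper B
  have hπT : ∀ Γ ∈ LinearMap.range (TensorProduct.mapIncl C B.max), π.rTensor B Γ = Γ := by
    rintro _ ⟨t, rfl⟩
    induction t with
    | zero => simp
    | add x y hx hy => simp only [map_add, hx, hy]
    | tmul a x => simp [TensorProduct.mapIncl, hπC' a a.2]
  have hπd' : ∀ t, π.rTensor B ((S.opsT B).d t) = 0 := fun t => by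
    induction t with
    | zero => simp
    | add x y hx hy => simp only [map_add, hx, hy, add_zero]
    | tmul a x => simp [opsT, Ops.tensor, hπd]
  have hdπ : ∀ t, (S.opsT B).d (π.rTensor B t) = (S.opsT B).d t := fun t => by
    induction t with
    | zero => simp
    | add x y hx hy => simp only [map_add, hx, hy]
    | tmul a x => simp [opsT, Ops.tensor, hdP]
  have hPπ : ∀ t, (S.opsT B).harm (π.rTensor B t) = (S.opsT B).harm t := fun t => by
    simp only [opsT_harm]
    induction t with
    | zero => simp
    | add x y hx hy => simp only [map_add, hx, hy]
    | tmul a x => simp [hdP]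
  have hdeg : ∀ n, ∀ t ∈ S.deg B n, π.rTensor B t ∈ S.deg B n := fun n t ht =>
    rTensor_mem_degOf (k := 0) (fun i a ha => by rw [add_zero]; exact hπ i a ha) (add_zero n) ht
  have hdegC : ∀ t ∈ S.deg B 1, π.rTensor B t ∈ LinearMap.range (TensorProduct.mapIncl C B.max) := by
    intro t ht
    suffices h : S.deg B 1 ≤ (LinearMap.range (TensorProduct.mapIncl C B.max)).comap
      (π.rTensor B) from h ht
    exact degOf_le fun i a ha x hx hx' => ⟨⟨π a, hπC a⟩ ⊗ₜ ⟨x, hx'⟩, by simp [TensorProduct.mapIncl]⟩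
  have hQ : ∀ Γ ∈ LinearMap.range (TensorProduct.mapIncl C B.max),
      Γ + S.quad π B Γ Γ = π.rTensor B ((S.opsT B).kur Γ) := fun Γ hΓ => by
    rw [Ops.kur, map_add, hπT Γ hΓ, map_smul, quad_apply]
  have hcocycle : ∀ t, (S.opsT B).d t = 0 →
      π.rTensor B t = π.rTensor B ((S.opsT B).harm t) := fun t ht => by
    rw [Ops.harm, ht, map_zero, sub_zero, map_sub, hπd', sub_zero]
  constructor
  · rintro ⟨Γ, hΓ, hΓC⟩ ⟨Γ', hΓ', hΓC'⟩ h
    have h1 : (S.opsT B).kappa Γ = (S.opsT B).kappa Γ' := congrArg Subtype.val h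
    refine Subtype.ext (S.eq_of_quad_eq hπ hΓ.1 hΓ'.1 ?_)
    rw [hQ _ hΓC, hQ _ hΓC', hcocycle _ (S.mem_MC_iff.mp hΓ).2, hcocycle _ (S.mem_MC_iff.mp hΓ').2]
    exact congrArg _ h1
  · rintro ⟨h, hh, hh'⟩
    obtain ⟨Γ, hΓ, e⟩ := S.exists_quad_eq hπ (hdeg 1 h hh)
    have hidem : ∀ t : G ⊗[𝕜] B, π.rTensor B (π.rTensor B t) = π.rTensor B t := fun t => by
      rw [← LinearMap.comp_apply, ← LinearMap.rTensor_comp]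
      congr 2
      ext a
      exact hπC' _ (hπC a)
    have hπΓ : π.rTensor B Γ = Γ := by
      have h1 : Γ = π.rTensor B (h - (2⁻¹ : 𝕜) • (S.opsT B).η ((S.opsT B).br Γ Γ)) := by
        rw [map_sub, map_smul, ← e, quad_apply]; abel
      rw [h1, hidem]
    have hΓC : Γ ∈ LinearMap.range (TensorProduct.mapIncl C B.max) := hπΓ ▸ hdegC Γ hΓ
    rw [hQ Γ hΓC] at e
    refine ⟨⟨Γ, S.mem_MC_iff.mpr ⟨hΓ, ?_⟩, hΓC⟩, Subtype.ext ?_⟩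
    · rw [← hdπ, e, hdπ, ← hh', H.d_harm]
    · change (S.opsT B).harm _ = h
      rw [← hPπ, e, hPπ, hh']

/-- The bijection `κ` from the solutions in a complement of the coboundaries to `(H ⊗ m_B)¹`. -/
noncomputable def mdefCEquiv {C : Submodule 𝕜 G} (hC : S.IsComplement C)
    (B : GradedArtin.{u, v} 𝕜) : S.MDefC B C ≃ S.HarmPts B :=
  Equiv.ofBijective _ (S.bijective_kappa_mdefC hC B)

theorem mdefCEquiv_apply {C : Submodule 𝕜 G} (hC : S.IsComplement C)
    (Γ : S.MDefC B C) : (S.mdefCEquiv hC B Γ : G ⊗[𝕜] B) = (S.opsT B).kappa (Γ : G ⊗[𝕜] B) := rfl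

/-- The kernel of `dη` is a graded complement of the coboundaries. -/
theorem isComplement_ker_d_η : S.IsComplement (LinearMap.ker (D.d ∘ₗ S.η)) where
  homogeneous x hx i := by
    have h : ∀ x : G, (DirectSum.decompose 𝒢 (D.d (S.η x)) i : G) =
        D.d (S.η (DirectSum.decompose 𝒢 x i)) := fun x => by
      induction x using DirectSum.Decomposition.inductionOn 𝒢 with
      | zero => simp
      | @homogeneous j m =>
        have hm : D.d (S.η m) ∈ 𝒢 j := by simpa using D.d_mem _ _ (S.η_mem j m m.2)
        by_cases h : j = i
        · subst h
          rw [DirectSum.decompose_of_mem_same _ m.2, DirectSum.decompose_of_mem_same _ hm]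
        · rw [DirectSum.decompose_of_mem_ne _ m.2 h, DirectSum.decompose_of_mem_ne _ hm h]
          simp
      | add x y hx hy => simp [DirectSum.decompose_add, hx, hy]
    rw [LinearMap.mem_ker, LinearMap.comp_apply] at hx ⊢
    rw [← h, hx]
    simp
  isCompl := by
    rw [isCompl_iff, Submodule.disjoint_def, codisjoint_iff, eq_top_iff]
    refine ⟨?_, fun x _ => ?_⟩
    · rintro _ hx ⟨y, rfl⟩
      rw [LinearMap.mem_ker, LinearMap.comp_apply, S.d_η_d] at hx
      exact hx
    · rw [← sub_add_cancel x (D.d (S.η x))]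
      refine Submodule.add_mem_sup ?_ ⟨_, rfl⟩
      simp [S.d_η_d]

end Hodge

end Def

/-! ### Points of analytic germs with values in Artin algebras -/

section GermPoints

/-- A power series in finitely many variables can be evaluated at nilpotent elements. -/
theorem exists_algHom_of_isNilpotent {σ : Type*} [Finite σ] {k R : Type*} [CommRing k] [CommRing R]
    [Algebra k R] (x : σ → R) (hx : ∀ i, IsNilpotent (x i)) :
    ∃ φ : MvPowerSeries σ k →ₐ[k] R, ∀ i, φ (MvPowerSeries.X i) = x i := by
  let _ : UniformSpace k := ⊥
  let _ : UniformSpace R := ⊥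
  have _ : DiscreteTopology k := ⟨rfl⟩
  have _ : DiscreteTopology R := ⟨rfl⟩
  have _ : DiscreteUniformity k := ⟨rfl⟩
  have _ : DiscreteUniformity R := ⟨rfl⟩
  have _ : ContinuousSMul k R := ⟨continuous_of_discreteTopology⟩
  have he : MvPowerSeries.HasEval x := by
    refine ⟨fun s => ?_, ?_⟩
    · obtain ⟨n, hn⟩ := hx s
      refine tendsto_const_nhds.congr' ?_
      filter_upwards [eventually_ge_atTop n] with m hm
      rw [pow_eq_zero_of_le hm hn]
    · rw [Filter.cofinite_eq_bot]; exact tendsto_bot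
  refine ⟨MvPowerSeries.aeval he, fun i => ?_⟩
  have := MvPowerSeries.aeval_coe he (MvPolynomial.X i : MvPolynomial σ k)
  simpa using this

variable {𝕜 : Type u} [RCLike 𝕜]

open Classical in
/-- A convergent power series is the sum of its constant term and of multiples of the coordinates:
every monomial other than `1` is assigned to one of the variables that divide it. -/
theorem Conv.exists_eq_add_sum {σ : Type*} [Fintype σ] (f : Conv 𝕜 σ) :
    ∃ (c : 𝕜) (g : σ → Conv 𝕜 σ), f = algebraMap 𝕜 _ c + ∑ i, Conv.X 𝕜 i * g i := by
  obtain ⟨f, r, hr, hf⟩ := f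
  have hvar : ∀ m : σ →₀ ℕ, ∃ v : Option σ, m ≠ 0 → ∃ i, v = some i ∧ m i ≠ 0 := fun m => by
    by_cases hm : ∃ i, m i ≠ 0
    · obtain ⟨i, hi⟩ := hm
      exact ⟨some i, fun _ => ⟨i, rfl, hi⟩⟩
    · push Not at hm
      exact ⟨none, fun h => absurd (Finsupp.ext hm) h⟩
  choose v hv using hvar
  set g : σ → MvPowerSeries σ 𝕜 := fun i n =>
    if v (n + Finsupp.single i 1) = some i then MvPowerSeries.coeff (n + Finsupp.single i 1) f else 0
    with hg
  have hgc : ∀ i n, MvPowerSeries.coeff n (g i) = if v (n + Finsupp.single i 1) = some i then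
      MvPowerSeries.coeff (n + Finsupp.single i 1) f else 0 := fun i n => rfl
  have hgm : ∀ i, g i ∈ Conv 𝕜 σ := fun i => by
    refine ⟨r, hr, ?_⟩
    have h1 := (hf.comp_injective (add_left_injective (Finsupp.single i 1))).mul_left r⁻¹
    refine Summable.of_nonneg_of_le (fun n => by positivity) (fun n => ?_) h1
    have h2 : ‖MvPowerSeries.coeff n (g i)‖ ≤ ‖MvPowerSeries.coeff (n + Finsupp.single i 1) f‖ := by
      rw [hgc]; split_ifs <;> simp
    simp only [Function.comp_apply, map_add, Finsupp.degree_single, pow_succ]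
    rw [← mul_assoc, mul_comm r⁻¹, mul_assoc, mul_comm _ r, inv_mul_cancel_left₀ hr.ne']
    gcongr
  refine ⟨MvPowerSeries.coeff 0 f, fun i => ⟨g i, hgm i⟩, Subtype.ext ?_⟩
  have e : ((algebraMap 𝕜 (Conv 𝕜 σ) (MvPowerSeries.coeff 0 f) +
      ∑ i, Conv.X 𝕜 i * (⟨g i, hgm i⟩ : Conv 𝕜 σ) : Conv 𝕜 σ) : MvPowerSeries σ 𝕜) =
      algebraMap 𝕜 _ (MvPowerSeries.coeff 0 f) + ∑ i, MvPowerSeries.X i * g i := by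
    rw [Subalgebra.coe_add, AddSubmonoidClass.coe_finsetSum]; rfl
  refine Eq.trans ?_ e.symm
  ext m
  rw [map_add, map_sum, MvPowerSeries.algebraMap_apply, MvPowerSeries.coeff_C]
  have hX : ∀ i, MvPowerSeries.coeff m (MvPowerSeries.X i * g i) =
      if m i ≠ 0 ∧ v m = some i then MvPowerSeries.coeff m f else 0 := fun i => by
    rw [MvPowerSeries.X, MvPowerSeries.coeff_monomial_mul]
    by_cases h : Finsupp.single i 1 ≤ m
    · have h1 : m i ≠ 0 := by
        have := h i; rw [Finsupp.single_eq_same] at this; omega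
      rw [if_pos h, one_mul, hgc, tsub_add_cancel_of_le h]
      simp [h1]
    · have h1 : m i = 0 := by
        by_contra h'
        exact h (Finsupp.single_le_iff.mpr (Nat.one_le_iff_ne_zero.mpr h'))
      rw [if_neg h]
      simp [h1]
  simp only [hX]
  by_cases hm : m = 0
  · subst hm; simp
  · obtain ⟨j, hj, hjm⟩ := hv m hm
    rw [if_neg hm, zero_add, Finset.sum_eq_single j]
    · rw [if_pos ⟨hjm, hj⟩]
    · intro i _ hi
      rw [if_neg]
      rintro ⟨-, h⟩
      exact hi (Option.some_injective _ (h.symm.trans hj))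
    · simp

/-- A homomorphism from the convergent power series to an Artin algebra is determined by the values
on the coordinates. -/
theorem Conv.algHom_ext {σ : Type*} [Finite σ] {B : GradedArtin.{u, v} 𝕜} {φ φ' : Conv 𝕜 σ →ₐ[𝕜] B}
    (hm : ∀ i, φ (Conv.X 𝕜 i) ∈ B.max) (h : ∀ i, φ (Conv.X 𝕜 i) = φ' (Conv.X 𝕜 i)) : φ = φ' := by
  classical
  cases nonempty_fintype σ
  have key : ∀ n, ∀ f, φ f - φ' f ∈ B.fil n := fun n => by
    induction n with
    | zero => intro f; rw [B.fil_zero]; trivial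
    | succ n ih =>
      intro f
      obtain ⟨c, g, hg⟩ := Conv.exists_eq_add_sum f
      have : φ f - φ' f = ∑ i, φ (Conv.X 𝕜 i) * (φ (g i) - φ' (g i)) := by
        rw [hg]
        simp only [map_add, map_sum, map_mul, AlgHom.commutes, mul_sub, Finset.sum_sub_distrib, ← h]
        abel
      rw [this, B.fil_succ]
      exact sum_mem fun i _ => Submodule.mul_mem_mul (hm i) (ih _)
  obtain ⟨N, hN⟩ := B.exists_fil_eq_bot
  refine AlgHom.ext fun f => ?_
  have := key N f
  rw [hN] at this
  exact sub_eq_zero.mp this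

theorem GradedArtin.isNilpotent_of_mem_max (B : GradedArtin.{u, v} 𝕜) {x : B} (hx : x ∈ B.max) :
    IsNilpotent x := by
  obtain ⟨N, hN⟩ := B.nilp
  refine ⟨N, ?_⟩
  have := Submodule.pow_mem_pow B.max hx N
  rw [GradedArtin.max, hN] at this
  simpa using this

/-- Convergent power series can be evaluated at even nilpotent elements; these are central. -/
theorem Conv.exists_algHom {σ : Type*} [Finite σ] {B : GradedArtin.{u, v} 𝕜} (x : σ → B)
    (hm : ∀ i, x i ∈ B.max) (hc : ∀ i, x i ∈ Subalgebra.center 𝕜 (B : Type v)) :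
    ∃ φ : Conv 𝕜 σ →ₐ[𝕜] Subalgebra.center 𝕜 (B : Type v), ∀ i, (φ (Conv.X 𝕜 i) : B) = x i := by
  obtain ⟨φ, hφ⟩ := exists_algHom_of_isNilpotent (k := 𝕜)
    (fun i => (⟨x i, hc i⟩ : Subalgebra.center 𝕜 (B : Type v))) fun i => by
      obtain ⟨n, hn⟩ := B.isNilpotent_of_mem_max (hm i)
      exact ⟨n, Subtype.ext hn⟩
  refine ⟨φ.comp (Conv 𝕜 σ).val, fun i => ?_⟩
  exact congrArg Subtype.val (hφ i)

/-- The possible values of the coordinates `t_α` on a `B`-point. -/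
def CoordPts {ι : Type*} (δ : ι → ℤ) (B : GradedArtin.{u, v} 𝕜) : Type _ :=
  {x : ι → B // ∀ α, x α ∈ B.gr (1 - δ α) ⊓ B.max}

variable {ι : Type*} [Finite ι]

theorem GradedArtin.mem_center_of_even (B : GradedArtin.{u, v} 𝕜) {i : ℤ} (hi : Even i) {x : B}
    (hx : x ∈ B.gr i) : x ∈ Subalgebra.center 𝕜 (B : Type v) := by
  refine Subalgebra.mem_center_iff.mpr fun y => ?_
  refine (B.isSuperComm.comm_even x y ?_).symm
  rw [parity_of_mem B.gr hx, Int.negOnePow_even i hi, one_smul]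

theorem GradedArtin.mul_anticomm_of_odd (B : GradedArtin.{u, v} 𝕜) {i j : ℤ} (hi : Odd i)
    (hj : Odd j) {x y : B} (hx : x ∈ B.gr i) (hy : y ∈ B.gr j) : x * y = -(y * x) := by
  rw [B.comm i j x hx y hy, Int.negOnePow_odd _ (hi.mul hj)]
  simp

variable (δ : ι → ℤ) (B : GradedArtin.{u, v} 𝕜)

theorem exteriorAlgebra_ι_pi {R κ : Type*} [CommRing R] [Fintype κ] [DecidableEq κ] (m : κ → R) :
    ExteriorAlgebra.ι R m = ∑ α, algebraMap R (ExteriorAlgebra R (κ → R)) (m α) *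
      ExteriorAlgebra.ι R (Pi.single α 1) := by
  have hm : m = ∑ α, m α • Pi.single α (1 : R) := by
    funext α
    simp [Finset.sum_apply, Pi.single_apply]
  conv_lhs => rw [hm]
  rw [map_sum]
  refine Finset.sum_congr rfl fun α _ => ?_
  rw [LinearMap.map_smul, Algebra.smul_def]

theorem superPoint_injective : Function.Injective (fun φ : SuperPoint δ B =>
    (⟨fun α => φ.1 (SuperGerm.t 𝕜 δ α), φ.2⟩ : CoordPts δ B)) := by
  classical
  cases nonempty_fintype ι
  rintro ⟨φ, hφ⟩ ⟨φ', hφ'⟩ h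
  have ht : ∀ α, φ (SuperGerm.t 𝕜 δ α) = φ' (SuperGerm.t 𝕜 δ α) := fun α =>
    congrFun (congrArg Subtype.val h) α
  refine Subtype.ext (AlgHom.ext fun a => ?_)
  have heven : ∀ α : {α // Odd (δ α)}, algebraMap (Conv 𝕜 {α // Odd (δ α)}) (SuperGerm 𝕜 δ)
      (Conv.X 𝕜 α) = SuperGerm.t 𝕜 δ α := fun α => by
    rw [SuperGerm.t, dif_pos α.2]
  have hodd : ∀ α : {α // ¬ Odd (δ α)}, ExteriorAlgebra.ι (Conv 𝕜 {α // Odd (δ α)})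
      (Pi.single α 1) = SuperGerm.t 𝕜 δ α := fun α => by
    rw [SuperGerm.t, dif_neg α.2]
  have hconv : φ.comp (IsScalarTower.toAlgHom 𝕜 (Conv 𝕜 {α // Odd (δ α)}) (SuperGerm 𝕜 δ)) =
      φ'.comp (IsScalarTower.toAlgHom 𝕜 (Conv 𝕜 {α // Odd (δ α)}) (SuperGerm 𝕜 δ)) := by
    refine Conv.algHom_ext (fun i => ?_) fun i => ?_
    · simp only [AlgHom.comp_apply, IsScalarTower.coe_toAlgHom', heven]
      exact (hφ i).2
    · simp only [AlgHom.comp_apply, IsScalarTower.coe_toAlgHom', heven, ht]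
  have hconv' : ∀ r, φ (algebraMap (Conv 𝕜 {α // Odd (δ α)}) (SuperGerm 𝕜 δ) r) =
      φ' (algebraMap (Conv 𝕜 {α // Odd (δ α)}) (SuperGerm 𝕜 δ) r) := fun r =>
    AlgHom.congr_fun hconv r
  induction a using ExteriorAlgebra.induction with
  | algebraMap r => exact hconv' r
  | mul a b ha hb => rw [map_mul, map_mul, ha, hb]
  | add a b ha hb => rw [map_add, map_add, ha, hb]
  | ι m =>
    have hι : ExteriorAlgebra.ι (Conv 𝕜 {α // Odd (δ α)}) m =
        ∑ α : {α // ¬ Odd (δ α)}, (algebraMap _ (SuperGerm 𝕜 δ) (m α) : SuperGerm 𝕜 δ) *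
          SuperGerm.t 𝕜 δ α := by
      simp only [← hodd]
      exact exteriorAlgebra_ι_pi m
    rw [hι, map_sum, map_sum]
    refine Finset.sum_congr rfl fun α _ => ?_
    rw [map_mul, map_mul, hconv', ht]

set_option maxHeartbeats 800000 in
theorem superPoint_surjective : Function.Surjective (fun φ : SuperPoint δ B =>
    (⟨fun α => φ.1 (SuperGerm.t 𝕜 δ α), φ.2⟩ : CoordPts δ B)) := by
  classical
  cases nonempty_fintype ι
  rintro ⟨x, hx⟩
  obtain ⟨φ, hφ⟩ := Conv.exists_algHom (B := B) (fun α : {α // Odd (δ α)} => x α) (fun α => (hx α).2)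
    fun α => B.mem_center_of_even (by
      have := α.2; grind) (hx α).1
  let _ : Algebra (Conv 𝕜 {α // Odd (δ α)}) B :=
    ((Subalgebra.center 𝕜 (B : Type v)).val.comp φ).toRingHom.toAlgebra' fun c y =>
      (Subalgebra.mem_center_iff.mp (φ c).2 y).symm
  have halg : ∀ c, algebraMap (Conv 𝕜 {α // Odd (δ α)}) B c = φ c := fun c => rfl
  have _ : IsScalarTower 𝕜 (Conv 𝕜 {α // Odd (δ α)}) B := IsScalarTower.of_algebraMap_eq fun c => by
    rw [halg, AlgHom.commutes]; rfl
  -- the images of the odd coordinates anticommute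
  set f : ({α // ¬ Odd (δ α)} → Conv 𝕜 {α // Odd (δ α)}) →ₗ[Conv 𝕜 {α // Odd (δ α)}] B :=
    ∑ α : {α // ¬ Odd (δ α)}, (LinearMap.proj α).smulRight (x α) with hf
  have hfa : ∀ m, f m = ∑ α : {α // ¬ Odd (δ α)}, m α • x α := fun m => by
    simp [hf]
  have hff : ∀ m, f m * f m = 0 := fun m => by
    have h1 : f m * f m = ∑ α : {α // ¬ Odd (δ α)}, ∑ β : {α // ¬ Odd (δ α)},
        (m α * m β) • (x α * x β) := by
      rw [hfa, Finset.sum_mul_sum]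
      refine Finset.sum_congr rfl fun α _ => Finset.sum_congr rfl fun β _ => ?_
      rw [smul_mul_assoc, mul_smul_comm, smul_smul]
    have h2 : f m * f m = -(f m * f m) := by
      refine h1.trans (Eq.trans ?_ (congrArg Neg.neg h1.symm))
      refine Finset.sum_comm.trans ?_
      rw [← Finset.sum_neg_distrib]
      refine Finset.sum_congr rfl fun α _ => ?_
      rw [← Finset.sum_neg_distrib]
      refine Finset.sum_congr rfl fun β _ => ?_
      rw [B.mul_anticomm_of_odd (i := 1 - δ β) (j := 1 - δ α) (by have := β.2; grind)
        (by have := α.2; grind) (hx β).1 (hx α).1, smul_neg, mul_comm]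
    have h3 : (2 : 𝕜) • (f m * f m) = 0 := by
      rw [two_smul]; nth_rewrite 1 [h2]; exact neg_add_cancel _
    exact (smul_eq_zero.mp h3).resolve_left two_ne_zero
  have key : ∀ α, ((ExteriorAlgebra.lift _ ⟨f, hff⟩).restrictScalars 𝕜 : SuperGerm 𝕜 δ →ₐ[𝕜] B)
      (SuperGerm.t 𝕜 δ α) = x α := fun α => by
    rw [SuperGerm.t]
    split_ifs with h
    · rw [AlgHom.restrictScalars_apply, AlgHom.commutes, halg]
      exact hφ ⟨α, h⟩
    · rw [AlgHom.restrictScalars_apply, ExteriorAlgebra.lift_ι_apply]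
      simp only [hfa]
      rw [Finset.sum_eq_single ⟨α, h⟩]
      · simp
      · intro β _ hβ; rw [Pi.single_eq_of_ne hβ, zero_smul]
      · simp
  obtain ⟨ψ, hψ⟩ : ∃ ψ : SuperGerm 𝕜 δ →ₐ[𝕜] B, ∀ α, ψ (SuperGerm.t 𝕜 δ α) = x α := ⟨_, key⟩
  exact ⟨⟨ψ, fun α => by rw [hψ]; exact hx α⟩, Subtype.ext (funext hψ)⟩

/-- A point of the germ of `V[1]` is the same as the values of the coordinates. -/
noncomputable def superPointEquiv : SuperPoint δ B ≃ CoordPts δ B :=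
  Equiv.ofBijective _ ⟨superPoint_injective δ B, superPoint_surjective δ B⟩

variable (ι) in
/-- For `B` in degree zero, a point of the germ of `𝕜^ι` is the same as the values of the
coordinates. -/
theorem exists_germPointEquiv {B : GradedArtin.{u, v} 𝕜} (hB : B.DegreeZero) :
    ∃ e : GermPoint ι B ≃ CoordPts (fun _ : ι => 1) B,
      ∀ φ α, (e φ).1 α = φ.1 (Conv.X 𝕜 α) := by
  have hgr : ∀ x : B, x ∈ B.gr 0 := fun x => by rw [hB]; trivial
  let F : GermPoint ι B → CoordPts (fun _ : ι => 1) B := fun φ =>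
    ⟨fun α => φ.1 (Conv.X 𝕜 α), fun α => ⟨by simpa using hgr _, φ.2 α⟩⟩
  refine ⟨Equiv.ofBijective F ⟨?_, ?_⟩, fun φ α => rfl⟩
  · rintro ⟨φ, hφ⟩ ⟨φ', hφ'⟩ h
    exact Subtype.ext (Conv.algHom_ext hφ fun i => congrFun (congrArg Subtype.val h) i)
  · rintro ⟨x, hx⟩
    obtain ⟨φ, hφ⟩ := Conv.exists_algHom (B := B) x (fun α => (hx α).2)
      fun α => B.mem_center_of_even (Even.zero) (hgr _)
    obtain ⟨ψ, hψ⟩ : ∃ ψ : Conv 𝕜 ι →ₐ[𝕜] B, ∀ α, ψ (Conv.X 𝕜 α) = x α :=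
      ⟨(Subalgebra.center 𝕜 (B : Type v)).val.comp φ, hφ⟩
    exact ⟨⟨ψ, fun α => by rw [hψ]; exact (hx α).2⟩, Subtype.ext (funext hψ)⟩

end GermPoints

/-! ### Coordinates of harmonic elements -/

section Coordinates

variable {𝕜 : Type u} [RCLike 𝕜] {G : Type w} [NormedAddCommGroup G] [NormedSpace 𝕜 G]
  {𝒢 : ℤ → Submodule 𝕜 G} [DirectSum.Decomposition 𝒢] {D : NormedDGLA 𝕜 𝒢} (S : Hodge D)
  {ι : Type*} [Fintype ι]

namespace Hodge

theorem P_of_mem_harmonic {x : G} (hx : x ∈ S.harmonic) : S.P x = x := by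
  obtain ⟨y, rfl⟩ := hx
  exact S.P_P y

/-- `∑ γ_α ⊗ x_α = 0` implies `x_α = 0` for linearly independent `γ_α`. -/
theorem eq_zero_of_sum_tmul_eq_zero {γ : ι → G} (hγ : LinearIndependent 𝕜 γ)
    {B : Type*} [AddCommGroup B] [Module 𝕜 B] {x : ι → B} (h : ∑ α, γ α ⊗ₜ[𝕜] x α = 0) : x = 0 := by
  classical
  obtain ⟨g, hg⟩ := LinearMap.exists_leftInverse_of_injective (Finsupp.linearCombination 𝕜 γ)
    (LinearMap.ker_eq_bot.mpr hγ)
  funext α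
  have h1 := congrArg ((TensorProduct.lid 𝕜 B).toLinearMap ∘ₗ (Finsupp.lapply α ∘ₗ g).rTensor B) h
  have h2 : ∀ β, g (γ β) = Finsupp.single β 1 := fun β => by
    have := LinearMap.congr_fun hg (Finsupp.single β 1)
    simpa using this
  simpa [h2, Finsupp.single_apply] using h1

/-- Elements of `(H ⊗ m_B)¹` and their coordinates with respect to a homogeneous family `γ` that is a
basis of the harmonic space in the degrees that matter for `B`. -/
theorem exists_coordEquiv {γ : ι → G} (hγ : LinearIndependent 𝕜 γ) {δ : ι → ℤ}
    (hδ : ∀ α, γ α ∈ 𝒢 (δ α)) (hh : ∀ α, γ α ∈ S.harmonic) {B : GradedArtin.{u, v} 𝕜}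
    (hspan : ∀ i, B.gr (1 - i) = ⊥ ∨
      S.harmonic ⊓ 𝒢 i ≤ Submodule.span 𝕜 (γ '' {α | δ α = i})) :
    ∃ e : CoordPts δ B ≃ S.HarmPts B, ∀ x, (e x : G ⊗[𝕜] B) = ∑ α, γ α ⊗ₜ[𝕜] x.1 α := by
  classical
  have hmem : ∀ x : CoordPts δ B, ∑ α, γ α ⊗ₜ[𝕜] x.1 α ∈ S.HarmPts B := fun x => by
    refine ⟨sum_mem fun α _ => tmul_mem_degOf (by ring) (hδ α) (x.2 α).1 (x.2 α).2, ?_⟩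
    rw [opsT_harm]
    simp [S.P_of_mem_harmonic (hh _)]
  let F : CoordPts δ B → S.HarmPts B := fun x => ⟨_, hmem x⟩
  refine ⟨Equiv.ofBijective F ⟨?_, ?_⟩, fun x => rfl⟩
  · rintro ⟨x, hx⟩ ⟨y, hy⟩ h
    have h1 : ∑ α, γ α ⊗ₜ[𝕜] x α = ∑ α, γ α ⊗ₜ[𝕜] y α := congrArg Subtype.val h
    refine Subtype.ext (sub_eq_zero.mp (eq_zero_of_sum_tmul_eq_zero hγ ?_))
    simp only [Pi.sub_apply, TensorProduct.tmul_sub, Finset.sum_sub_distrib, h1, sub_self]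
  · rintro ⟨h, hd, hP⟩
    set L : (ι → B) →ₗ[𝕜] G ⊗[𝕜] B :=
      ∑ α, (TensorProduct.mk 𝕜 G B (γ α)) ∘ₗ LinearMap.proj α with hL
    have hLa : ∀ x, L x = ∑ α, γ α ⊗ₜ[𝕜] x α := fun x => by simp [hL]
    set X : Submodule 𝕜 (ι → B) := Submodule.pi Set.univ fun α => B.gr (1 - δ α) ⊓ B.max with hX
    suffices hle : S.deg B 1 ≤ (X.map L).comap (S.opsT B).harmL by
      obtain ⟨x, hx, e⟩ := hle hd
      refine ⟨⟨x, fun α => hx α trivial⟩, Subtype.ext ?_⟩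
      change ∑ α, γ α ⊗ₜ[𝕜] x α = h
      rw [← hLa, e]
      exact hP
    refine degOf_le fun i a ha x hx hx' => ?_
    rw [Submodule.mem_comap, Ops.harmL_apply, opsT_harm, LinearMap.rTensor_tmul]
    rcases hspan i with h0 | h1
    · rw [h0, Submodule.mem_bot] at hx
      rw [hx, TensorProduct.tmul_zero]
      exact zero_mem _
    · have hPa := h1 ⟨⟨a, rfl⟩, S.P_mem i a ha⟩
      generalize S.P a = p at hPa
      induction hPa using Submodule.span_induction with
      | mem p hp =>
        obtain ⟨α, rfl, rfl⟩ := hp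
        refine ⟨Pi.single α x, fun β _ => ?_, ?_⟩
        · by_cases h : β = α
          · subst h; rw [Pi.single_eq_same]; exact ⟨hx, hx'⟩
          · rw [Pi.single_eq_of_ne h]; exact zero_mem _
        · rw [hLa, Finset.sum_eq_single α]
          · rw [Pi.single_eq_same]
          · intro β _ h; rw [Pi.single_eq_of_ne h, TensorProduct.tmul_zero]
          · simp
      | zero => rw [TensorProduct.zero_tmul]; exact zero_mem _
      | add p q _ _ hp hq => rw [TensorProduct.add_tmul]; exact add_mem hp hq
      | smul c p _ hp => rw [← TensorProduct.smul_tmul']; exact Submodule.smul_mem _ _ hp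

/-- The components of a homogeneous basis of the harmonic space span its homogeneous parts. -/
theorem harmonic_inf_le_span (b : Module.Basis ι 𝕜 S.harmonic) {δ : ι → ℤ}
    (hδ : ∀ α, (b α : G) ∈ 𝒢 (δ α)) (i : ℤ) :
    S.harmonic ⊓ 𝒢 i ≤ Submodule.span 𝕜 ((fun α => (b α : G)) '' {α | δ α = i}) := by
  classical
  rintro x ⟨hx, hxi⟩
  obtain ⟨c, hc⟩ : ∃ c : ι → 𝕜, ∑ α, c α • (b α : G) = x := ⟨b.repr ⟨x, hx⟩, by
    have := congrArg S.harmonic.subtype (b.sum_repr ⟨x, hx⟩)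
    rwa [map_sum] at this⟩
  have h2 : x = ∑ α, c α • (DirectSum.decompose 𝒢 (b α : G) i : G) := by
    rw [← DirectSum.decompose_of_mem_same 𝒢 hxi, ← hc]
    simp [DirectSum.decompose_sum, DirectSum.decompose_smul, DirectSum.sum_apply,
      DirectSum.smul_apply]
  rw [h2]
  refine sum_mem fun α _ => Submodule.smul_mem _ _ ?_
  by_cases h : δ α = i
  · subst h
    rw [DirectSum.decompose_of_mem_same _ (hδ α)]
    exact Submodule.subset_span ⟨α, rfl, rfl⟩
  · rw [DirectSum.decompose_of_mem_ne _ (hδ α) h]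
    exact zero_mem _

/-- Every class has exactly one harmonic representative. -/
theorem harmonicRepresents (i : ℤ) : S.HarmonicRepresents i := by
  have hPd : ∀ y, S.P (D.d y) = 0 := fun y => by
    rw [← S.ops_harm]; exact S.ops_isSuper.harm_d y
  have hcls : ∀ z z' : ↥(𝒢 i ⊓ LinearMap.ker D.d), D.cls z = D.cls z' ↔
      ∃ y, D.d y = (z : G) - z' := fun z z' => by
    rw [NormedDGLA.cls, NormedDGLA.cls, Submodule.Quotient.eq]; rfl
  intro c
  obtain ⟨z, rfl⟩ := Submodule.Quotient.mk_surjective _ c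
  refine ⟨⟨S.P z, S.P_mem i z z.2.1, S.d_P z⟩, ⟨⟨z, rfl⟩, ?_⟩, ?_⟩
  · refine (hcls _ z).mpr ⟨-S.η z, ?_⟩
    have h := S.decomp z
    rw [show D.d z = 0 from z.2.2, map_zero, add_zero] at h
    change D.d (-S.η z) = S.P z - z
    rw [map_neg, neg_eq_iff_eq_neg, neg_sub]
    exact (sub_eq_of_eq_add' h).symm
  · rintro z' ⟨h1, h2⟩
    obtain ⟨y, hy⟩ := (hcls z' z).mp h2
    have h3 := congrArg S.P hy
    rw [hPd, map_sub, S.P_of_mem_harmonic h1] at h3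
    exact Subtype.ext (sub_eq_zero.mp h3.symm)

/-! ### The tangent space -/

theorem cls_eq_cls_iff {i : ℤ} (z z' : ↥(𝒢 i ⊓ LinearMap.ker D.d)) :
    D.cls z = D.cls z' ↔ S.P z = S.P z' := by
  rw [NormedDGLA.cls, NormedDGLA.cls, Submodule.Quotient.eq]
  constructor
  · rintro ⟨y, hy⟩
    have h := S.ops_isSuper.harm_d y
    rw [S.ops_harm, ops_d, hy] at h
    exact sub_eq_zero.mp (by rw [← map_sub]; exact h)
  · intro h
    refine ⟨S.η ((z : G) - z'), ?_⟩
    have h1 := S.decomp ((z : G) - z')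
    rw [map_sub S.P, h, sub_self, zero_add, map_sub D.d, show D.d z = 0 from z.2.2,
      show D.d z' = 0 from z'.2.2, sub_self, map_zero, add_zero] at h1
    exact h1.symm

theorem exists_tangent_equiv {i j : ℤ} (hij : i + j = 1) (B : GradedArtin.{u, v} 𝕜) {ε : B}
    (hε : ε ∈ B.gr j) (hε0 : ε ≠ 0) (hB : B.max = Submodule.span 𝕜 {ε}) :
    ∃ T : D.Cohomology i ≃ S.MDef B, ∀ z : ↥(𝒢 i ⊓ LinearMap.ker D.d),
        ∃ Γ : S.MC B, (Γ : G ⊗[𝕜] B) = (z : G) ⊗ₜ[𝕜] ε ∧ T (D.cls z) = Quot.mk _ Γ := by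
  classical
  have hεm : ε ∈ B.max := by rw [hB]; exact Submodule.mem_span_singleton_self ε
  have hεε : ε * ε = 0 := by
    have h1 := B.mul_mem_max_left ε hεm
    rw [hB] at h1
    obtain ⟨c, hc⟩ := Submodule.mem_span_singleton.mp h1
    obtain ⟨N, hN⟩ := B.isNilpotent_of_mem_max hεm
    have h2 : ∀ n, ε ^ (n + 1) = c ^ n • ε := fun n => by
      induction n with
      | zero => simp
      | succ n ih => rw [pow_succ, ih, smul_mul_assoc, ← hc, smul_smul, pow_succ]
    have h3 := h2 N
    rw [pow_succ, hN, zero_mul] at h3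
    have h4 : c = 0 := by
      rcases smul_eq_zero.mp h3.symm with h | h
      · exact eq_zero_of_pow_eq_zero h
      · exact absurd h hε0
    rw [← hc, h4, zero_smul]
  -- elements of total degree one are of the form `a ⊗ ε`
  have hdeg : ∀ t ∈ S.deg B 1, ∃ a ∈ 𝒢 i, t = a ⊗ₜ ε := by
    intro t ht
    suffices h : S.deg B 1 ≤ (𝒢 i).map ((TensorProduct.mk 𝕜 G B).flip ε) by
      obtain ⟨a, ha, e⟩ := h ht
      exact ⟨a, ha, e.symm⟩
    refine degOf_le fun k a ha x hx hx' => ?_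
    rw [hB] at hx'
    obtain ⟨c, rfl⟩ := Submodule.mem_span_singleton.mp hx'
    by_cases hk : 1 - k = j
    · obtain rfl : k = i := by omega
      exact ⟨c • a, Submodule.smul_mem _ _ ha, by simp⟩
    · have h0 : c • ε = 0 := by
        rw [← DirectSum.decompose_of_mem_same B.gr hx]
        exact DirectSum.decompose_of_mem_ne B.gr (Submodule.smul_mem _ c hε) (Ne.symm hk)
      rw [h0, TensorProduct.tmul_zero]
      exact zero_mem _
  have htmul0 : ∀ a : G, a ⊗ₜ[𝕜] ε = 0 → a = 0 := fun a h => by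
    obtain ⟨f, hf⟩ := not_forall.mp (mt (Module.forall_dual_apply_eq_zero_iff 𝕜 ε).mp hε0)
    have h1 := congrArg ((TensorProduct.rid 𝕜 G).toLinearMap ∘ₗ f.lTensor G) h
    simp only [LinearMap.comp_apply, LinearMap.lTensor_tmul, map_zero] at h1
    exact (smul_eq_zero.mp (by simpa using h1)).resolve_left hf
  have hbr : ∀ a b : G, (S.opsT B).br (a ⊗ₜ ε) (b ⊗ₜ ε) = 0 := fun a b => by
    have hτ : parity B.gr ε * ε = 0 := by
      rw [parity_of_mem B.gr hε, Units.smul_def, smul_mul_assoc, hεε, smul_zero]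
    simp [opsT, Ops.tensor, hεε, hτ]
  have hMC : ∀ z : ↥(𝒢 i ⊓ LinearMap.ker D.d), (z : G) ⊗ₜ[𝕜] ε ∈ S.MC B := fun z => by
    refine S.mem_MC_iff.mpr ⟨tmul_mem_degOf hij z.2.1 hε hεm, ?_⟩
    rw [Ops.kur, hbr, map_zero, smul_zero, add_zero]
    change D.d (z : G) ⊗ₜ[𝕜] ε = 0
    rw [show D.d z = 0 from z.2.2, TensorProduct.zero_tmul]
  have hκ : ∀ a : G, (S.opsT B).kappa (a ⊗ₜ ε) = S.P a ⊗ₜ ε := fun a => by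
    rw [Ops.kappa, Ops.kur, hbr, map_zero, smul_zero, add_zero, opsT_harm, LinearMap.rTensor_tmul]
  have hmk : ∀ z z' : ↥(𝒢 i ⊓ LinearMap.ker D.d), D.cls z = D.cls z' ↔
      (Quot.mk _ ⟨_, hMC z⟩ : S.MDef B) = Quot.mk _ ⟨_, hMC z'⟩ := fun z z' => by
    refine (S.cls_eq_cls_iff z z').trans (Iff.trans ?_ (S.mk_eq_mk_iff _ _).symm)
    simp only [hκ]
    refine ⟨fun h => by rw [h], fun h => sub_eq_zero.mp (htmul0 _ ?_)⟩
    rw [TensorProduct.sub_tmul, h, sub_self]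
  let T : D.Cohomology i → S.MDef B := Quotient.lift
    (fun z : ↥(𝒢 i ⊓ LinearMap.ker D.d) => (Quot.mk _ ⟨_, hMC z⟩ : S.MDef B))
    fun z z' h => (hmk z z').mp (Quotient.sound h)
  have hT : ∀ z, T (D.cls z) = Quot.mk _ ⟨_, hMC z⟩ := fun z => rfl
  refine ⟨Equiv.ofBijective T ⟨fun c c' h => ?_, fun q => ?_⟩, fun z => ⟨⟨_, hMC z⟩, rfl, rfl⟩⟩
  · obtain ⟨z, rfl⟩ := Submodule.Quotient.mk_surjective _ c
    obtain ⟨z', rfl⟩ := Submodule.Quotient.mk_surjective _ c'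
    exact (hmk z z').mpr h
  · obtain ⟨⟨Γ, hΓ⟩, rfl⟩ := Quot.exists_rep q
    obtain ⟨a, ha, rfl⟩ := hdeg Γ hΓ.1
    refine ⟨D.cls ⟨S.P a, S.P_mem i a ha, S.d_P a⟩, ?_⟩
    rw [hT]
    refine (S.mk_eq_mk_iff _ _).mpr ?_
    simp only [hκ, S.P_P]

end Hodge

end Coordinates

/-! ### The slice `Ker dη` -/

section Slice

variable {𝕜 : Type*} [Field 𝕜] {A : Type*} [AddCommGroup A] [Module 𝕜 A]

/-- The bilinear map `½ (Id - dη) η[x, y]`. The elements `Γ` of the slice `Ker dη` whose image under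
the Kuranishi map is a cocycle are the solutions of `Γ + Q(Γ, Γ) = h` with harmonic `h`. -/
def Ops.sliceQ (o : Ops 𝕜 A) : A →ₗ[𝕜] A →ₗ[𝕜] A :=
  o.br.compr₂ ((2⁻¹ : 𝕜) • (o.η - o.d ∘ₗ o.η ∘ₗ o.η))

theorem Ops.sliceQ_apply (o : Ops 𝕜 A) (x y : A) :
    o.sliceQ x y = (2⁻¹ : 𝕜) • (o.η (o.br x y) - o.d (o.η (o.η (o.br x y)))) := rfl

theorem Ops.map_sliceQ {A' : Type*} [AddCommGroup A'] [Module 𝕜 A'] (o : Ops 𝕜 A) (o' : Ops 𝕜 A')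
    (h : A →ₗ[𝕜] A') (hd : ∀ x, h (o.d x) = o'.d (h x)) (hη : ∀ x, h (o.η x) = o'.η (h x))
    (hb : ∀ x y, h (o.br x y) = o'.br (h x) (h y)) (x y : A) :
    h (o.sliceQ x y) = o'.sliceQ (h x) (h y) := by
  simp [Ops.sliceQ_apply, hd, hη, hb]

variable {o : Ops 𝕜 A} {σ : A →ₗ[𝕜] A}

theorem Ops.kur_sub_eq_slice (o : Ops 𝕜 A) (Γ : A) :
    o.kur Γ - o.d (o.η (o.kur Γ)) = Γ + o.sliceQ Γ Γ - o.d (o.η Γ) := by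
  simp only [Ops.kur, Ops.sliceQ_apply, map_add, map_smul, smul_sub]
  abel

theorem Ops.slice_eq_kappa {Γ : A} (h1 : o.d (o.η Γ) = 0)
    (h2 : o.d (o.kur Γ) = 0) : Γ + o.sliceQ Γ Γ = o.kappa Γ := by
  have h := o.kur_sub_eq_slice Γ
  rw [h1, sub_zero] at h
  rw [← h, Ops.kappa, Ops.harm, h2, map_zero, sub_zero]

theorem Ops.IsSuper.of_slice_eq (H : o.IsSuper σ) {Γ h : A} (hh : o.harm h = h)
    (e : Γ + o.sliceQ Γ Γ = h) : o.d (o.η Γ) = 0 ∧ o.d (o.kur Γ) = 0 ∧ o.kappa Γ = h := by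
  have hidem : ∀ x, o.d (o.η (o.d (o.η x))) = o.d (o.η x) := fun x => H.d_η_d _
  have hdηh : o.d (o.η h) = 0 := by rw [← hh]; exact H.d_η_harm h
  have hdh : o.d h = 0 := by rw [← hh]; exact H.d_harm h
  have h1 : o.d (o.η Γ) = 0 := by
    have : Γ = h - o.sliceQ Γ Γ := by rw [← e]; abel
    rw [this]
    simp only [Ops.sliceQ_apply, map_sub, map_smul, hidem, hdηh, sub_self, smul_zero]
  have h2 := o.kur_sub_eq_slice Γ
  rw [h1, sub_zero, e, sub_eq_iff_eq_add] at h2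
  refine ⟨h1, ?_, ?_⟩
  · rw [h2, map_add, hdh, H.d_d, add_zero]
  · rw [Ops.kappa, h2, ← Ops.harmL_apply, map_add, Ops.harmL_apply, Ops.harmL_apply, hh, H.harm_d,
      add_zero]

theorem Ops.IsSuper.σ_sliceQ (H : o.IsSuper σ) (x y : A) :
    σ (o.sliceQ x y) = -o.sliceQ (σ x) (σ y) := by
  simp only [Ops.sliceQ_apply, map_smul, map_sub, H.σ_η, H.σ_d, H.σ_br, map_neg, neg_neg]
  rw [← smul_neg]
  congr 1
  abel

theorem Ops.IsSuper.sliceQ_comm_odd [CharZero 𝕜] (H : o.IsSuper σ) {x y : A} (hx : σ x = -x)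
    (hy : σ y = -y) : o.sliceQ x y = o.sliceQ y x := by
  rw [Ops.sliceQ_apply, Ops.sliceQ_apply, H.br_comm_odd hx hy]

end Slice

/-! ### Convergence of the Maurer–Cartan series -/

section Series

variable {𝕜 : Type*} [RCLike 𝕜] {X : Type*} [NormedAddCommGroup X] [NormedSpace 𝕜 X]

/-- A series whose partial sums satisfy `Pₙ₊₁ - S Pₙ = e` can converge to zero only if `e = 0`. -/
theorem eq_zero_of_hasSum_zero {f : X → X} (hf : Continuous f) (h0 : f 0 = 0) {t : ℕ → X} {e : X}
    (hP : ∀ n, ∑ k ∈ Finset.range (n + 3), t k - f (∑ k ∈ Finset.range (n + 2), t k) = e)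
    (h : HasSum t 0) : e = 0 := by
  have h1 := h.tendsto_sum_nat
  have h2 := (h1.comp (tendsto_add_atTop_nat 3)).sub
    ((hf.tendsto 0).comp (h1.comp (tendsto_add_atTop_nat 2)))
  rw [h0, sub_zero] at h2
  refine tendsto_nhds_unique (tendsto_const_nhds.congr fun n => ?_) h2
  exact (hP n).symm

/-- Conversely a geometric series whose partial sums satisfy `Pₙ₊₁ = S Pₙ` converges to zero. -/
theorem hasSum_zero_of_geometric [CompleteSpace X] {f : X → X} {t : ℕ → X}
    (hP : ∀ n, ∑ k ∈ Finset.range (n + 3), t k - f (∑ k ∈ Finset.range (n + 2), t k) = 0)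
    (ht : ∀ k, t (k + 3) = f (t (k + 2))) (h2 : Summable fun k => ‖f^[k] (t 2)‖)
    (hP2 : Summable fun k => ‖f^[k] (∑ k ∈ Finset.range 2, t k)‖) : HasSum t 0 := by
  have h3 : ∀ k, t (k + 2) = f^[k] (t 2) := fun k => by
    induction k with
    | zero => rfl
    | succ k ih => rw [Function.iterate_succ_apply', ← ih, ← ht]
  have h4 : ∀ n, ∑ k ∈ Finset.range (n + 2), t k = f^[n] (∑ k ∈ Finset.range 2, t k) := fun n => by
    induction n with
    | zero => rfl
    | succ n ih => rw [Function.iterate_succ_apply', ← ih, ← sub_eq_zero]; exact hP n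
  have h5 : Summable t := by
    refine (summable_nat_add_iff 2).mp (Summable.of_norm ?_)
    exact h2.congr fun k => (congrArg norm (h3 k)).symm
  have h6 := (h5.hasSum.tendsto_sum_nat).comp (tendsto_add_atTop_nat 2)
  have h7 : Tendsto (fun n => f^[n] (∑ k ∈ Finset.range 2, t k)) atTop (𝓝 0) :=
    tendsto_zero_iff_norm_tendsto_zero.mpr hP2.tendsto_atTop_zero
  have h8 : ∑' k, t k = 0 := tendsto_nhds_unique (h6.congr fun n => h4 n) h7
  rw [← h8]
  exact h5.hasSum

/-- A perturbation of a contraction by an operator that raises a finite filtration has a convergent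
Neumann series. -/
theorem summable_iterate_of_filtration {F : ℕ → Submodule 𝕜 X} {N : ℕ} (hN : F N = ⊥)
    (h0 : F 0 = ⊤) {O : Submodule 𝕜 X} {f g : X →ₗ[𝕜] X} (hO : ∀ x ∈ O, f x ∈ O)
    (hgO : ∀ x ∈ O, g x ∈ O) {c K : ℝ} (hc : c < 1) (hg : ∀ x ∈ O, ‖g x‖ ≤ c * ‖x‖)
    (hgF : ∀ n, ∀ x ∈ F n, g x ∈ F n) (hfg : ∀ n, ∀ x ∈ O, x ∈ F n → f x - g x ∈ F (n + 1))
    (hK : ∀ x ∈ O, ‖f x - g x‖ ≤ K * ‖x‖) {x : X} (hx : x ∈ O) :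
    Summable fun k => ‖f^[k] x‖ := by
  have key : ∀ i, ∃ M : ℝ, ∀ j, i + j = N → ∀ x ∈ O, x ∈ F j → ∀ n,
      ∑ k ∈ Finset.range n, ‖f^[k] x‖ ≤ M * ‖x‖ := fun i => by
    induction i with
    | zero =>
      refine ⟨0, fun j hj x _ hxj n => ?_⟩
      obtain rfl : j = N := by omega
      rw [hN, Submodule.mem_bot] at hxj
      subst hxj
      have : ∀ k, f^[k] 0 = 0 := fun k => by
        rw [← Module.End.coe_pow]; exact map_zero _
      simp [this]
    | succ i ih =>
      obtain ⟨M, hM⟩ := ih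
      set M' := max M 0 with hM'
      set K' := max K 0 with hK'
      have hM1 : M ≤ M' := le_max_left _ _
      have hM0 : 0 ≤ M' := le_max_right _ _
      have hK1 : K ≤ K' := le_max_left _ _
      have hK0 : 0 ≤ K' := le_max_right _ _
      have hc' : 0 < 1 - c := by linarith
      refine ⟨(1 + M' * K') / (1 - c), fun j hj x hx hxj n => ?_⟩
      have hpos : 0 ≤ (1 + M' * K') / (1 - c) := by positivity
      induction n generalizing x with
      | zero => simpa using mul_nonneg hpos (norm_nonneg x)
      | succ n ihn =>
        rw [Finset.sum_range_succ']
        have h1 : ∀ k, ‖f^[k + 1] x‖ ≤ ‖f^[k] (g x)‖ + ‖f^[k] (f x - g x)‖ := fun k => by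
          have : f^[k + 1] x = f^[k] (g x) + f^[k] (f x - g x) := by
            rw [Function.iterate_succ_apply]
            simp only [← Module.End.coe_pow]
            rw [← map_add]
            congr 1
            abel
          rw [this]
          exact norm_add_le _ _
        have h2 := ihn (g x) (hgO x hx) (hgF j x hxj)
        have h3 := hM (j + 1) (by omega) (f x - g x) (sub_mem (hO x hx) (hgO x hx))
          (hfg j x hx hxj) n
        have h4 := Finset.sum_le_sum fun k (_ : k ∈ Finset.range n) => h1 k
        rw [Finset.sum_add_distrib] at h4
        have h5 : M * ‖f x - g x‖ ≤ M' * (K' * ‖x‖) :=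
          mul_le_mul hM1 ((hK x hx).trans (by gcongr)) (norm_nonneg _) hM0
        have h6 := mul_le_mul_of_nonneg_left (hg x hx) hpos
        have h7 : (1 + M' * K') / (1 - c) * (c * ‖x‖) + M' * (K' * ‖x‖) + ‖x‖ =
            (1 + M' * K') / (1 - c) * ‖x‖ := by field_simp; ring
        simp only [Function.iterate_zero, id_eq]
        linarith
  obtain ⟨M, hM⟩ := key N
  exact summable_of_sum_range_le (fun _ => norm_nonneg _)
    (hM 0 (add_zero N) x hx (by rw [h0]; trivial))

end Series

/-! ### Analytic charts from quadratic equations -/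

section Charts

variable {𝕜 : Type u} [RCLike 𝕜] {E : Type*} [NormedAddCommGroup E] [NormedSpace 𝕜 E]

theorem analyticAt_quadratic (Q : E →L[𝕜] E →L[𝕜] E) (x : E) :
    AnalyticAt 𝕜 (fun x => x + Q x x) x :=
  analyticAt_id.add ((Q.analyticAt_bilinear (x, x)).comp
    (f := fun x => (x, x)) (analyticAt_id.prod analyticAt_id))

theorem quadratic_injOn (Q : E →L[𝕜] E →L[𝕜] E) {r : ℝ} (hr : 2 * ‖Q‖ * r < 1) {x y : E}
    (hx : ‖x‖ ≤ r) (hy : ‖y‖ ≤ r) (h : x + Q x x = y + Q y y) : x = y := by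
  have h1 : x - y = -(Q x (x - y) + Q (x - y) y) := by
    have h2 : x - y = Q y y - Q x x := by rw [sub_eq_sub_iff_add_eq_add, h, add_comm]
    nth_rewrite 1 [h2]
    simp only [map_sub, sub_apply]
    abel
  have h3 : ‖x - y‖ ≤ 2 * ‖Q‖ * r * ‖x - y‖ := by
    calc ‖x - y‖ = ‖Q x (x - y) + Q (x - y) y‖ := by rw [← norm_neg (Q x (x - y) + _), ← h1]
      _ ≤ ‖Q‖ * ‖x‖ * ‖x - y‖ + ‖Q‖ * ‖x - y‖ * ‖y‖ :=
        (norm_add_le _ _).trans (add_le_add (Q.le_opNorm₂ _ _) (Q.le_opNorm₂ _ _))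
      _ ≤ ‖Q‖ * r * ‖x - y‖ + ‖Q‖ * ‖x - y‖ * r := by gcongr
      _ = 2 * ‖Q‖ * r * ‖x - y‖ := by ring
  have h4 : ‖x - y‖ = 0 := by
    by_contra h5
    have : 0 < ‖x - y‖ := lt_of_le_of_ne (norm_nonneg _) (Ne.symm h5)
    nlinarith
  exact sub_eq_zero.mp (norm_eq_zero.mp h4)

/-- The inverse function theorem for `x ↦ x + Q(x, x)` at the origin. -/
theorem exists_quadratic_inverse [CompleteSpace E] (Q : E →L[𝕜] E →L[𝕜] E) {r : ℝ} (hr : 0 < r) :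
    ∃ (U V : Set E) (ψ : E → E), IsOpen U ∧ 0 ∈ U ∧ IsOpen V ∧ 0 ∈ V ∧ (∀ x ∈ U, ‖x‖ < r) ∧
      (∀ x ∈ U, x + Q x x ∈ V ∧ ψ (x + Q x x) = x) ∧
      (∀ y ∈ V, ψ y ∈ U ∧ ψ y + Q (ψ y) (ψ y) = y) ∧ AnalyticOnNhd 𝕜 ψ V := by
  set L : E → E := fun x => x + Q x x with hL
  have hL0 : L 0 = 0 := by simp [hL]
  obtain ⟨p, hp⟩ := analyticAt_quadratic Q 0
  have hfd : HasFDerivAt L (ContinuousLinearMap.id 𝕜 E) 0 := by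
    have h1 : HasFDerivAt (fun x : E => Q x x) (0 : E →L[𝕜] E) 0 := by
      have := (Q.hasFDerivAt (x := (0 : E))).clm_apply (hasFDerivAt_id (𝕜 := 𝕜) (0 : E))
      have e : Q 0 ∘SL ContinuousLinearMap.id 𝕜 E + Q.flip (id 0) = 0 := by
        rw [id, map_zero, map_zero, ContinuousLinearMap.zero_comp, add_zero]
      rwa [e] at this
    have h2 := (hasFDerivAt_id (𝕜 := 𝕜) (0 : E)).add h1
    rw [add_zero] at h2
    exact h2
  have hp1 : continuousMultilinearCurryFin1 𝕜 E E (p 1) = ContinuousLinearMap.id 𝕜 E :=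
    hp.hasFDerivAt.unique hfd
  have hstrict : HasStrictFDerivAt L
      ((ContinuousLinearEquiv.refl 𝕜 E : E ≃L[𝕜] E) : E →L[𝕜] E) 0 := by
    have := hp.hasStrictFDerivAt
    rw [hp1] at this
    exact this
  set f := hstrict.toOpenPartialHomeomorph L with hf
  have hfL : ∀ x, f x = L x := fun x => rfl
  have h0s : (0 : E) ∈ f.source := hstrict.mem_toOpenPartialHomeomorph_source
  have hsymm : AnalyticAt 𝕜 f.symm 0 := by
    have := f.hasFPowerSeriesAt_symm (i := ContinuousLinearEquiv.refl 𝕜 E) h0s hp (by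
      rw [LinearIsometryEquiv.eq_symm_apply, hp1]; rfl)
    have h2 := this.analyticAt
    rwa [hfL, hL0] at h2
  have h0t : (0 : E) ∈ f.target := by
    have := f.map_source h0s
    rwa [hfL, hL0] at this
  have hs0 : f.symm 0 = 0 := by
    have := f.left_inv h0s
    rwa [hfL, hL0] at this
  have hnhds : {y | y ∈ f.target ∧ AnalyticAt 𝕜 f.symm y ∧ ‖f.symm y‖ < r} ∈ 𝓝 (0 : E) := by
    have h3 : ∀ᶠ y in 𝓝 0, ‖f.symm y‖ < r :=
      hsymm.continuousAt.norm.eventually_lt_const (by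
        change ‖f.symm 0‖ < r
        rwa [hs0, norm_zero])
    filter_upwards [f.open_target.mem_nhds h0t, hsymm.eventually_analyticAt, h3] with y a b c
    exact ⟨a, b, c⟩
  obtain ⟨V, hV, hVo, h0V⟩ := mem_nhds_iff.mp hnhds
  refine ⟨f.source ∩ f ⁻¹' V, V, f.symm, f.isOpen_inter_preimage hVo, ⟨h0s, ?_⟩, hVo, h0V, ?_, ?_,
    ?_, fun y hy => (hV hy).2.1⟩
  · change L 0 ∈ V; rwa [hL0]
  · rintro x ⟨hx, hxV⟩
    have := (hV hxV).2.2
    rwa [f.left_inv hx] at this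
  · rintro x ⟨hx, hxV⟩
    exact ⟨hxV, f.left_inv hx⟩
  · intro y hy
    have h1 := f.right_inv (hV hy).1
    exact ⟨⟨f.map_target (hV hy).1, by rw [Set.mem_preimage, h1]; exact hy⟩, h1⟩

/-- The inverse of a chart that solves `ψ h + Q(ψ h, ψ h) = h` is tangent to the identity. -/
theorem isAnalyticChart_of_quadratic {κ ψ : E → E} {M N : Set E} (Q : E →L[𝕜] E →L[𝕜] E)
    (h0M : 0 ∈ M) (h0N : 0 ∈ N) (hκ0 : κ 0 = 0) (hκ : AnalyticOnNhd 𝕜 κ M)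
    (hMN : ∀ x ∈ M, κ x ∈ N ∧ ψ (κ x) = x) (hNM : ∀ y ∈ N, ψ y ∈ M ∧ κ (ψ y) = y)
    (hψ : AnalyticOn 𝕜 ψ N) (hQ : ∀ y ∈ N, ψ y + Q (ψ y) (ψ y) = y) :
    IsAnalyticChart 𝕜 κ M N := by
  have hinv : Set.InvOn ψ κ M N := ⟨fun x hx => (hMN x hx).2, fun y hy => (hNM y hy).2⟩
  refine ⟨⟨h0M, h0N, hκ0⟩, hinv.bijOn (fun x hx => (hMN x hx).1) fun y hy => (hNM y hy).1, hκ,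
    ψ, hψ, hinv, ?_⟩
  have hψ0 : ψ 0 = 0 := by rw [← hκ0]; rw [hκ0]; nth_rewrite 1 [← hκ0]; exact (hMN 0 h0M).2
  have hd : DifferentiableWithinAt 𝕜 ψ N 0 := 
    (hψ 0 h0N).differentiableWithinAt.mono (Set.subset_insert _ _)
  have hO : ψ =O[𝓝[N] 0] (fun h : E => h) := by
    have := hd.isBigO_sub
    simpa [hψ0] using this
  have hto : Tendsto ψ (𝓝[N] 0) (𝓝 0) := by
    have := hd.continuousWithinAt.tendsto
    rwa [hψ0] at this
  have h1 : (fun h => Q (ψ h) (ψ h)) =o[𝓝[N] 0] (fun h : E => h) := by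
    have h2 : (fun h => Q (ψ h) (ψ h)) =O[𝓝[N] 0] fun h => ‖ψ h‖ * ‖ψ h‖ := by
      refine Asymptotics.IsBigO.of_bound ‖Q‖ (Eventually.of_forall fun h => ?_)
      rw [norm_mul, norm_norm, ← mul_assoc]
      exact Q.le_opNorm₂ _ _
    have h3 : (fun h => ‖ψ h‖ * ‖ψ h‖) =o[𝓝[N] 0] fun h : E => (1 : ℝ) * ‖h‖ := by
      refine Asymptotics.IsLittleO.mul_isBigO ?_ hO.norm_norm
      rw [Asymptotics.isLittleO_one_iff]
      simpa using hto.norm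
    simp only [one_mul] at h3
    exact (h2.trans_isLittleO h3).of_norm_right
  refine HasFDerivWithinAt.of_isLittleO ?_
  refine (h1.neg_left).congr' ?_ (by simp)
  filter_upwards [self_mem_nhdsWithin] with h hh
  simp only [hψ0, sub_zero, ContinuousLinearMap.id_apply]
  rw [neg_eq_iff_eq_neg, neg_sub, eq_sub_iff_add_eq']
  exact hQ h hh

end Charts

/-! ### The normed space `E ⊗ B` -/

section TensorNorm

variable {𝕜 : Type u} [RCLike 𝕜] {E : Type*} [NormedAddCommGroup E] [NormedSpace 𝕜 E]
  {X : Type*} [NormedAddCommGroup X] [NormedSpace 𝕜 X] {B : GradedArtin.{u, v} 𝕜}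

theorem norm_tensor_eq (t : E ⊗[𝕜] B) : ‖t‖ = ‖tensorCoord E B t‖ := rfl

theorem tensorCoord_tmul (x : E) (y : B) (i : Fin (Module.finrank 𝕜 B)) :
    tensorCoord E B (x ⊗ₜ y) i = (Module.finBasis 𝕜 B).repr y i • x := by
  simp [tensorCoord]

theorem eq_sum_tensorCoord (t : E ⊗[𝕜] B) :
    t = ∑ i, tensorCoord E B t i ⊗ₜ[𝕜] Module.finBasis 𝕜 B i := by
  induction t with
  | zero => simp
  | add x y hx hy =>
    nth_rewrite 1 [hx, hy]
    simp [TensorProduct.add_tmul, Finset.sum_add_distrib]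
  | tmul x y =>
    simp only [tensorCoord_tmul, TensorProduct.smul_tmul]
    rw [← TensorProduct.tmul_sum, Module.Basis.sum_repr]

theorem norm_tensorCoord_le (t : E ⊗[𝕜] B) (i : Fin (Module.finrank 𝕜 B)) :
    ‖tensorCoord E B t i‖ ≤ ‖t‖ := norm_le_pi_norm _ i

instance [CompleteSpace E] : CompleteSpace (E ⊗[𝕜] B) := by
  let e : E ⊗[𝕜] B ≃ₗᵢ[𝕜] (Fin (Module.finrank 𝕜 B) → E) := ⟨tensorCoord E B, fun _ => rfl⟩
  exact e.toIsometryEquiv.completeSpace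

theorem tensor_bound {g : E ⊗[𝕜] B →ₗ[𝕜] X} (h : ∀ y : B, ∃ C, ∀ x : E, ‖g (x ⊗ₜ y)‖ ≤ C * ‖x‖) :
    ∃ C, ∀ t, ‖g t‖ ≤ C * ‖t‖ := by
  choose C hC using h
  refine ⟨∑ i, |C (Module.finBasis 𝕜 B i)|, fun t => ?_⟩
  nth_rewrite 1 [eq_sum_tensorCoord t]
  rw [map_sum, Finset.sum_mul]
  refine (norm_sum_le _ _).trans (Finset.sum_le_sum fun i _ => (hC _ _).trans ?_)
  exact mul_le_mul (le_abs_self _) (norm_tensorCoord_le t i) (norm_nonneg _) (abs_nonneg _)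

theorem tensor_bound₂ {g : E ⊗[𝕜] B →ₗ[𝕜] E ⊗[𝕜] B →ₗ[𝕜] X}
    (h : ∀ y y' : B, ∃ C, ∀ x x' : E, ‖g (x ⊗ₜ y) (x' ⊗ₜ y')‖ ≤ C * ‖x‖ * ‖x'‖) :
    ∃ C, ∀ s t, ‖g s t‖ ≤ C * ‖s‖ * ‖t‖ := by
  choose C hC using h
  refine ⟨∑ i, ∑ j, |C (Module.finBasis 𝕜 B i) (Module.finBasis 𝕜 B j)|, fun s t => ?_⟩
  nth_rewrite 1 [eq_sum_tensorCoord t, eq_sum_tensorCoord s]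
  simp only [map_sum, LinearMap.sum_apply, Finset.sum_mul]
  rw [Finset.sum_comm]
  refine (norm_sum_le _ _).trans (Finset.sum_le_sum fun i _ => ?_)
  refine (norm_sum_le _ _).trans (Finset.sum_le_sum fun j _ => (hC _ _ _ _).trans ?_)
  refine mul_le_mul (mul_le_mul (le_abs_self _) (norm_tensorCoord_le s i) (norm_nonneg _)
    (abs_nonneg _)) (norm_tensorCoord_le t j) (norm_nonneg _) (by positivity)

theorem exists_norm_tmul_le (y : B) : ∃ C, ∀ x : E, ‖x ⊗ₜ[𝕜] y‖ ≤ C * ‖x‖ := by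
  refine ⟨‖fun i => (Module.finBasis 𝕜 B).repr y i‖, fun x => ?_⟩
  rw [norm_tensor_eq]
  refine (pi_norm_le_iff_of_nonneg (by positivity)).mpr fun i => ?_
  rw [tensorCoord_tmul, norm_smul]
  gcongr
  exact norm_le_pi_norm (fun i => (Module.finBasis 𝕜 B).repr y i) i

theorem tensorCoord_rTensor (f : E →ₗ[𝕜] E) (t : E ⊗[𝕜] B) (i : Fin (Module.finrank 𝕜 B)) :
    tensorCoord E B (f.rTensor B t) i = f (tensorCoord E B t i) := by
  induction t with
  | zero => simp
  | add x y hx hy => simp [hx, hy]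
  | tmul x y => simp [tensorCoord_tmul]

variable (E B) in
/-- The action of bounded operators of `E` on `E ⊗ B`. -/
noncomputable def rTensorL : (E →L[𝕜] E) →L[𝕜] E ⊗[𝕜] B →L[𝕜] E ⊗[𝕜] B :=
  LinearMap.mkContinuous₂ (LinearMap.rTensorHom B ∘ₗ ContinuousLinearMap.coeLM 𝕜) 1 fun f t => by
    rw [one_mul]
    change ‖tensorCoord E B ((f : E →ₗ[𝕜] E).rTensor B t)‖ ≤ _
    refine (pi_norm_le_iff_of_nonneg (by positivity)).mpr fun i => ?_
    rw [tensorCoord_rTensor]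
    exact (f.le_opNorm _).trans (mul_le_mul_of_nonneg_left (norm_tensorCoord_le t i) (norm_nonneg _))

theorem norm_rTensorL_apply_le (f : E →L[𝕜] E) (t : E ⊗[𝕜] B) :
    ‖rTensorL E B f t‖ ≤ ‖f‖ * ‖t‖ := by
  have h := (rTensorL E B).le_opNorm₂ f t
  have h1 : ‖rTensorL E B‖ ≤ 1 := LinearMap.mkContinuous₂_norm_le _ zero_le_one _
  refine h.trans ?_
  calc ‖rTensorL E B‖ * ‖f‖ * ‖t‖ ≤ 1 * ‖f‖ * ‖t‖ := by gcongr
    _ = ‖f‖ * ‖t‖ := by rw [one_mul]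

variable (E B) in
/-- The constant points of `E ⊗ B`. -/
noncomputable def constL : E →L[𝕜] E ⊗[𝕜] B :=
  LinearMap.mkContinuousOfExistsBound ((TensorProduct.mk 𝕜 E B).flip 1) (exists_norm_tmul_le 1)

variable (E B) in
/-- The body `E ⊗ B → E` as a bounded operator. -/
noncomputable def bodyL : E ⊗[𝕜] B →L[𝕜] E :=
  LinearMap.mkContinuousOfExistsBound (Hodge.body E B) <| tensor_bound fun y =>
    ⟨‖B.aug y‖, fun x => by simp [Hodge.body, norm_smul]⟩

theorem body_tmul (x : E) (y : B) : Hodge.body E B (x ⊗ₜ y) = B.aug y • x := by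
  simp [Hodge.body]

theorem body_const (x : E) : Hodge.body E B (x ⊗ₜ 1) = x := by simp [body_tmul]

theorem sub_body_mem (t : E ⊗[𝕜] B) : t - Hodge.body E B t ⊗ₜ 1 ∈ tfil E B 1 := by
  induction t with
  | zero => simp
  | add x y hx hy =>
    rw [map_add, TensorProduct.add_tmul, add_sub_add_comm]
    exact add_mem hx hy
  | tmul x y =>
    rw [body_tmul, TensorProduct.smul_tmul, ← TensorProduct.tmul_sub]
    refine tmul_mem_tfil x ?_
    rw [B.fil_one, B.mem_max]
    simp

theorem body_eq_zero_of_mem {t : E ⊗[𝕜] B} (ht : t ∈ tfil E B 1) : Hodge.body E B t = 0 := by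
  suffices h : tfil E B 1 ≤ LinearMap.ker (Hodge.body E B) from h ht
  refine tfil_le fun a x hx => ?_
  rw [B.fil_one, B.mem_max] at hx
  rw [LinearMap.mem_ker, body_tmul, hx, zero_smul]

end TensorNorm

/-! ### Bounded operations on a Banach space -/

section Bounded

variable {𝕜 : Type u} [RCLike 𝕜] {E : Type*} [NormedAddCommGroup E] [NormedSpace 𝕜 E]
  {X : Type*} [NormedAddCommGroup X] [NormedSpace 𝕜 X]

theorem Ops.tensor_br_tmul {A : Type*} [AddCommGroup A] [Module 𝕜 A] (o : Ops 𝕜 A) (σ : A →ₗ[𝕜] A)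
    {B : Type*} [Ring B] [Algebra 𝕜 B] (τ : B →ₗ[𝕜] B) (x x' : A) (y y' : B) :
    (o.tensor σ B τ).br (x ⊗ₜ y) (x' ⊗ₜ y') =
      o.br x ((2⁻¹ : 𝕜) • (x' + σ x')) ⊗ₜ (y * y') +
        o.br x ((2⁻¹ : 𝕜) • (x' - σ x')) ⊗ₜ (τ y * y') := rfl

/-- The operations `d`, `[ , ]`, `η` are bounded. -/
structure Ops.IsBounded (o : Ops 𝕜 E) : Prop where
  d : ∃ C, ∀ x, ‖o.d x‖ ≤ C * ‖x‖
  η : ∃ C, ∀ x, ‖o.η x‖ ≤ C * ‖x‖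
  br : ∃ C, ∀ x y, ‖o.br x y‖ ≤ C * ‖x‖ * ‖y‖

/-- A bounded bilinear map composed with a continuous linear map is bounded. -/
theorem exists_bound_compr₂ {b : E →ₗ[𝕜] E →ₗ[𝕜] E} (h : ∃ C, ∀ x y, ‖b x y‖ ≤ C * ‖x‖ * ‖y‖)
    (f : E →L[𝕜] X) : ∃ C, ∀ x y, ‖b.compr₂ (f : E →ₗ[𝕜] X) x y‖ ≤ C * ‖x‖ * ‖y‖ := by
  obtain ⟨C, hC⟩ := h
  refine ⟨‖f‖ * C, fun x y => (f.le_opNorm (b x y)).trans ?_⟩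
  rw [mul_assoc, mul_assoc, ← mul_assoc C]
  exact mul_le_mul_of_nonneg_left (hC x y) (norm_nonneg _)

namespace Ops.IsBounded

variable {o : Ops 𝕜 E} (hb : o.IsBounded)

/-- The differential as a continuous map. -/
noncomputable def dL : E →L[𝕜] E := LinearMap.mkContinuousOfExistsBound o.d hb.d

/-- The homotopy as a continuous map. -/
noncomputable def ηL : E →L[𝕜] E := LinearMap.mkContinuousOfExistsBound o.η hb.η

/-- The bilinear map `η[ , ]` as a continuous map. -/
noncomputable def ηbrL : E →L[𝕜] E →L[𝕜] E :=
  LinearMap.mkContinuousOfExistsBound₂ _ (exists_bound_compr₂ hb.br hb.ηL)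

/-- The quadratic map of the slice as a continuous map. -/
noncomputable def sliceL : E →L[𝕜] E →L[𝕜] E :=
  LinearMap.mkContinuousOfExistsBound₂ o.sliceQ
    (exists_bound_compr₂ hb.br ((2⁻¹ : 𝕜) • (hb.ηL - hb.dL ∘SL hb.ηL ∘SL hb.ηL)))

theorem sliceL_apply (x y : E) : hb.sliceL x y = o.sliceQ x y := rfl

include hb in
theorem analyticAt_kappa (x : E) : AnalyticAt 𝕜 o.kappa x :=
  ((ContinuousLinearMap.id 𝕜 E - hb.dL ∘SL hb.ηL - hb.ηL ∘SL hb.dL).analyticAt _).comp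
    (f := o.kur) (analyticAt_quadratic ((2⁻¹ : 𝕜) • hb.ηbrL) x)

variable {B : GradedArtin.{u, v} 𝕜}

theorem exists_bound_rTensor {f : E →ₗ[𝕜] E} (h : ∃ C, ∀ x, ‖f x‖ ≤ C * ‖x‖) :
    ∃ C, ∀ t : E ⊗[𝕜] B, ‖f.rTensor B t‖ ≤ C * ‖t‖ :=
  ⟨_, fun t => norm_rTensorL_apply_le (LinearMap.mkContinuousOfExistsBound f h) t⟩

include hb in
theorem tensor {σ : E →ₗ[𝕜] E} (hσ : ∀ x, ‖σ x‖ = ‖x‖) (τ : B →ₗ[𝕜] B) :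
    (o.tensor σ B τ).IsBounded := by
  refine ⟨exists_bound_rTensor hb.d, exists_bound_rTensor hb.η, tensor_bound₂ fun y y' => ?_⟩
  obtain ⟨C, hC⟩ := hb.br
  obtain ⟨C₁, h₁⟩ := exists_norm_tmul_le (E := E) (y * y')
  obtain ⟨C₂, h₂⟩ := exists_norm_tmul_le (E := E) (τ y * y')
  have h2 : ‖(2⁻¹ : 𝕜)‖ = 2⁻¹ := by simp
  have key : ∀ x x' z : E, ‖z‖ ≤ ‖x'‖ → ‖o.br x z‖ ≤ |C| * ‖x‖ * ‖x'‖ := fun x x' z hz =>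
    (hC x z).trans (by gcongr; exact le_abs_self C)
  refine ⟨|C₁| * |C| + |C₂| * |C|, fun x x' => ?_⟩
  have e1 : ‖(2⁻¹ : 𝕜) • (x' + σ x')‖ ≤ ‖x'‖ := by
    rw [norm_smul, h2]
    have := norm_add_le x' (σ x')
    rw [hσ] at this
    linarith
  have e2 : ‖(2⁻¹ : 𝕜) • (x' - σ x')‖ ≤ ‖x'‖ := by
    rw [norm_smul, h2]
    have := norm_sub_le x' (σ x')
    rw [hσ] at this
    linarith
  rw [Ops.tensor_br_tmul, add_mul, add_mul]
  refine (norm_add_le _ _).trans (add_le_add ?_ ?_)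
  · refine (h₁ _).trans ?_
    rw [mul_assoc, mul_assoc, ← mul_assoc |C|]
    exact mul_le_mul (le_abs_self _) (key _ _ _ e1) (norm_nonneg _) (abs_nonneg _)
  · refine (h₂ _).trans ?_
    rw [mul_assoc, mul_assoc, ← mul_assoc |C|]
    exact mul_le_mul (le_abs_self _) (key _ _ _ e2) (norm_nonneg _) (abs_nonneg _)

end Ops.IsBounded

end Bounded

/-! ### The moduli space of points with small body -/

section Moduli

variable {𝕜 : Type u} [RCLike 𝕜] {E : Type*} [NormedAddCommGroup E] [NormedSpace 𝕜 E]
  {o : Ops 𝕜 E} {σ : E →ₗ[𝕜] E} {B : GradedArtin.{u, v} 𝕜}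

theorem parity_one : parity B.gr (1 : B) = 1 := by
  rw [parity_of_mem B.gr (i := 0) SetLike.GradedOne.one_mem]
  simp

theorem map_parity_const (x : E) :
    TensorProduct.map σ (parity B.gr) (x ⊗ₜ[𝕜] (1 : B)) = σ x ⊗ₜ 1 := by
  rw [TensorProduct.map_tmul, parity_one]

theorem tensor_br_const (x : E) (t : E ⊗[𝕜] B) :
    (o.tensor σ B (parity B.gr)).br (x ⊗ₜ 1) t = (o.br x).rTensor B t := by
  induction t with
  | zero => simp
  | add s t hs ht => rw [map_add, map_add, hs, ht]
  | tmul y b =>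
    rw [Ops.tensor_br_tmul, parity_one, one_mul, ← TensorProduct.add_tmul, ← map_add, LinearMap.rTensor_tmul]
    congr 2
    module

theorem tensor_sliceQ_const (x : E) (t : E ⊗[𝕜] B) :
    (o.tensor σ B (parity B.gr)).sliceQ (x ⊗ₜ 1) t = (o.sliceQ x).rTensor B t := by
  rw [Ops.sliceQ_apply, tensor_br_const]
  induction t with
  | zero => simp
  | add s t hs ht =>
    rw [map_add (LinearMap.rTensor _ (o.sliceQ x)), ← hs, ← ht]
    simp only [map_add, smul_sub, smul_add]
    abel
  | tmul y b =>
    simp only [LinearMap.rTensor_tmul, Ops.sliceQ_apply]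
    rw [← TensorProduct.smul_tmul', TensorProduct.sub_tmul]
    rfl

theorem body_map_parity (t : E ⊗[𝕜] B) :
    Hodge.body E B (TensorProduct.map σ (parity B.gr) t) = σ (Hodge.body E B t) := by
  induction t with
  | zero => simp
  | add s t hs ht => simp only [map_add, hs, ht]
  | tmul y b => rw [TensorProduct.map_tmul, body_tmul, body_tmul, B.aug_parity, map_smul]

theorem body_rTensor (f : E →ₗ[𝕜] E) (t : E ⊗[𝕜] B) :
    Hodge.body E B (f.rTensor B t) = f (Hodge.body E B t) := by
  induction t with
  | zero => simp
  | add s t hs ht => simp only [map_add, hs, ht]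
  | tmul y b => rw [LinearMap.rTensor_tmul, body_tmul, body_tmul, map_smul]

theorem body_tensor_br (s t : E ⊗[𝕜] B) :
    Hodge.body E B ((o.tensor σ B (parity B.gr)).br s t) =
      o.br (Hodge.body E B s) (Hodge.body E B t) := by
  induction s with
  | zero => simp
  | add s s' hs hs' => simp only [map_add, LinearMap.add_apply, hs, hs']
  | tmul x a =>
    induction t with
    | zero => simp
    | add t t' ht ht' => simp only [map_add, ht, ht']
    | tmul y b =>
      rw [Ops.tensor_br_tmul, map_add, body_tmul, body_tmul, body_tmul, body_tmul, map_mul, map_mul, B.aug_parity,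
        ← smul_add, ← map_add, map_smul, map_smul, LinearMap.smul_apply, smul_smul, mul_comm]
      congr 2
      module

theorem body_tensor_sliceQ (s t : E ⊗[𝕜] B) :
    Hodge.body E B ((o.tensor σ B (parity B.gr)).sliceQ s t) =
      o.sliceQ (Hodge.body E B s) (Hodge.body E B t) :=
  Ops.map_sliceQ _ o (Hodge.body E B) (body_rTensor _) (body_rTensor _) body_tensor_br s t

variable (o σ B) in
/-- The points of the slice `Ker dη` with odd total parity and body in `U` that solve the
Maurer–Cartan equation. -/
def SlicePoints (U : Set E) : Set (E ⊗[𝕜] B) :=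
  {Γ | TensorProduct.map σ (parity B.gr) Γ = -Γ ∧ Hodge.body E B Γ ∈ U ∧
    (o.tensor σ B (parity B.gr)).d ((o.tensor σ B (parity B.gr)).η Γ) = 0 ∧
    HasSum ((o.tensor σ B (parity B.gr)).mcTerm Γ) 0}

variable (o σ B) in
/-- The harmonic points with odd total parity and body in `V`. -/
def HarmonicPoints (V : Set E) : Set (E ⊗[𝕜] B) :=
  {h | (o.tensor σ B (parity B.gr)).harm h = h ∧ TensorProduct.map σ (parity B.gr) h = -h ∧
    Hodge.body E B h ∈ V}

/-- The odd part of `E ⊗ B` with respect to the total parity. -/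
noncomputable def oddPart (σ : E →ₗ[𝕜] E) (B : GradedArtin.{u, v} 𝕜) : Submodule 𝕜 (E ⊗[𝕜] B) :=
  LinearMap.ker (TensorProduct.map σ (parity B.gr) + LinearMap.id)

theorem mem_oddPart {t : E ⊗[𝕜] B} : t ∈ oddPart σ B ↔ TensorProduct.map σ (parity B.gr) t = -t := by
  rw [oddPart, LinearMap.mem_ker, LinearMap.add_apply, LinearMap.id_apply, add_eq_zero_iff_eq_neg]

/-- The even part of `E ⊗ B` with respect to the total parity. -/
noncomputable def evenPart (σ : E →ₗ[𝕜] E) (B : GradedArtin.{u, v} 𝕜) : Submodule 𝕜 (E ⊗[𝕜] B) :=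
  LinearMap.ker (TensorProduct.map σ (parity B.gr) - LinearMap.id)

theorem mem_evenPart {t : E ⊗[𝕜] B} :
    t ∈ evenPart σ B ↔ TensorProduct.map σ (parity B.gr) t = t := by
  rw [evenPart, LinearMap.mem_ker, LinearMap.sub_apply, LinearMap.id_apply, sub_eq_zero]

/-- For a point of small body the Maurer–Cartan series converges to zero exactly when the Kuranishi
map takes it to a cocycle: on even elements `t ↦ η[t, Γ]` is a contraction modulo an operator that
raises the filtration by powers of the maximal ideal. -/
theorem hasSum_mcTerm_iff [CompleteSpace E] (H : o.IsSuper σ) (hb : o.IsBounded)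
    (hσ : ∀ x, ‖σ x‖ = ‖x‖) {r : ℝ} (hr : ‖hb.ηbrL‖ * r < 1) {Γ : E ⊗[𝕜] B}
    (hΓ : TensorProduct.map σ (parity B.gr) Γ = -Γ) (hΓr : ‖Hodge.body E B Γ‖ ≤ r) :
    HasSum ((o.tensor σ B (parity B.gr)).mcTerm Γ) 0 ↔
      (o.tensor σ B (parity B.gr)).d ((o.tensor σ B (parity B.gr)).kur Γ) = 0 := by
  have HT := H.tensor B.isSuperComm
  have hbT : (o.tensor σ B (parity B.gr)).IsBounded := hb.tensor hσ (parity B.gr)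
  set oT := o.tensor σ B (parity B.gr) with hoT
  have hP := HT.sum_mcTerm hΓ
  set f : E ⊗[𝕜] B →ₗ[𝕜] E ⊗[𝕜] B := oT.η ∘ₗ oT.br.flip Γ with hf
  have hfa : ∀ t, f t = oT.η (oT.br t Γ) := fun t => rfl
  constructor
  · intro h
    have h1 : Continuous f := (hbT.ηbrL.flip Γ).continuous
    exact neg_eq_zero.mp (eq_zero_of_hasSum_zero h1 (map_zero f) hP h)
  · intro hK
    rw [hK, neg_zero] at hP
    set γ := Hodge.body E B Γ with hγ
    have hγo : σ γ = -γ := by rw [hγ, ← body_map_parity, hΓ, map_neg]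
    have hγT : TensorProduct.map σ (parity B.gr) (γ ⊗ₜ[𝕜] (1 : B)) = -(γ ⊗ₜ 1) := by
      rw [map_parity_const, hγo, TensorProduct.neg_tmul]
    set g : E ⊗[𝕜] B →ₗ[𝕜] E ⊗[𝕜] B := -(rTensorL E B (hb.ηbrL γ)).toLinearMap with hg
    have hg1 : ∀ t, TensorProduct.map σ (parity B.gr) t = t → g t = oT.η (oT.br t (γ ⊗ₜ 1)) :=
      fun t ht => by
        rw [HT.br_comm_even _ ht, map_neg, hoT, tensor_br_const, hg, LinearMap.neg_apply]
        congr 1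
        change (o.η ∘ₗ o.br γ).rTensor B t = o.η.rTensor B _
        rw [LinearMap.rTensor_comp]
        rfl
    obtain ⟨N, hN⟩ := exists_tfil_eq_bot E B
    obtain ⟨K, hK1⟩ : ∃ K, ∀ t, ‖f t - g t‖ ≤ K * ‖t‖ :=
      ⟨_, fun t => (hbT.ηbrL.flip Γ + rTensorL E B (hb.ηbrL γ)).le_opNorm t |>.trans' (by
        rw [hg, LinearMap.neg_apply, sub_neg_eq_add]; rfl)⟩
    have hc : ‖hb.ηbrL γ‖ < 1 :=
      ((hb.ηbrL.le_opNorm γ).trans (mul_le_mul_of_nonneg_left hΓr (norm_nonneg _))).trans_lt hr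
    have hsum : ∀ t ∈ evenPart σ B, Summable fun k => ‖f^[k] t‖ := fun t ht => by
      refine summable_iterate_of_filtration (F := tfil E B) hN tfil_zero (O := evenPart σ B) (g := g)
        (K := K) (fun x hx => ?_) (fun x hx => ?_) hc (fun x _ => ?_) (fun n x hx => ?_)
        (fun n x hx hxn => ?_) (fun x _ => hK1 x) ht
      · rw [mem_evenPart] at hx ⊢
        rw [hfa, HT.σ_η, HT.σ_br, hx, hΓ, map_neg, map_neg, neg_neg]
      · have hx' := hx
        rw [mem_evenPart] at hx ⊢
        rw [hg1 x hx, HT.σ_η, HT.σ_br, hx, hγT, map_neg, map_neg, neg_neg]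
      · rw [hg, LinearMap.neg_apply, norm_neg]
        exact norm_rTensorL_apply_le _ _
      · exact neg_mem (rTensor_mem_tfil _ hx)
      · rw [mem_evenPart] at hx
        rw [hg1 x hx, hfa, ← map_sub, ← map_sub]
        exact rTensor_mem_tfil _ (tensor_br_mem_tfil o σ rfl hxn (sub_body_mem Γ))
    have hdΓ : TensorProduct.map σ (parity B.gr) (oT.d Γ) = oT.d Γ := HT.σ_d_odd hΓ
    refine hasSum_zero_of_geometric (f := f) hP (fun k => oT.mcTerm_succ Γ k) (hsum _ ?_)
      (hsum _ ?_)
    · rw [mem_evenPart, Ops.mcTerm_two]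
      have h1 : TensorProduct.map σ (parity B.gr) (oT.br Γ Γ) = oT.br Γ Γ := by
        rw [HT.σ_br, hΓ]; simp
      simp only [map_neg, map_smul, map_add, HT.σ_d, HT.σ_η, h1, neg_neg]
    · rw [mem_evenPart, Finset.sum_range_succ, Finset.sum_range_one, Ops.mcTerm_zero,
        Ops.mcTerm_one, zero_add, map_neg, hdΓ]

end Moduli

/-! ### The Kuranishi map as a chart of the moduli space -/

section SliceChart

variable {𝕜 : Type u} [RCLike 𝕜] {E : Type*} [NormedAddCommGroup E] [NormedSpace 𝕜 E]
  {o : Ops 𝕜 E} {σ : E →ₗ[𝕜] E} {B : GradedArtin.{u, v} 𝕜}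

/-- The solutions of `γ + Q(γ, γ) = b` with small `γ` and odd `b` are odd. -/
theorem odd_of_slice_eq (H : o.IsSuper σ) (hb : o.IsBounded) (hσ : ∀ x, ‖σ x‖ = ‖x‖) {r : ℝ}
    (hr : 2 * ‖hb.sliceL‖ * r < 1) {γ : E} (hγ : ‖γ‖ ≤ r)
    (h : σ (γ + o.sliceQ γ γ) = -(γ + o.sliceQ γ γ)) : σ γ = -γ := by
  have h1 := quadratic_injOn hb.sliceL hr (x := -σ γ) (y := γ) (by rwa [norm_neg, hσ]) hγ (by
    simp only [map_neg, neg_apply, neg_neg, Ops.IsBounded.sliceL_apply]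
    have h2 : o.sliceQ (σ γ) (σ γ) = -σ (o.sliceQ γ γ) := by rw [H.σ_sliceQ, neg_neg]
    rw [h2, ← neg_add, ← map_add, h, neg_neg])
  rw [← neg_neg (σ γ), h1]

variable (hb : o.IsBounded)

/-- The derivative `Id + 2 Q(γ, ·)` of `x ↦ x + Q(x, x)` at an odd point `γ`, on odd vectors. -/
noncomputable def Ops.IsBounded.linearization (γ : E) : E →L[𝕜] E := 1 + (2 : 𝕜) • hb.sliceL γ

theorem Ops.IsBounded.isUnit_linearization [CompleteSpace E] {r : ℝ}
    (hr : 2 * ‖hb.sliceL‖ * r < 1) {γ : E} (hγ : ‖γ‖ ≤ r) : IsUnit (hb.linearization γ) := by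
  have h1 : ‖-((2 : 𝕜) • hb.sliceL γ)‖ < 1 := by
    rw [norm_neg, norm_smul]
    have h2 : ‖(2 : 𝕜)‖ = 2 := by simp
    rw [h2]
    refine lt_of_le_of_lt ?_ hr
    rw [mul_assoc]
    gcongr
    exact (hb.sliceL.le_opNorm γ).trans (by gcongr)
  have := (Units.oneSub _ h1).isUnit
  rwa [Units.val_oneSub, sub_neg_eq_add] at this

/-- The operator `(Id + 2 Q(γ, ·))⁻¹ ⊗ Id` on `E ⊗ B`. -/
noncomputable def Ops.IsBounded.resolvent (B : GradedArtin.{u, v} 𝕜) (γ : E) :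
    E ⊗[𝕜] B →L[𝕜] E ⊗[𝕜] B :=
  rTensorL E B (Ring.inverse (hb.linearization γ))

theorem exists_newtonData_const [CompleteSpace E] (H : o.IsSuper σ) {r : ℝ}
    (hr : 2 * ‖hb.sliceL‖ * r < 1) {γ : E} (hγ : ‖γ‖ ≤ r) (hγo : σ γ = -γ) {N : ℕ}
    (hN : tfil E B N = ⊥) :
    NewtonData (tfil E B) (oddPart σ B) N (o.tensor σ B (parity B.gr)).sliceQ
      (hb.resolvent B γ).toLinearMap (γ ⊗ₜ 1) := by
  have HT := H.tensor B.isSuperComm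
  set oT := o.tensor σ B (parity B.gr) with hoT
  obtain ⟨A, hA⟩ := hb.isUnit_linearization hr hγ
  have hR : hb.resolvent B γ = rTensorL E B (↑A⁻¹ : E →L[𝕜] E) := by
    rw [Ops.IsBounded.resolvent, ← hA, Ring.inverse_unit]
  have hγT : TensorProduct.map σ (parity B.gr) (γ ⊗ₜ[𝕜] (1 : B)) = -(γ ⊗ₜ 1) := by
    rw [map_parity_const, hγo, TensorProduct.neg_tmul]
  have hlin : ∀ e ∈ oddPart σ B, e + oT.sliceQ (γ ⊗ₜ 1) e + oT.sliceQ e (γ ⊗ₜ 1) =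
      rTensorL E B (A : E →L[𝕜] E) e := fun e he => by
    rw [mem_oddPart] at he
    have h1 : rTensorL E B (hb.sliceL γ) e = (o.sliceQ γ).rTensor B e := rfl
    have h2 : rTensorL E B 1 e = e := by
      change (LinearMap.id : E →ₗ[𝕜] E).rTensor B e = e
      rw [LinearMap.rTensor_id]; rfl
    rw [HT.sliceQ_comm_odd he hγT, hoT, tensor_sliceQ_const, hA, Ops.IsBounded.linearization,
      map_add, map_smul, add_apply, smul_apply, h1, h2, two_smul, add_assoc]
  have hcomp : ∀ (f g : E →L[𝕜] E) (e : E ⊗[𝕜] B),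
      rTensorL E B f (rTensorL E B g e) = rTensorL E B (f * g) e := fun f g e => by
    change f.toLinearMap.rTensor B (g.toLinearMap.rTensor B e) =
      (f.toLinearMap ∘ₗ g.toLinearMap).rTensor B e
    rw [LinearMap.rTensor_comp]; rfl
  have hone : ∀ e : E ⊗[𝕜] B, rTensorL E B 1 e = e := fun e => by
    change (LinearMap.id : E →ₗ[𝕜] E).rTensor B e = e
    rw [LinearMap.rTensor_id]; rfl
  have hAσ : ∀ x, (A : E →L[𝕜] E) (σ x) = σ ((A : E →L[𝕜] E) x) := fun x => by
    rw [hA]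
    change σ x + (2 : 𝕜) • o.sliceQ γ (σ x) = σ (x + (2 : 𝕜) • o.sliceQ γ x)
    rw [map_add, map_smul, H.σ_sliceQ, hγo, map_neg, LinearMap.neg_apply, neg_neg]
  have hAσ' : ∀ x, (↑A⁻¹ : E →L[𝕜] E) (σ x) = σ ((↑A⁻¹ : E →L[𝕜] E) x) := fun x => by
    have h1 : ∀ y, (↑A⁻¹ : E →L[𝕜] E) ((A : E →L[𝕜] E) y) = y := fun y => by
      change ((↑A⁻¹ : E →L[𝕜] E) * (A : E →L[𝕜] E)) y = y
      rw [Units.inv_mul]; rfl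
    have h2 : (A : E →L[𝕜] E) ((↑A⁻¹ : E →L[𝕜] E) x) = x := by
      change ((A : E →L[𝕜] E) * (↑A⁻¹ : E →L[𝕜] E)) x = x
      rw [Units.mul_inv]; rfl
    nth_rewrite 1 [← h2]
    rw [← hAσ, h1]
  have hRσ : ∀ e, TensorProduct.map σ (parity B.gr) (hb.resolvent B γ e) =
      hb.resolvent B γ (TensorProduct.map σ (parity B.gr) e) := fun e => by
    rw [hR]
    induction e with
    | zero => simp
    | add s t hs ht => simp only [map_add, hs, ht]
    | tmul x y =>
      change TensorProduct.map σ (parity B.gr) ((↑A⁻¹ : E →L[𝕜] E) x ⊗ₜ y) =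
        ((↑A⁻¹ : E →L[𝕜] E) (σ x)) ⊗ₜ (parity B.gr y)
      rw [TensorProduct.map_tmul, hAσ']
  have hRO : ∀ e ∈ oddPart σ B, hb.resolvent B γ e ∈ oddPart σ B := fun e he => by
    rw [mem_oddPart] at he ⊢
    rw [hRσ, he, map_neg]
  refine ⟨tfil_antitone, hN, tfil_zero, fun m n s hs t ht => ?_, fun s hs t ht => ?_,
    fun n s hs => rTensor_mem_tfil _ hs, hRO, fun e he => ?_, fun e he => ?_, mem_oddPart.mpr hγT⟩
  · have h1 := tensor_br_mem_tfil o σ rfl hs ht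
    exact Submodule.smul_mem _ _ (sub_mem (rTensor_mem_tfil o.η h1)
      (rTensor_mem_tfil o.d (rTensor_mem_tfil o.η (rTensor_mem_tfil o.η h1))))
  · rw [mem_oddPart] at hs ht ⊢
    rw [HT.σ_sliceQ, hs, ht, map_neg, map_neg, LinearMap.neg_apply, neg_neg]
  · have := hlin _ (hRO e he)
    refine this.trans ?_
    rw [hR, hcomp, Units.mul_inv, hone]
  · rw [hlin e he]
    change hb.resolvent B γ _ = e
    rw [hR, hcomp, Units.inv_mul, hone]

/-- The Newton iterates depend analytically on the right-hand side. -/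
theorem analyticOnNhd_newton [CompleteSpace E] {r : ℝ} (hr : 2 * ‖hb.sliceL‖ * r < 1) {V : Set E}
    {ψ : E → E} (hψ : AnalyticOnNhd 𝕜 ψ V) (hψr : ∀ y ∈ V, ‖ψ y‖ ≤ r)
    (hT : (o.tensor σ B (parity B.gr)).IsBounded) (n : ℕ) :
    AnalyticOnNhd 𝕜 (fun h => newton (o.tensor σ B (parity B.gr)).sliceQ
      (hb.resolvent B (ψ (Hodge.body E B h))).toLinearMap (ψ (Hodge.body E B h) ⊗ₜ 1) h n)
      (Hodge.body E B ⁻¹' V) := by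
  intro h hh
  have hγ : AnalyticAt 𝕜 (fun h => ψ (Hodge.body E B h)) h :=
    (hψ _ hh).comp (f := Hodge.body E B) ((bodyL E B).analyticAt h)
  have hR : AnalyticAt 𝕜 (fun h => hb.resolvent B (ψ (Hodge.body E B h))) h := by
    have h1 : AnalyticAt 𝕜 (fun h => hb.linearization (ψ (Hodge.body E B h))) h :=
      analyticAt_const.add (((2 : 𝕜) • hb.sliceL).analyticAt _ |>.comp hγ)
    obtain ⟨A, hA⟩ := hb.isUnit_linearization hr (hψr _ hh)
    have h2 : AnalyticAt 𝕜 Ring.inverse (hb.linearization (ψ (Hodge.body E B h))) := by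
      rw [← hA]; exact analyticAt_inverse A
    exact ((rTensorL E B).analyticAt _).comp (h2.comp (f := fun h => hb.linearization (ψ (Hodge.body E B h))) h1)
  induction n with
  | zero => exact ((constL E B).analyticAt _).comp hγ
  | succ n ih =>
    refine ih.sub ?_
    have h3 := ((analyticAt_quadratic hT.sliceL _).comp ih).sub analyticAt_id
    exact ((ContinuousLinearMap.id 𝕜 (E ⊗[𝕜] B →L[𝕜] E ⊗[𝕜] B)).analyticAt_bilinear _).comp
      (hR.prod h3)

include hb in
/-- For bounded operations on a Banach space, the map `κ` is, for every coefficient algebra, an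
analytic isomorphism of the solutions in the slice with small body onto the harmonic points with
small body. -/
theorem exists_sliceChart [CompleteSpace E] (H : o.IsSuper σ) (hσ : ∀ x, ‖σ x‖ = ‖x‖) :
    ∃ U V : Set E, IsOpen U ∧ 0 ∈ U ∧ IsOpen V ∧ 0 ∈ V ∧ ∀ B : GradedArtin.{u, v} 𝕜,
      IsAnalyticChart 𝕜 (o.tensor σ B (parity B.gr)).kappa (SlicePoints o σ B U)
        (HarmonicPoints o σ B V) ∧
      ∀ Γ : E ⊗[𝕜] B, TensorProduct.map σ (parity B.gr) Γ = -Γ → Hodge.body E B Γ ∈ U →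
        (HasSum ((o.tensor σ B (parity B.gr)).mcTerm Γ) 0 ↔
          (o.tensor σ B (parity B.gr)).d ((o.tensor σ B (parity B.gr)).kur Γ) = 0) := by
  set r : ℝ := 1 / (2 * ‖hb.sliceL‖ + ‖hb.ηbrL‖ + 1) with hr
  have hden : 0 < 2 * ‖hb.sliceL‖ + ‖hb.ηbrL‖ + 1 := by positivity
  have hr0 : 0 < r := by positivity
  have hr1 : 2 * ‖hb.sliceL‖ * r < 1 := by
    rw [hr, mul_one_div, div_lt_one hden]
    linarith [norm_nonneg hb.ηbrL]
  have hr2 : ‖hb.ηbrL‖ * r < 1 := by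
    rw [hr, mul_one_div, div_lt_one hden]
    linarith [norm_nonneg hb.sliceL]
  obtain ⟨U, V, ψ, hUo, h0U, hVo, h0V, hUr, hUV, hVU, hψ⟩ :=
    exists_quadratic_inverse hb.sliceL hr0
  refine ⟨U, V, hUo, h0U, hVo, h0V, fun B => ?_⟩
  have HT := H.tensor B.isSuperComm
  have hbT : (o.tensor σ B (parity B.gr)).IsBounded := hb.tensor hσ (parity B.gr)
  have hMC : ∀ Γ : E ⊗[𝕜] B, TensorProduct.map σ (parity B.gr) Γ = -Γ → Hodge.body E B Γ ∈ U →
      (HasSum ((o.tensor σ B (parity B.gr)).mcTerm Γ) 0 ↔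
        (o.tensor σ B (parity B.gr)).d ((o.tensor σ B (parity B.gr)).kur Γ) = 0) :=
    fun Γ h1 h2 => hasSum_mcTerm_iff H hb hσ hr2 h1 (hUr _ h2).le
  refine ⟨?_, hMC⟩
  obtain ⟨N, hN⟩ := exists_tfil_eq_bot E B
  set oT := o.tensor σ B (parity B.gr) with hoT
  set ψB : E ⊗[𝕜] B → E ⊗[𝕜] B := fun h => newton oT.sliceQ
    (hb.resolvent B (ψ (Hodge.body E B h))).toLinearMap (ψ (Hodge.body E B h) ⊗ₜ 1) h N with hψB
  -- the constant point `ψ(body h)` solves the equation to first order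
  have hstart : ∀ h : E ⊗[𝕜] B, Hodge.body E B h ∈ V →
      ψ (Hodge.body E B h) ⊗ₜ[𝕜] (1 : B) +
        oT.sliceQ (ψ (Hodge.body E B h) ⊗ₜ 1) (ψ (Hodge.body E B h) ⊗ₜ 1) - h ∈ tfil E B 1 :=
    fun h hh => by
      have h1 := (hVU _ hh).2
      rw [hoT, tensor_sliceQ_const, LinearMap.rTensor_tmul, ← TensorProduct.add_tmul]
      rw [Ops.IsBounded.sliceL_apply] at h1
      rw [h1, ← neg_sub]
      exact neg_mem (sub_body_mem h)
  have hodd : ∀ h : E ⊗[𝕜] B, TensorProduct.map σ (parity B.gr) h = -h → Hodge.body E B h ∈ V →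
      σ (ψ (Hodge.body E B h)) = -ψ (Hodge.body E B h) := fun h h1 h2 => by
    refine odd_of_slice_eq H hb hσ hr1 (hUr _ (hVU _ h2).1).le ?_
    have h3 := (hVU _ h2).2
    rw [Ops.IsBounded.sliceL_apply] at h3
    rw [h3, ← body_map_parity, h1, map_neg]
  have hdata : ∀ h : E ⊗[𝕜] B, TensorProduct.map σ (parity B.gr) h = -h → Hodge.body E B h ∈ V →
      NewtonData (tfil E B) (oddPart σ B) N oT.sliceQ
        (hb.resolvent B (ψ (Hodge.body E B h))).toLinearMap (ψ (Hodge.body E B h) ⊗ₜ 1) :=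
    fun h h1 h2 => exists_newtonData_const hb H hr1 (hUr _ (hVU _ h2).1).le (hodd h h1 h2) hN
  have hspec : ∀ h : E ⊗[𝕜] B, TensorProduct.map σ (parity B.gr) h = -h → Hodge.body E B h ∈ V →
      ψB h + oT.sliceQ (ψB h) (ψB h) = h ∧ TensorProduct.map σ (parity B.gr) (ψB h) = -ψB h ∧
        ψB h - ψ (Hodge.body E B h) ⊗ₜ 1 ∈ tfil E B 1 := fun h h1 h2 => by
    have h3 := (hdata h h1 h2).newton_spec (mem_oddPart.mpr h1) (hstart h h2) N
    exact ⟨(hdata h h1 h2).newton_eq (mem_oddPart.mpr h1) (hstart h h2), mem_oddPart.mp h3.1, h3.2.1⟩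
  have hbody0 : Hodge.body E B 0 = 0 := map_zero _
  refine isAnalyticChart_of_quadratic (ψ := ψB) hbT.sliceL ⟨by simp, by rwa [hbody0], by simp, ?_⟩
    ⟨?_, by simp, by rwa [hbody0]⟩ ?_ (fun x _ => hbT.analyticAt_kappa x) (fun Γ hΓ => ?_)
    (fun h hh => ?_) ?_ fun h hh => (hspec h hh.2.1 hh.2.2).1
  · rw [hMC 0 (by simp) (by rwa [hbody0])]
    simp [Ops.kur]
  · rw [← Ops.harmL_apply, map_zero]
  · rw [Ops.kappa, ← Ops.harmL_apply]
    simp [Ops.kur]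
  · obtain ⟨h1, h2, h3, h4⟩ := hΓ
    rw [hMC Γ h1 h2] at h4
    have h5 := oT.slice_eq_kappa h3 h4
    have h6 : TensorProduct.map σ (parity B.gr) (oT.kappa Γ) = -oT.kappa Γ := by
      rw [← h5, map_add, HT.σ_sliceQ, h1]
      simp only [map_neg, LinearMap.neg_apply, neg_neg, neg_add]
    have h7 := hUV _ h2
    rw [Ops.IsBounded.sliceL_apply] at h7
    have h8 : Hodge.body E B (oT.kappa Γ) =
        Hodge.body E B Γ + o.sliceQ (Hodge.body E B Γ) (Hodge.body E B Γ) := by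
      rw [← h5, map_add, hoT, body_tensor_sliceQ]
    rw [← h8] at h7
    refine ⟨⟨HT.harm_harm _, h6, h7.1⟩, ?_⟩
    have h9 := hspec _ h6 h7.1
    refine (hdata _ h6 h7.1).unique (mem_oddPart.mpr h9.2.1) (mem_oddPart.mpr h1) h9.2.2 ?_
      (h9.1.trans h5.symm)
    rw [h7.2]
    exact sub_body_mem Γ
  · obtain ⟨h1, h2, h3⟩ := hh
    obtain ⟨h4, h5, h6⟩ := hspec h h2 h3
    obtain ⟨h7, h8, h9⟩ := HT.of_slice_eq h1 h4
    have h10 : Hodge.body E B (ψB h) ∈ U := by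
      have := body_eq_zero_of_mem h6
      rw [map_sub, body_const, sub_eq_zero] at this
      rw [this]
      exact (hVU _ h3).1
    exact ⟨⟨h5, h10, h7, (hMC _ h5 h10).mpr h8⟩, h9⟩
  · exact (analyticOnNhd_newton hb hr1 hψ (fun y hy => (hUr _ (hVU y hy).1).le) hbT N).analyticOn.mono
      fun h hh => hh.2.2

end SliceChart

/-! ### The completion of `𝔤` -/

section Hat

variable {𝕜 : Type u} [RCLike 𝕜] {G : Type w} [NormedAddCommGroup G] [NormedSpace 𝕜 G]
  {𝒢 : ℤ → Submodule 𝕜 G} [DirectSum.Decomposition 𝒢] {D : NormedDGLA 𝕜 𝒢}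

theorem decompose_parity (x : G) (i : ℤ) :
    (DirectSum.decompose 𝒢 (parity 𝒢 x) i : G) =
      ((i.negOnePow : ℤˣ) : ℤ) • (DirectSum.decompose 𝒢 x i : G) := by
  induction x using DirectSum.Decomposition.inductionOn 𝒢 with
  | zero => simp
  | @homogeneous j m =>
    rw [parity_of_mem 𝒢 m.2, Units.smul_def]
    have hm : ((j.negOnePow : ℤˣ) : ℤ) • (m : G) ∈ 𝒢 j := (𝒢 j).smul_of_tower_mem _ m.2
    by_cases h : j = i
    · subst h
      rw [DirectSum.decompose_of_mem_same _ m.2, DirectSum.decompose_of_mem_same _ hm]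
    · rw [DirectSum.decompose_of_mem_ne _ m.2 h, DirectSum.decompose_of_mem_ne _ hm h, smul_zero]
  | add x y hx hy => simp [DirectSum.decompose_add, hx, hy]

theorem NormedDGLA.norm_parity (D : NormedDGLA 𝕜 𝒢) (x : G) : ‖parity 𝒢 x‖ = ‖x‖ := by
  rw [D.norm_eq, D.norm_eq x]
  refine finsum_congr fun i => ?_
  rw [decompose_parity]
  rcases Int.even_or_odd i with hi | hi
  · simp [Int.negOnePow_even i hi]
  · simp [Int.negOnePow_odd i hi]

/-- The inclusion of `𝔤` in its completion. -/
noncomputable def hatι (G : Type w) [NormedAddCommGroup G] [NormedSpace 𝕜 G] :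
    G →ₗ[𝕜] Completion G := (Completion.toComplL : G →L[𝕜] Completion G).toLinearMap

theorem hatι_apply (x : G) : hatι (𝕜 := 𝕜) G x = (x : Completion G) := rfl

namespace Hodge

/-- The continuous map underlying `extendHat`. -/
noncomputable def extendHatL (f : G →ₗ[𝕜] G) : Completion G →L[𝕜] Completion G :=
  LinearMap.extendOfNorm ((Completion.toComplL : G →L[𝕜] Completion G).toLinearMap ∘ₗ f)
    (Completion.toComplL : G →L[𝕜] Completion G).toLinearMap

theorem extendHat_eq (f : G →ₗ[𝕜] G) : extendHat f = (extendHatL f).toLinearMap := by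
  unfold extendHat extendHatL; rfl

theorem continuous_extendHat (f : G →ₗ[𝕜] G) : Continuous (extendHat f) := by
  rw [extendHat_eq]
  exact (extendHatL f).continuous

theorem extendHat_coe {f : G →ₗ[𝕜] G} (hf : ∃ C, ∀ x, ‖f x‖ ≤ C * ‖x‖) (x : G) :
    extendHat f (x : Completion G) = (f x : Completion G) := by
  have h1 : DenseRange (Completion.toComplL : G →L[𝕜] Completion G).toLinearMap :=
    Completion.denseRange_coe
  have h2 : ∃ C, ∀ x : G, ‖((Completion.toComplL : G →L[𝕜] Completion G).toLinearMap ∘ₗ f) x‖ ≤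
      C * ‖(Completion.toComplL : G →L[𝕜] Completion G).toLinearMap x‖ := by
    obtain ⟨C, hC⟩ := hf
    exact ⟨C, fun x => by simpa using hC x⟩
  have h3 := LinearMap.extendOfNorm_eq h1 h2 x
  rw [extendHat_eq]
  exact h3
theorem exists_bound_parity (D : NormedDGLA 𝕜 𝒢) : ∃ C, ∀ x, ‖parity 𝒢 x‖ ≤ C * ‖x‖ :=
  ⟨1, fun x => by rw [one_mul, D.norm_parity]⟩

theorem parityHat_coe (D : NormedDGLA 𝕜 𝒢) (x : G) :
    extendHat (parity 𝒢) (x : Completion G) = (parity 𝒢 x : G) :=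
  extendHat_coe (exists_bound_parity D) x

theorem norm_parityHat (D : NormedDGLA 𝕜 𝒢) (x : Completion G) :
    ‖extendHat (parity 𝒢) x‖ = ‖x‖ := by
  refine Completion.induction_on x
    (isClosed_eq (continuous_extendHat _).norm continuous_norm) fun x => ?_
  rw [parityHat_coe D, Completion.norm_coe, Completion.norm_coe, D.norm_parity]

variable {S : Hodge D} (h : S.ContinuousOps)

theorem opsHat_d (x : G) : (opsHat h).d x = (D.d x : G) := extendHat_coe h.d x

theorem opsHat_η (x : G) : (opsHat h).η x = (S.η x : G) := extendHat_coe h.η x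

theorem opsHat_br (x y : G) : (opsHat h).br x y = (D.br x y : G) :=
  complBilin_coe (LinearMap.mkContinuousOfExistsBound₂ D.br h.br) x y

theorem continuous_opsHat_d : Continuous (opsHat h).d := continuous_extendHat _

theorem continuous_opsHat_η : Continuous (opsHat h).η := continuous_extendHat _

theorem continuous_opsHat_br {X : Type*} [TopologicalSpace X] {f g : X → Completion G}
    (hf : Continuous f) (hg : Continuous g) : Continuous fun x => (opsHat h).br (f x) (g x) :=
  ((complBilin (LinearMap.mkContinuousOfExistsBound₂ D.br h.br)).continuous.comp hf).clm_apply hg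

theorem opsHat_isBounded : (opsHat h).IsBounded where
  d := ⟨_, (extendHatL D.d).le_opNorm⟩
  η := ⟨_, (extendHatL S.η).le_opNorm⟩
  br := ⟨_, (complBilin (LinearMap.mkContinuousOfExistsBound₂ D.br h.br)).le_opNorm₂⟩

theorem opsHat_isSuper : (opsHat h).IsSuper (extendHat (parity 𝒢)) := by
  have H := S.ops_isSuper
  have cσ := continuous_extendHat (𝕜 := 𝕜) (parity 𝒢)
  have cd := continuous_opsHat_d h
  have cη := continuous_opsHat_η h
  have c1 : Continuous fun p : Completion G × Completion G => p.1 := continuous_fst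
  have c2 : Continuous fun p : Completion G × Completion G => p.2 := continuous_snd
  have cb := fun {f g : Completion G × Completion G → Completion G} (hf : Continuous f)
    (hg : Continuous g) => continuous_opsHat_br h hf hg
  refine ⟨fun x => ?_, fun x => ?_, fun x => ?_, fun x y => ?_, fun x => ?_, fun x => ?_,
    fun x => ?_, fun x y => ?_, fun x y => ?_⟩
  · refine Completion.induction_on x (isClosed_eq (cσ.comp cσ) continuous_id) fun x => ?_
    rw [parityHat_coe D, parityHat_coe D, H.σ_σ]
  · refine Completion.induction_on x (isClosed_eq (cσ.comp cd) (cd.comp cσ).neg) fun x => ?_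
    rw [opsHat_d, parityHat_coe D, parityHat_coe D, opsHat_d, ← Completion.coe_neg]
    exact congrArg _ (H.σ_d x)
  · refine Completion.induction_on x (isClosed_eq (cσ.comp cη) (cη.comp cσ).neg) fun x => ?_
    rw [opsHat_η, parityHat_coe D, parityHat_coe D, opsHat_η, ← Completion.coe_neg]
    exact congrArg _ (H.σ_η x)
  · refine Completion.induction_on₂ x y (isClosed_eq (cσ.comp (cb c1 c2))
      (cb (cσ.comp c1) (cσ.comp c2))) fun x y => ?_
    rw [opsHat_br, parityHat_coe D, parityHat_coe D, parityHat_coe D, opsHat_br]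
    exact congrArg _ (H.σ_br x y)
  · refine Completion.induction_on x (isClosed_eq (cd.comp cd) continuous_const) fun x => ?_
    rw [opsHat_d, opsHat_d, D.d_d]
    exact Completion.coe_zero
  · refine Completion.induction_on x (isClosed_eq (cd.comp (cη.comp cd)) cd) fun x => ?_
    rw [opsHat_d, opsHat_η, opsHat_d, S.d_η_d]
  · refine Completion.induction_on x (isClosed_eq (cd.comp (cη.comp (cη.comp cd)))
      continuous_const) fun x => ?_
    rw [opsHat_d, opsHat_η, opsHat_η, opsHat_d, ← Completion.coe_zero]
    exact congrArg _ (H.d_η_η_d x)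
  · refine Completion.induction_on₂ x y (isClosed_eq (cd.comp (cb c1 c2))
      ((cb (cd.comp c1) c2).add (cb (cσ.comp c1) (cd.comp c2)))) fun x y => ?_
    rw [opsHat_br, opsHat_d, opsHat_d, opsHat_d, parityHat_coe D, opsHat_br, opsHat_br,
      ← Completion.coe_add]
    exact congrArg _ (H.leibniz x y)
  · refine Completion.induction_on₂ x y (isClosed_eq ((cb c1 c2).const_smul (2 : 𝕜))
      ((((cb c2 c1).add (cb (cσ.comp c2) c1)).add (cb c2 (cσ.comp c1))).sub
        (cb (cσ.comp c2) (cσ.comp c1))).neg) fun x y => ?_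
    rw [opsHat_br, parityHat_coe D, parityHat_coe D, opsHat_br, opsHat_br, opsHat_br, opsHat_br,
      ← Completion.coe_add, ← Completion.coe_add, ← Completion.coe_sub, ← Completion.coe_neg,
      ← Completion.coe_smul]
    exact congrArg _ (H.symm x y)

theorem opsHat_harm (x : G) : (opsHat h).harm x = (S.P x : G) := by
  rw [← S.ops_harm, Ops.harm, Ops.harm, opsHat_η, opsHat_d, opsHat_d, opsHat_η,
    ← Completion.coe_sub, ← Completion.coe_sub]
  rfl

theorem continuous_opsHat_harm : Continuous (opsHat h).harm :=
  (continuous_id.sub ((continuous_opsHat_d h).comp (continuous_opsHat_η h))).sub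
    ((continuous_opsHat_η h).comp (continuous_opsHat_d h))

/-- A finite-dimensional harmonic space is closed, so the harmonic projection of the closure of a
subspace `W` that it preserves has values in `W`. -/
theorem opsHat_harm_mem [FiniteDimensional 𝕜 S.harmonic] {W : Submodule 𝕜 G}
    (hW : ∀ x ∈ W, S.P x ∈ W) {x : Completion G} (hx : x ∈ (W.map (hatι G)).topologicalClosure) :
    ∃ y ∈ S.harmonic ⊓ W, (opsHat h).harm x = y := by
  have hfd : FiniteDimensional 𝕜 ↥(S.harmonic ⊓ W) := Submodule.finiteDimensional_inf_left _ _
  have hcl : IsClosed (((S.harmonic ⊓ W).map (hatι G) : Submodule 𝕜 (Completion G)) :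
    Set (Completion G)) := Submodule.closed_of_finiteDimensional _
  have h1 : (opsHat h).harm x ∈ (((S.harmonic ⊓ W).map (hatι G) : Submodule 𝕜 (Completion G)) :
      Set (Completion G)) := by
    rw [← hcl.closure_eq]
    refine map_mem_closure (continuous_opsHat_harm h) hx ?_
    rintro _ ⟨y, hy, rfl⟩
    exact ⟨S.P y, ⟨⟨y, rfl⟩, hW y hy⟩, (opsHat_harm h y).symm⟩
  obtain ⟨y, hy, e⟩ := h1
  exact ⟨y, hy, e.symm⟩

theorem opsHatT_harm_tmul (B : GradedArtin.{u, v} 𝕜) (x : Completion G) (b : B) :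
    (opsHatT h B).harm (x ⊗ₜ b) = (opsHat h).harm x ⊗ₜ b := by
  simp only [Ops.harm, TensorProduct.sub_tmul]
  rfl

theorem harmZ_eq [FiniteDimensional 𝕜 S.harmonic] (V : Set (Completion G))
    (B : GradedArtin.{u, v} 𝕜) :
    S.HarmZ V B = HarmonicPoints (opsHat h) (extendHat (parity 𝒢)) B V := by
  have key : ∀ x : Completion G ⊗[𝕜] B,
      x ∈ LinearMap.range (((Completion.toComplL : G →L[𝕜] Completion G).toLinearMap ∘ₗ
        S.harmonic.subtype).rTensor B) ↔ (opsHatT h B).harm x = x := fun x => by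
    refine ⟨?_, fun hx => ?_⟩
    · rintro ⟨t, rfl⟩
      induction t with
      | zero => exact map_zero (opsHatT h B).harmL
      | add s t hs ht =>
        rw [map_add]
        refine (map_add (opsHatT h B).harmL _ _).trans ?_
        rw [Ops.harmL_apply, Ops.harmL_apply, hs, ht]
      | tmul y b =>
        refine (opsHatT_harm_tmul h B _ b).trans ?_
        change (opsHat h).harm ((y : G) : Completion G) ⊗ₜ b = ((y : G) : Completion G) ⊗ₜ b
        rw [opsHat_harm, S.P_of_mem_harmonic y.2]
    · rw [← hx]
      clear hx
      change (opsHatT h B).harmL x ∈ _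
      induction x with
      | zero => simp
      | add s t hs ht => rw [map_add]; exact add_mem hs ht
      | tmul y b =>
        have hy : y ∈ ((⊤ : Submodule 𝕜 G).map (hatι G)).topologicalClosure :=
          closure_mono (by rintro _ ⟨z, rfl⟩; exact ⟨z, trivial, rfl⟩) (Completion.denseRange_coe y)
        obtain ⟨z, hz, e⟩ := opsHat_harm_mem h (W := ⊤) (fun _ _ => Submodule.mem_top) hy
        rw [Ops.harmL_apply, opsHatT_harm_tmul, e]
        exact ⟨(⟨z, hz.1⟩ : S.harmonic) ⊗ₜ b, rfl⟩
  ext x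
  exact and_congr_left' (key x)

/-! ### Points of degree one over the base point -/

variable (B : GradedArtin.{u, v} 𝕜)

theorem hatι_rTensor_d (t : G ⊗[𝕜] B) :
    (hatι G).rTensor B ((S.opsT B).d t) = (opsHatT h B).d ((hatι G).rTensor B t) := by
  induction t with
  | zero => simp
  | add s t hs ht => simp only [map_add, hs, ht]
  | tmul x b => exact congrArg (· ⊗ₜ[𝕜] b) (opsHat_d h x).symm

theorem hatι_rTensor_η (t : G ⊗[𝕜] B) :
    (hatι G).rTensor B ((S.opsT B).η t) = (opsHatT h B).η ((hatι G).rTensor B t) := by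
  induction t with
  | zero => simp
  | add s t hs ht => simp only [map_add, hs, ht]
  | tmul x b => exact congrArg (· ⊗ₜ[𝕜] b) (opsHat_η h x).symm

theorem hatι_rTensor_br (s t : G ⊗[𝕜] B) :
    (hatι G).rTensor B ((S.opsT B).br s t) =
      (opsHatT h B).br ((hatι G).rTensor B s) ((hatι G).rTensor B t) := by
  induction s with
  | zero => simp
  | add s s' hs hs' => simp only [map_add, LinearMap.add_apply, hs, hs']
  | tmul x a =>
    induction t with
    | zero => simp
    | add t t' ht ht' => simp only [map_add, ht, ht']
    | tmul y b =>
      simp only [opsT, opsHatT, Ops.tensor_br_tmul, LinearMap.rTensor_tmul, hatι_apply, map_add,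
        parityHat_coe D, ← Completion.coe_add, ← Completion.coe_sub, ← Completion.coe_smul,
        opsHat_br, ops_br]

theorem hatι_rTensor_parity (D : NormedDGLA 𝕜 𝒢) (t : G ⊗[𝕜] B) :
    (hatι G).rTensor B (TensorProduct.map (parity 𝒢) (parity B.gr) t) =
      TensorProduct.map (extendHat (parity 𝒢)) (parity B.gr) ((hatι G).rTensor B t) := by
  induction t with
  | zero => simp
  | add s t hs ht => simp only [map_add, hs, ht]
  | tmul x b =>
    simp only [TensorProduct.map_tmul, LinearMap.rTensor_tmul, hatι_apply, parityHat_coe D]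

/-- The closure of `𝔤ⁱ` in the completion. -/
noncomputable def closureDeg (𝒢 : ℤ → Submodule 𝕜 G) (i : ℤ) : Submodule 𝕜 (Completion G) :=
  ((𝒢 i).map (hatι G)).topologicalClosure

omit [DirectSum.Decomposition 𝒢] in
theorem coe_mem_closureDeg {i : ℤ} {x : G} (hx : x ∈ 𝒢 i) :
    (x : Completion G) ∈ closureDeg 𝒢 i :=
  subset_closure ⟨x, hx, rfl⟩

theorem parityHat_of_mem (D : NormedDGLA 𝕜 𝒢) {i : ℤ} {x : Completion G}
    (hx : x ∈ closureDeg 𝒢 i) :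
    extendHat (parity 𝒢) x = ((i.negOnePow : ℤˣ) : ℤ) • x := by
  have hcl : IsClosed {x : Completion G | extendHat (parity 𝒢) x = ((i.negOnePow : ℤˣ) : ℤ) • x} :=
    isClosed_eq (continuous_extendHat _) (continuous_const_smul _)
  refine closure_minimal ?_ hcl hx
  rintro _ ⟨y, hy, rfl⟩
  change extendHat (parity 𝒢) (y : Completion G) = ((i.negOnePow : ℤˣ) : ℤ) • (y : Completion G)
  rw [parityHat_coe D, parity_of_mem 𝒢 hy, Units.smul_def]
  exact map_zsmul (hatι (𝕜 := 𝕜) G) _ y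

theorem opsHat_η_mem {i : ℤ} {x : Completion G} (hx : x ∈ closureDeg 𝒢 i) :
    (opsHat h).η x ∈ closureDeg 𝒢 (i - 1) := by
  refine map_mem_closure (continuous_opsHat_η h) hx ?_
  rintro _ ⟨y, hy, rfl⟩
  exact ⟨S.η y, S.η_mem i y hy, (opsHat_η h y).symm⟩

theorem opsHat_br_mem {i j : ℤ} {x y : Completion G} (hx : x ∈ closureDeg 𝒢 i)
    (hy : y ∈ closureDeg 𝒢 j) : (opsHat h).br x y ∈ closureDeg 𝒢 (i + j) := by
  refine map_mem_closure₂ (f := fun x y => (opsHat h).br x y)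
    (continuous_opsHat_br h continuous_fst continuous_snd) hx hy ?_
  rintro _ ⟨x, hx, rfl⟩ _ ⟨y, hy, rfl⟩
  exact ⟨D.br x y, D.br_mem i j x hx y hy, (opsHat_br h x y).symm⟩

/-- The value of `κ` on a point of degree one of the completion is a harmonic point of `𝔤 ⊗ B`. -/
theorem exists_harmPts_eq_kappa [FiniteDimensional 𝕜 S.harmonic] {Γ : Completion G ⊗[𝕜] B}
    (hΓ : Γ ∈ S.degHat B) : ∃ t ∈ S.HarmPts B, (opsHatT h B).kappa Γ = (hatι G).rTensor B t := by
  have hkur : (opsHatT h B).kur Γ ∈ degOf (closureDeg 𝒢) B 1 :=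
    add_mem hΓ (Submodule.smul_mem _ _ (rTensor_mem_degOf (k := -1)
      (fun i a ha => opsHat_η_mem h ha) (n := 2) (by norm_num)
      (tensor_br_mem_degOf (fun i a => parityHat_of_mem D)
        (fun i j a ha b hb => opsHat_br_mem h ha hb) (by norm_num) hΓ hΓ)))
  have key : degOf (closureDeg 𝒢) B 1 ≤
      ((S.deg B 1 ⊓ LinearMap.eqLocus (S.opsT B).harmL LinearMap.id).map
        ((hatι G).rTensor B)).comap (opsHatT h B).harmL := by
    refine degOf_le fun i a ha b hb hb' => ?_
    obtain ⟨y, hy, e⟩ := opsHat_harm_mem h (S.P_mem i) ha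
    rw [Submodule.mem_comap, Ops.harmL_apply, opsHatT_harm_tmul, e]
    refine ⟨y ⊗ₜ b, ⟨tmul_mem_degOf (by omega) hy.2 hb hb', ?_⟩, rfl⟩
    change (S.opsT B).harm (y ⊗ₜ b) = y ⊗ₜ b
    rw [opsT_harm, LinearMap.rTensor_tmul, S.P_of_mem_harmonic hy.1]
  obtain ⟨t, ht, e⟩ := key hkur
  exact ⟨t, ht, e.symm⟩

/-- The moduli superspace: `κ` is an analytic isomorphism onto the harmonic points, and the points
of degree one over the base point are the Maurer–Cartan elements in the slice. -/
theorem exists_modZ_chart (S : Hodge D) (h : S.ContinuousOps) [FiniteDimensional 𝕜 S.harmonic] :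
    ∃ U V : Set (Completion G), IsOpen U ∧ 0 ∈ U ∧ IsOpen V ∧ 0 ∈ V ∧
      ∀ B : GradedArtin.{u, v} 𝕜,
        IsAnalyticChart 𝕜 (Hodge.opsHatT h B).kappa (Hodge.ModZ h U B) (S.HarmZ V B) ∧
        ((Completion.toComplL : G →L[𝕜] Completion G).toLinearMap.rTensor B) ''
            S.MDefC B (LinearMap.ker (D.d ∘ₗ S.η)) =
          {Γ | Γ ∈ Hodge.ModZ h U B ∧ Γ ∈ S.degHat B} := by
  obtain ⟨U, V, hU, h0U, hV, h0V, H⟩ := exists_sliceChart (opsHat_isBounded h) (opsHat_isSuper h)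
    (norm_parityHat D)
  refine ⟨U, V, hU, h0U, hV, h0V, fun B => ?_⟩
  obtain ⟨hchart, hMC⟩ := H B
  have hchart' : IsAnalyticChart 𝕜 (Hodge.opsHatT h B).kappa (Hodge.ModZ h U B) (S.HarmZ V B) := by
    rw [harmZ_eq h]
    exact hchart
  refine ⟨hchart', ?_⟩
  have hsub : ∀ Γ ∈ S.MDefC B (LinearMap.ker (D.d ∘ₗ S.η)),
      (hatι G).rTensor B Γ ∈ Hodge.ModZ h U B ∧ (hatι G).rTensor B Γ ∈ S.degHat B := by
    rintro Γ ⟨hΓ, t, ht⟩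
    obtain ⟨h1, h2⟩ := S.mem_MC_iff.mp hΓ
    have h3 : TensorProduct.map (extendHat (parity 𝒢)) (parity B.gr) ((hatι G).rTensor B Γ) =
        -(hatι G).rTensor B Γ := by
      rw [← hatι_rTensor_parity B D, S.odd_of_mem_deg h1, map_neg]
    have h4 : Hodge.body (Completion G) B ((hatι G).rTensor B Γ) ∈ U := by
      rwa [body_eq_zero_of_mem (rTensor_mem_tfil _ (degOf_le_tfil_one 1 h1))]
    have h5 : (opsHatT h B).d ((opsHatT h B).η ((hatι G).rTensor B Γ)) = 0 := by
      rw [← hatι_rTensor_η h, ← hatι_rTensor_d h]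
      suffices e : (S.opsT B).d ((S.opsT B).η Γ) = 0 by rw [e, map_zero]
      rw [← ht]
      clear ht
      induction t with
      | zero => simp
      | add s t hs ht => simp only [map_add, hs, ht, add_zero]
      | tmul x b =>
        change D.d (S.η x) ⊗ₜ[𝕜] (b : B) = 0
        have hx : D.d (S.η x) = 0 := x.2
        rw [hx, TensorProduct.zero_tmul]
    refine ⟨⟨h3, h4, h5, (hMC _ h3 h4).mpr ?_⟩, ?_⟩
    · change (opsHatT h B).d ((opsHatT h B).kur _) = 0
      rw [← Ops.map_kur (S.opsT B) (opsHatT h B) _ (hatι_rTensor_η h B) (hatι_rTensor_br h B),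
        ← hatι_rTensor_d h, h2, map_zero]
    · exact rTensor_mem_degOf (W' := closureDeg 𝒢) (k := 0)
        (fun i a ha => by rw [add_zero]; exact coe_mem_closureDeg ha) (add_zero 1) h1
  ext Γ
  constructor
  · rintro ⟨Γ, hΓ, rfl⟩
    exact hsub Γ hΓ
  · rintro ⟨hΓ, hdeg⟩
    obtain ⟨t, ht, e⟩ := exists_harmPts_eq_kappa h B hdeg
    obtain ⟨Γ', hΓ'⟩ := (S.bijective_kappa_mdefC S.isComplement_ker_d_η B).2 ⟨t, ht⟩
    have e' : (S.opsT B).kappa (Γ' : G ⊗[𝕜] B) = t := congrArg Subtype.val hΓ'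
    refine ⟨Γ', Γ'.2, hchart'.bijOn.injOn (hsub Γ' Γ'.2).1 hΓ ?_⟩
    rw [e, ← e']
    exact (Ops.map_kappa (S.opsT B) (opsHatT h B) _ (hatι_rTensor_d h B) (hatι_rTensor_η h B)
      (hatι_rTensor_br h B) _).symm

end Hodge

end Hat

/-! ### The direct sum of the completions of the `𝔤ⁱ` -/

section GrHat

variable {𝕜 : Type u} [RCLike 𝕜] {G : Type w} [NormedAddCommGroup G] [NormedSpace 𝕜 G]
  {𝒢 : ℤ → Submodule 𝕜 G}

namespace Hodge

/-- The inclusion of the completion of `𝔤ⁱ` in `⨁ᵢ ĝⁱ`. -/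
noncomputable def inDeg (𝒢 : ℤ → Submodule 𝕜 G) (i : ℤ) : Completion (𝒢 i) →ₗ[𝕜] GrHat 𝒢 :=
  DirectSum.lof 𝕜 ℤ (fun i => Completion (𝒢 i)) i

theorem inDeg_injective (i : ℤ) : Function.Injective (inDeg 𝒢 i) := DirectSum.of_injective i

theorem inDeg_apply_same (i : ℤ) (x : Completion (𝒢 i)) : inDeg 𝒢 i x i = x := by
  rw [inDeg, DirectSum.lof_apply]

/-- The parity involution of `⨁ᵢ ĝⁱ`. -/
noncomputable def parityGr (𝒢 : ℤ → Submodule 𝕜 G) : GrHat 𝒢 →ₗ[𝕜] GrHat 𝒢 :=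
  DirectSum.toModule 𝕜 ℤ _ fun i => ((i.negOnePow : ℤˣ) : ℤ) • inDeg 𝒢 i

theorem parityGr_inDeg (i : ℤ) (x : Completion (𝒢 i)) :
    parityGr 𝒢 (inDeg 𝒢 i x) = ((i.negOnePow : ℤˣ) : ℤ) • inDeg 𝒢 i x := by
  rw [parityGr, inDeg, DirectSum.toModule_lof]
  rfl

/-- A map to `⨁ᵢ ĝⁱ` that has values in degree `k` and is continuous. -/
def IsContinuousInDeg {X : Type*} [TopologicalSpace X] (k : ℤ) (φ : X → GrHat 𝒢) : Prop :=
  ∃ f : X → Completion (𝒢 k), Continuous f ∧ ∀ x, φ x = inDeg 𝒢 k (f x)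

namespace IsContinuousInDeg

variable {X : Type*} [TopologicalSpace X] {k m : ℤ} {φ ψ : X → GrHat 𝒢}

theorem inDeg {f : X → Completion (𝒢 k)} (hf : Continuous f) :
    IsContinuousInDeg k fun x => inDeg 𝒢 k (f x) := ⟨f, hf, fun _ => rfl⟩

theorem zero : IsContinuousInDeg k fun _ : X => (0 : GrHat 𝒢) :=
  ⟨fun _ => 0, continuous_const, fun _ => (map_zero _).symm⟩

theorem add (hφ : IsContinuousInDeg k φ) (hψ : IsContinuousInDeg k ψ) :
    IsContinuousInDeg k fun x => φ x + ψ x := by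
  obtain ⟨f, hf, h⟩ := hφ
  obtain ⟨g, hg, h'⟩ := hψ
  exact ⟨fun x => f x + g x, hf.add hg, fun x => by simp only [h, h', map_add]⟩

theorem neg (hφ : IsContinuousInDeg k φ) : IsContinuousInDeg k fun x => -φ x := by
  obtain ⟨f, hf, h⟩ := hφ
  exact ⟨fun x => -f x, hf.neg, fun x => by simp only [h, map_neg]⟩

theorem sub (hφ : IsContinuousInDeg k φ) (hψ : IsContinuousInDeg k ψ) :
    IsContinuousInDeg k fun x => φ x - ψ x := by
  obtain ⟨f, hf, h⟩ := hφ
  obtain ⟨g, hg, h'⟩ := hψ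
  exact ⟨fun x => f x - g x, hf.sub hg, fun x => by simp only [h, h', map_sub]⟩

theorem smul (c : 𝕜) (hφ : IsContinuousInDeg k φ) : IsContinuousInDeg k fun x => c • φ x := by
  obtain ⟨f, hf, h⟩ := hφ
  exact ⟨fun x => c • f x, hf.const_smul c, fun x => by simp only [h, map_smul]⟩

theorem parity (hφ : IsContinuousInDeg k φ) : IsContinuousInDeg k fun x => parityGr 𝒢 (φ x) := by
  obtain ⟨f, hf, h⟩ := hφ
  exact ⟨fun x => ((k.negOnePow : ℤˣ) : ℤ) • f x, hf.const_smul _, fun x => by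
    simp only [h, parityGr_inDeg, map_zsmul]⟩

/-- Continuous maps of the same degree that agree on a dense set agree. -/
theorem eq_of_denseRange (hφ : IsContinuousInDeg k φ) (hψ : IsContinuousInDeg k ψ) {Y : Type*}
    {e : Y → X} (he : DenseRange e) (h : ∀ y, φ (e y) = ψ (e y)) (x : X) : φ x = ψ x := by
  obtain ⟨f, hf, h1⟩ := hφ
  obtain ⟨g, hg, h2⟩ := hψ
  rw [h1, h2]
  refine congrArg _ (congrFun (he.equalizer hf hg (funext fun y => ?_)) x)
  have := h y
  rw [h1, h2] at this
  exact inDeg_injective k this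

end IsContinuousInDeg

variable [DirectSum.Decomposition 𝒢] {D : NormedDGLA 𝕜 𝒢} (S : Hodge D)

theorem opsGr_d_inDeg (i : ℤ) (x : Completion (𝒢 i)) :
    S.opsGr.d (inDeg 𝒢 i x) = inDeg 𝒢 (i + 1) ((S.dDeg i).completion x) := by
  simp only [opsGr, inDeg]
  rw [DirectSum.toModule_lof]
  rfl

theorem opsGr_η_inDeg (i : ℤ) (x : Completion (𝒢 i)) :
    S.opsGr.η (inDeg 𝒢 i x) = inDeg 𝒢 (i - 1) ((S.ηDeg i).completion x) := by
  simp only [opsGr, inDeg]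
  rw [DirectSum.toModule_lof]
  rfl

theorem opsGr_br_inDeg (i j : ℤ) (x : Completion (𝒢 i)) (y : Completion (𝒢 j)) :
    S.opsGr.br (inDeg 𝒢 i x) (inDeg 𝒢 j y) =
      inDeg 𝒢 (i + j) (complBilin (S.brDeg i j) x y) := by
  simp only [opsGr, inDeg]
  rw [DirectSum.toModule_lof, LinearMap.flip_apply, DirectSum.toModule_lof]
  rfl

section Continuity

variable {X : Type*} [TopologicalSpace X] {k l m : ℤ} {φ ψ : X → GrHat 𝒢}

theorem continuousInDeg_d (hm : k + 1 = m) (hφ : IsContinuousInDeg k φ) :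
    IsContinuousInDeg m fun x => S.opsGr.d (φ x) := by
  subst hm
  obtain ⟨f, hf, h⟩ := hφ
  exact ⟨fun x => (S.dDeg k).completion (f x), (S.dDeg k).completion.continuous.comp hf,
    fun x => by simp only [h, opsGr_d_inDeg]⟩

theorem continuousInDeg_η (hm : k - 1 = m) (hφ : IsContinuousInDeg k φ) :
    IsContinuousInDeg m fun x => S.opsGr.η (φ x) := by
  subst hm
  obtain ⟨f, hf, h⟩ := hφ
  exact ⟨fun x => (S.ηDeg k).completion (f x), (S.ηDeg k).completion.continuous.comp hf,
    fun x => by simp only [h, opsGr_η_inDeg]⟩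

theorem continuousInDeg_br (hm : k + l = m) (hφ : IsContinuousInDeg k φ)
    (hψ : IsContinuousInDeg l ψ) : IsContinuousInDeg m fun x => S.opsGr.br (φ x) (ψ x) := by
  subst hm
  obtain ⟨f, hf, h⟩ := hφ
  obtain ⟨g, hg, h'⟩ := hψ
  exact ⟨fun x => complBilin (S.brDeg k l) (f x) (g x),
    ((complBilin (S.brDeg k l)).continuous.comp hf).clm_apply hg, fun x => by
      simp only [h, h', opsGr_br_inDeg]⟩

end Continuity

/-- The map `𝔤 → ⨁ᵢ ĝⁱ`. -/
noncomputable def toGr (𝒢 : ℤ → Submodule 𝕜 G) [DirectSum.Decomposition 𝒢] : G →ₗ[𝕜] GrHat 𝒢 :=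
  DirectSum.toModule 𝕜 ℤ _ (fun i => inDeg 𝒢 i ∘ₗ hatι (𝒢 i)) ∘ₗ
    (DirectSum.decomposeLinearEquiv 𝒢).toLinearMap

theorem toGr_coe (i : ℤ) (x : 𝒢 i) : toGr 𝒢 (x : G) = inDeg 𝒢 i (x : Completion (𝒢 i)) := by
  rw [toGr, LinearMap.comp_apply]
  simp only [LinearEquiv.coe_coe, DirectSum.decomposeLinearEquiv_apply, DirectSum.decompose_coe]
  exact DirectSum.toModule_lof 𝕜 (M := fun i => 𝒢 i) i x

theorem toGr_d (x : G) : toGr 𝒢 (D.d x) = S.opsGr.d (toGr 𝒢 x) := by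
  induction x using DirectSum.Decomposition.inductionOn 𝒢 with
  | zero => simp
  | @homogeneous i m =>
    rw [toGr_coe, opsGr_d_inDeg]
    have : (S.dDeg i).completion (m : Completion (𝒢 i)) = (S.dDeg i m : Completion (𝒢 (i + 1))) :=
      ContinuousLinearMap.completion_apply_coe _ _
    rw [this, ← toGr_coe]
    rfl
  | add x y hx hy => simp only [map_add, hx, hy]

theorem toGr_η (x : G) : toGr 𝒢 (S.η x) = S.opsGr.η (toGr 𝒢 x) := by
  induction x using DirectSum.Decomposition.inductionOn 𝒢 with
  | zero => simp
  | @homogeneous i m =>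
    rw [toGr_coe, opsGr_η_inDeg]
    have : (S.ηDeg i).completion (m : Completion (𝒢 i)) = (S.ηDeg i m : Completion (𝒢 (i - 1))) :=
      ContinuousLinearMap.completion_apply_coe _ _
    rw [this, ← toGr_coe]
    rfl
  | add x y hx hy => simp only [map_add, hx, hy]

theorem toGr_br (x y : G) : toGr 𝒢 (D.br x y) = S.opsGr.br (toGr 𝒢 x) (toGr 𝒢 y) := by
  refine decomposition_induction₂ 𝒢 (p := fun x y => toGr 𝒢 (D.br x y) =
    S.opsGr.br (toGr 𝒢 x) (toGr 𝒢 y)) (fun x y z h h' => ?_) (fun x y z h h' => ?_)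
    (fun i j x hx y hy => ?_) x y
  · simp only [map_add, LinearMap.add_apply, h, h']
  · simp only [map_add, h, h']
  · lift x to 𝒢 i using hx
    lift y to 𝒢 j using hy
    rw [toGr_coe, toGr_coe, opsGr_br_inDeg, complBilin_coe, ← toGr_coe]
    rfl

theorem toGr_parity (x : G) : toGr 𝒢 (parity 𝒢 x) = parityGr 𝒢 (toGr 𝒢 x) := by
  induction x using DirectSum.Decomposition.inductionOn 𝒢 with
  | zero => simp
  | @homogeneous i m =>
    rw [parity_of_mem 𝒢 m.2, Units.smul_def, map_zsmul, toGr_coe, parityGr_inDeg]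
  | add x y hx hy => simp only [map_add, hx, hy]

/-- Two linear maps of degree `k` of `⨁ᵢ ĝⁱ` that are continuous in each degree agree if they
agree on `𝔤`. -/
theorem grHat_ext {E F : GrHat 𝒢 →ₗ[𝕜] GrHat 𝒢} (k : ℤ)
    (hE : ∀ i, IsContinuousInDeg (i + k) fun x => E (inDeg 𝒢 i x))
    (hF : ∀ i, IsContinuousInDeg (i + k) fun x => F (inDeg 𝒢 i x))
    (h : ∀ x, E (toGr 𝒢 x) = F (toGr 𝒢 x)) (x : GrHat 𝒢) : E x = F x := by
  induction x using DirectSum.induction_on with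
  | zero => rw [map_zero, map_zero]
  | of i x =>
    refine (hE i).eq_of_denseRange (hF i) Completion.denseRange_coe (fun y => ?_) x
    rw [← toGr_coe, h]
  | add x y hx hy => rw [map_add, map_add, hx, hy]

theorem grHat_ext₂ {E F : GrHat 𝒢 →ₗ[𝕜] GrHat 𝒢 →ₗ[𝕜] GrHat 𝒢} (k : ℤ)
    (hE : ∀ i j, IsContinuousInDeg (i + j + k)
      fun p : Completion (𝒢 i) × Completion (𝒢 j) => E (inDeg 𝒢 i p.1) (inDeg 𝒢 j p.2))
    (hF : ∀ i j, IsContinuousInDeg (i + j + k)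
      fun p : Completion (𝒢 i) × Completion (𝒢 j) => F (inDeg 𝒢 i p.1) (inDeg 𝒢 j p.2))
    (h : ∀ x y, E (toGr 𝒢 x) (toGr 𝒢 y) = F (toGr 𝒢 x) (toGr 𝒢 y)) (x y : GrHat 𝒢) :
    E x y = F x y := by
  induction x using DirectSum.induction_on with
  | zero => simp only [map_zero, LinearMap.zero_apply]
  | add x z hx hz => simp only [map_add, LinearMap.add_apply, hx, hz]
  | of i x =>
    induction y using DirectSum.induction_on with
    | zero => simp only [map_zero]
    | add y z hy hz => simp only [map_add, hy, hz]
    | of j y =>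
      refine (hE i j).eq_of_denseRange (hF i j)
        (Completion.denseRange_coe.prodMap Completion.denseRange_coe) (fun p => ?_) (x, y)
      simp only [Prod.map_fst, Prod.map_snd]
      rw [← toGr_coe, ← toGr_coe, h]

theorem opsGr_isSuper : S.opsGr.IsSuper (parityGr 𝒢) := by
  have H := S.ops_isSuper
  set o := S.opsGr with ho
  have c : ∀ i, IsContinuousInDeg i fun x => inDeg 𝒢 i x := fun i =>
    IsContinuousInDeg.inDeg continuous_id
  have c1 : ∀ i j, IsContinuousInDeg i
      fun p : Completion (𝒢 i) × Completion (𝒢 j) => inDeg 𝒢 i p.1 := fun i j =>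
    IsContinuousInDeg.inDeg continuous_fst
  have c2 : ∀ i j, IsContinuousInDeg j
      fun p : Completion (𝒢 i) × Completion (𝒢 j) => inDeg 𝒢 j p.2 := fun i j =>
    IsContinuousInDeg.inDeg continuous_snd
  refine ⟨grHat_ext (E := parityGr 𝒢 ∘ₗ parityGr 𝒢) (F := LinearMap.id) 0 (fun i => ?_)
      (fun i => ?_) fun x => ?_,
    grHat_ext (E := parityGr 𝒢 ∘ₗ o.d) (F := -(o.d ∘ₗ parityGr 𝒢)) 1 (fun i => ?_)
      (fun i => ?_) fun x => ?_,
    grHat_ext (E := parityGr 𝒢 ∘ₗ o.η) (F := -(o.η ∘ₗ parityGr 𝒢)) (-1) (fun i => ?_)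
      (fun i => ?_) fun x => ?_,
    grHat_ext₂ (E := o.br.compr₂ (parityGr 𝒢)) (F := o.br.compl₁₂ (parityGr 𝒢) (parityGr 𝒢)) 0
      (fun i j => ?_) (fun i j => ?_) fun x y => ?_,
    grHat_ext (E := o.d ∘ₗ o.d) (F := 0) 2 (fun i => ?_) (fun i => ?_) fun x => ?_,
    grHat_ext (E := o.d ∘ₗ o.η ∘ₗ o.d) (F := o.d) 1 (fun i => ?_) (fun i => ?_) fun x => ?_,
    grHat_ext (E := o.d ∘ₗ o.η ∘ₗ o.η ∘ₗ o.d) (F := 0) 0 (fun i => ?_) (fun i => ?_) fun x => ?_,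
    grHat_ext₂ (E := o.br.compr₂ o.d) (F := o.br ∘ₗ o.d + o.br.compl₁₂ (parityGr 𝒢) o.d) 1
      (fun i j => ?_) (fun i j => ?_) fun x y => ?_,
    grHat_ext₂ (E := (2 : 𝕜) • o.br)
      (F := -(o.br.flip + (o.br ∘ₗ parityGr 𝒢).flip + o.br.flip ∘ₗ parityGr 𝒢 -
        (o.br.compl₁₂ (parityGr 𝒢) (parityGr 𝒢)).flip)) 0
      (fun i j => ?_) (fun i j => ?_) fun x y => ?_⟩
  · rw [add_zero]; exact (c i).parity.parity
  · rw [add_zero]; exact c i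
  · simp only [LinearMap.comp_apply, LinearMap.id_apply, ← toGr_parity, H.σ_σ]
  · exact (S.continuousInDeg_d rfl (c i)).parity
  · exact (S.continuousInDeg_d rfl (c i).parity).neg
  · simp only [LinearMap.comp_apply, LinearMap.neg_apply, ho, ← toGr_d, ← toGr_parity]
    rw [← map_neg]
    exact congrArg _ (H.σ_d x)
  · exact (S.continuousInDeg_η rfl (c i)).parity
  · exact (S.continuousInDeg_η rfl (c i).parity).neg
  · simp only [LinearMap.comp_apply, LinearMap.neg_apply, ho, ← toGr_η, ← toGr_parity]
    rw [← map_neg]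
    exact congrArg _ (H.σ_η x)
  · exact (S.continuousInDeg_br (add_zero _).symm (c1 i j) (c2 i j)).parity
  · exact S.continuousInDeg_br (add_zero _).symm (c1 i j).parity (c2 i j).parity
  · simp only [LinearMap.compr₂_apply, LinearMap.compl₁₂_apply, ho, ← toGr_br, ← toGr_parity]
    exact congrArg _ (H.σ_br x y)
  · exact S.continuousInDeg_d (by ring) (S.continuousInDeg_d rfl (c i))
  · exact IsContinuousInDeg.zero
  · simp only [LinearMap.comp_apply, LinearMap.zero_apply, ho, ← toGr_d, D.d_d, map_zero]
  · exact S.continuousInDeg_d (by ring) (S.continuousInDeg_η rfl (S.continuousInDeg_d rfl (c i)))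
  · exact S.continuousInDeg_d rfl (c i)
  · simp only [LinearMap.comp_apply, ho, ← toGr_d, ← toGr_η, S.d_η_d]
  · exact S.continuousInDeg_d (by ring)
      (S.continuousInDeg_η rfl (S.continuousInDeg_η rfl (S.continuousInDeg_d rfl (c i))))
  · exact IsContinuousInDeg.zero
  · simp only [LinearMap.comp_apply, LinearMap.zero_apply, ho, ← toGr_d, ← toGr_η]
    rw [← map_zero (toGr 𝒢)]
    exact congrArg _ (H.d_η_η_d x)
  · exact S.continuousInDeg_d rfl (S.continuousInDeg_br rfl (c1 i j) (c2 i j))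
  · exact (S.continuousInDeg_br (by ring) (S.continuousInDeg_d rfl (c1 i j)) (c2 i j)).add
      (S.continuousInDeg_br (by ring) (c1 i j).parity (S.continuousInDeg_d rfl (c2 i j)))
  · simp only [LinearMap.compr₂_apply, LinearMap.compl₁₂_apply, LinearMap.add_apply,
      LinearMap.comp_apply, ho, ← toGr_br, ← toGr_parity, ← toGr_d]
    rw [← map_add]
    exact congrArg _ (H.leibniz x y)
  · exact (S.continuousInDeg_br (by ring) (c1 i j) (c2 i j)).smul 2
  · exact ((((S.continuousInDeg_br (by ring) (c2 i j) (c1 i j)).add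
      (S.continuousInDeg_br (by ring) (c2 i j).parity (c1 i j))).add
      (S.continuousInDeg_br (by ring) (c2 i j) (c1 i j).parity)).sub
      (S.continuousInDeg_br (by ring) (c2 i j).parity (c1 i j).parity)).neg
  · simp only [LinearMap.compl₁₂_apply, LinearMap.add_apply, LinearMap.sub_apply,
      LinearMap.neg_apply, LinearMap.smul_apply, LinearMap.flip_apply,
      LinearMap.comp_apply, ho, ← toGr_br, ← toGr_parity]
    rw [← map_add, ← map_add, ← map_sub, ← map_neg, ← map_smul]
    exact congrArg _ (H.symm x y)

end Hodge

end GrHat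

/-! ### The moduli space in degree one -/

section DegreeOne

variable {𝕜 : Type u} [RCLike 𝕜] {G : Type w} [NormedAddCommGroup G] [NormedSpace 𝕜 G]
  {𝒢 : ℤ → Submodule 𝕜 G} [DirectSum.Decomposition 𝒢] {D : NormedDGLA 𝕜 𝒢} (S : Hodge D)

namespace Hodge

/-- The bracket `ĝ¹ × ĝ¹ → ĝ²`. -/
noncomputable def br₁₁ : Completion (𝒢 1) →L[𝕜] Completion (𝒢 1) →L[𝕜] Completion (𝒢 2) :=
  complBilin (S.brDeg 1 1)

/-- The homotopy `ĝ² → ĝ¹`. -/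
noncomputable def η₂ : Completion (𝒢 2) →L[𝕜] Completion (𝒢 1) := (S.ηDeg 2).completion

/-- The homotopy `ĝ¹ → ĝ⁰`. -/
noncomputable def η₁ : Completion (𝒢 1) →L[𝕜] Completion (𝒢 0) := (S.ηDeg 1).completion

/-- The differential `ĝ⁰ → ĝ¹`. -/
noncomputable def d₀ : Completion (𝒢 0) →L[𝕜] Completion (𝒢 1) := (S.dDeg 0).completion

/-- The differential `ĝ¹ → ĝ²`. -/
noncomputable def d₁ : Completion (𝒢 1) →L[𝕜] Completion (𝒢 2) := (S.dDeg 1).completion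

/-- The operator `x ↦ η[x, Γ]` of `ĝ²` for `Γ ∈ ĝ¹`. -/
noncomputable def adOne : Completion (𝒢 1) →L[𝕜] Completion (𝒢 2) →L[𝕜] Completion (𝒢 2) :=
  ((ContinuousLinearMap.compL 𝕜 (Completion (𝒢 2)) (Completion (𝒢 3)) (Completion (𝒢 2))
    (S.ηDeg 3).completion)).comp
    (complBilin (S.brDeg 2 1) :
      Completion (𝒢 2) →L[𝕜] Completion (𝒢 1) →L[𝕜] Completion (𝒢 3)).flip

/-- The quadratic map of the slice on `ĝ¹`. -/
noncomputable def sliceOne : Completion (𝒢 1) →L[𝕜] Completion (𝒢 1) →L[𝕜] Completion (𝒢 1) :=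
  (ContinuousLinearMap.compL 𝕜 (Completion (𝒢 1)) (Completion (𝒢 2)) (Completion (𝒢 1))
    ((2⁻¹ : 𝕜) • (S.η₂ - S.d₀ ∘SL S.η₁ ∘SL S.η₂))).comp S.br₁₁

/-- The harmonic projection of `ĝ¹`. -/
noncomputable def harmOne : Completion (𝒢 1) →L[𝕜] Completion (𝒢 1) :=
  ContinuousLinearMap.id 𝕜 _ - S.d₀ ∘SL S.η₁ - S.η₂ ∘SL S.d₁

omit [DirectSum.Decomposition 𝒢] in
theorem inOne_eq (x : Completion (𝒢 1)) : inOne x = inDeg 𝒢 1 x := rfl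

theorem opsGr_br_inOne (x y : Completion (𝒢 1)) :
    S.opsGr.br (inDeg 𝒢 1 x) (inDeg 𝒢 1 y) = inDeg 𝒢 2 (S.br₁₁ x y) := S.opsGr_br_inDeg 1 1 x y

theorem opsGr_η_inTwo (x : Completion (𝒢 2)) :
    S.opsGr.η (inDeg 𝒢 2 x) = inDeg 𝒢 1 (S.η₂ x) := S.opsGr_η_inDeg 2 x

theorem opsGr_η_inOne (x : Completion (𝒢 1)) :
    S.opsGr.η (inDeg 𝒢 1 x) = inDeg 𝒢 0 (S.η₁ x) := S.opsGr_η_inDeg 1 x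

theorem opsGr_d_inZero (x : Completion (𝒢 0)) :
    S.opsGr.d (inDeg 𝒢 0 x) = inDeg 𝒢 1 (S.d₀ x) := S.opsGr_d_inDeg 0 x

theorem opsGr_d_inOne (x : Completion (𝒢 1)) :
    S.opsGr.d (inDeg 𝒢 1 x) = inDeg 𝒢 2 (S.d₁ x) := S.opsGr_d_inDeg 1 x

theorem opsGr_ad_inTwo (x : Completion (𝒢 2)) (Γ : Completion (𝒢 1)) :
    S.opsGr.η (S.opsGr.br (inDeg 𝒢 2 x) (inDeg 𝒢 1 Γ)) = inDeg 𝒢 2 (S.adOne Γ x) := by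
  rw [opsGr_br_inDeg]
  exact S.opsGr_η_inDeg 3 _

theorem opsGr_sliceQ_inOne (x y : Completion (𝒢 1)) :
    S.opsGr.sliceQ (inDeg 𝒢 1 x) (inDeg 𝒢 1 y) = inDeg 𝒢 1 (S.sliceOne x y) := by
  rw [Ops.sliceQ_apply, opsGr_br_inOne, opsGr_η_inTwo, opsGr_η_inOne, opsGr_d_inZero, ← map_sub,
    ← map_smul]
  rfl

theorem opsGr_harm_inOne (x : Completion (𝒢 1)) :
    S.opsGr.harm (inDeg 𝒢 1 x) = inDeg 𝒢 1 (S.harmOne x) := by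
  rw [Ops.harm, opsGr_η_inOne, opsGr_d_inZero, opsGr_d_inOne, opsGr_η_inTwo, ← map_sub, ← map_sub]
  rfl

theorem opsGr_kur_inOne (x : Completion (𝒢 1)) :
    S.opsGr.kur (inDeg 𝒢 1 x) =
      inDeg 𝒢 1 (x + (2⁻¹ : 𝕜) • S.η₂ (S.br₁₁ x x)) := by
  rw [Ops.kur, opsGr_br_inOne, opsGr_η_inTwo, ← map_smul, ← map_add]

theorem kappa0_eq (x : Completion (𝒢 1)) :
    S.kappa0 x = S.harmOne (x + (2⁻¹ : 𝕜) • S.η₂ (S.br₁₁ x x)) := by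
  rw [kappa0, Ops.kappa, inOne_eq, opsGr_kur_inOne, opsGr_harm_inOne, inDeg_apply_same]

theorem opsGr_kappa_inOne (x : Completion (𝒢 1)) :
    S.opsGr.kappa (inDeg 𝒢 1 x) = inDeg 𝒢 1 (S.kappa0 x) := by
  rw [Ops.kappa, kappa0_eq, opsGr_kur_inOne, opsGr_harm_inOne]

theorem analyticAt_kappa0 (x : Completion (𝒢 1)) : AnalyticAt 𝕜 S.kappa0 x := by
  have h := (S.harmOne.analyticAt _).comp (analyticAt_quadratic ((ContinuousLinearMap.compL 𝕜
    (Completion (𝒢 1)) (Completion (𝒢 2)) (Completion (𝒢 1)) ((2⁻¹ : 𝕜) • S.η₂)).comp S.br₁₁) x)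
  refine h.congr (Eventually.of_forall fun y => ?_)
  rw [kappa0_eq]
  rfl

omit [DirectSum.Decomposition 𝒢] in
theorem parityGr_inOne (x : Completion (𝒢 1)) : parityGr 𝒢 (inDeg 𝒢 1 x) = -inDeg 𝒢 1 x := by
  rw [parityGr_inDeg]
  simp

/-- The terms of the Maurer–Cartan series have degree two. -/
theorem mcTerm_inOne (Γ : Completion (𝒢 1)) (k : ℕ) :
    S.opsGr.mcTerm (inDeg 𝒢 1 Γ) k = inDeg 𝒢 2 (S.opsGr.mcTerm (inDeg 𝒢 1 Γ) k 2) := by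
  suffices h : ∃ y, S.opsGr.mcTerm (inDeg 𝒢 1 Γ) k = inDeg 𝒢 2 y by
    obtain ⟨y, hy⟩ := h
    rw [hy, inDeg_apply_same]
  have h2 : ∀ n, ∃ y, S.opsGr.mcTerm (inDeg 𝒢 1 Γ) (n + 2) = inDeg 𝒢 2 y := fun n => by
    induction n with
    | zero =>
      have h3 : ∀ y : Completion (𝒢 2), ∃ z, S.opsGr.η (S.opsGr.d (inDeg 𝒢 2 y)) = inDeg 𝒢 2 z :=
        fun y => ⟨_, by rw [opsGr_d_inDeg]; exact S.opsGr_η_inDeg 3 _⟩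
      obtain ⟨z, hz⟩ := h3 (S.br₁₁ Γ Γ)
      refine ⟨-((2⁻¹ : 𝕜) • (S.d₁ (S.η₂ (S.br₁₁ Γ Γ)) + z)), ?_⟩
      rw [Ops.mcTerm_two, opsGr_br_inOne, hz, opsGr_η_inTwo, opsGr_d_inOne]
      simp only [map_neg, map_smul, map_add, neg_smul]
    | succ n ih =>
      obtain ⟨y, hy⟩ := ih
      exact ⟨S.adOne Γ y, by rw [Ops.mcTerm_succ, hy, opsGr_ad_inTwo]⟩
  match k with
  | 0 => exact ⟨0, by rw [Ops.mcTerm_zero, map_zero]⟩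
  | 1 => exact ⟨-S.d₁ Γ, by rw [Ops.mcTerm_one, opsGr_d_inOne, map_neg]⟩
  | n + 2 => exact h2 n

set_option maxSynthPendingDepth 3 in
theorem hasSum_mcTerm_inOne_iff {r : ℝ} (hr : ‖S.adOne‖ * r < 1) {Γ : Completion (𝒢 1)}
    (hΓ : ‖Γ‖ ≤ r) : HasSum (fun k => S.opsGr.mcTerm (inDeg 𝒢 1 Γ) k 2) 0 ↔
      S.opsGr.d (S.opsGr.kur (inDeg 𝒢 1 Γ)) = 0 := by
  set t : ℕ → Completion (𝒢 2) := fun k => S.opsGr.mcTerm (inDeg 𝒢 1 Γ) k 2 with ht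
  have htk : ∀ k, S.opsGr.mcTerm (inDeg 𝒢 1 Γ) k = inDeg 𝒢 2 (t k) := S.mcTerm_inOne Γ
  obtain ⟨e, he⟩ : ∃ e, S.opsGr.d (S.opsGr.kur (inDeg 𝒢 1 Γ)) = inDeg 𝒢 2 e :=
    ⟨_, by rw [opsGr_kur_inOne, opsGr_d_inOne]⟩
  have hP : ∀ n, ∑ k ∈ Finset.range (n + 3), t k -
      S.adOne Γ (∑ k ∈ Finset.range (n + 2), t k) = -e := fun n => by
    have h := S.opsGr_isSuper.sum_mcTerm (parityGr_inOne Γ) n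
    simp only [htk] at h
    rw [← map_sum, ← map_sum, opsGr_ad_inTwo, he, ← map_sub, ← map_neg] at h
    exact inDeg_injective 2 h
  rw [he]
  constructor
  · intro h
    have := eq_zero_of_hasSum_zero (S.adOne Γ).continuous (map_zero _) hP h
    rw [neg_eq_zero.mp this, map_zero]
  · intro h
    rw [← map_zero (inDeg 𝒢 2)] at h
    rw [inDeg_injective 2 h, neg_zero] at hP
    have hc : ‖S.adOne Γ‖ < 1 :=
      ((S.adOne.le_opNorm Γ).trans (mul_le_mul_of_nonneg_left hΓ (norm_nonneg _))).trans_lt hr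
    have hsum : ∀ x, Summable fun k => ‖(S.adOne Γ)^[k] x‖ := fun x => by
      refine Summable.of_nonneg_of_le (fun _ => norm_nonneg _) (fun k => ?_)
        ((summable_geometric_of_lt_one (norm_nonneg _) hc).mul_right ‖x‖)
      induction k with
      | zero => simp
      | succ k ih =>
        rw [Function.iterate_succ_apply', pow_succ', mul_assoc]
        exact ((S.adOne Γ).le_opNorm _).trans (mul_le_mul_of_nonneg_left ih (norm_nonneg _))
    refine hasSum_zero_of_geometric hP (fun k => ?_) (hsum _) (hsum _)
    have h3 := S.opsGr.mcTerm_succ (inDeg 𝒢 1 Γ) k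
    rw [htk, htk, opsGr_ad_inTwo] at h3
    exact inDeg_injective 2 h3

theorem harmOne_coe (y : 𝒢 1) :
    S.harmOne (y : Completion (𝒢 1)) = ((⟨S.P y, S.P_mem 1 y y.2⟩ : 𝒢 1) : Completion (𝒢 1)) := by
  apply inDeg_injective 1
  rw [← opsGr_harm_inOne, ← toGr_coe, ← toGr_coe]
  refine (Ops.map_harm S.ops S.opsGr (toGr 𝒢) S.toGr_d S.toGr_η _).symm.trans ?_
  rw [S.ops_harm]

theorem harm0_eq [FiniteDimensional 𝕜 ↥(S.harmonic ⊓ 𝒢 1)] (V : Set (Completion (𝒢 1))) :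
    S.Harm0 V = {x | x ∈ V ∧ S.harmOne x = x} := by
  ext x
  refine and_congr_right fun _ => ⟨?_, fun hx => ?_⟩
  · rintro ⟨y, hy, rfl⟩
    rw [harmOne_coe]
    congr 2
    exact S.P_of_mem_harmonic hy
  · set W : Submodule 𝕜 (𝒢 1) := (S.harmonic ⊓ 𝒢 1).comap (𝒢 1).subtype with hW
    have hfd : FiniteDimensional 𝕜 W :=
      Module.Finite.equiv (Submodule.comapSubtypeEquivOfLe inf_le_right).symm
    have hcl : IsClosed ((W.map (hatι (𝒢 1)) : Submodule 𝕜 (Completion (𝒢 1))) :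
      Set (Completion (𝒢 1))) := Submodule.closed_of_finiteDimensional _
    have hmem : S.harmOne x ∈ ((W.map (hatι (𝒢 1)) : Submodule 𝕜 (Completion (𝒢 1))) :
        Set (Completion (𝒢 1))) := by
      refine Completion.induction_on x (hcl.preimage S.harmOne.continuous) fun y => ?_
      rw [harmOne_coe]
      exact ⟨_, ⟨⟨y, rfl⟩, S.P_mem 1 y y.2⟩, rfl⟩
    rw [hx] at hmem
    obtain ⟨y, hy, rfl⟩ := hmem
    exact ⟨y, hy.1, rfl⟩

set_option maxSynthPendingDepth 3 in
/-- The moduli space in degree one: `κ` is an analytic isomorphism of the small solutions in the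
slice onto the small harmonic elements of degree one. -/
theorem exists_mod0_chart [FiniteDimensional 𝕜 ↥(S.harmonic ⊓ 𝒢 1)] :
    ∃ U V : Set (Completion (𝒢 1)), IsOpen U ∧ 0 ∈ U ∧ IsOpen V ∧ 0 ∈ V ∧
      IsAnalyticChart 𝕜 S.kappa0 (S.Mod0 U) (S.Harm0 V) := by
  set r : ℝ := 1 / (‖S.adOne‖ + 1) with hr
  have hden : 0 < ‖S.adOne‖ + 1 := by positivity
  have hr0 : 0 < r := by positivity
  have hr1 : ‖S.adOne‖ * r < 1 := by
    rw [hr, mul_one_div, div_lt_one hden]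
    linarith
  obtain ⟨U, V, ψ, hUo, h0U, hVo, h0V, hUr, hUV, hVU, hψ⟩ := exists_quadratic_inverse S.sliceOne hr0
  refine ⟨U, V, hUo, h0U, hVo, h0V, ?_⟩
  have H := S.opsGr_isSuper
  have hMC : ∀ Γ ∈ U, (HasSum (fun k => S.opsGr.mcTerm (inOne Γ) k 2) 0 ↔
      S.opsGr.d (S.opsGr.kur (inDeg 𝒢 1 Γ)) = 0) := fun Γ hΓ =>
    S.hasSum_mcTerm_inOne_iff hr1 (hUr Γ hΓ).le
  rw [harm0_eq]
  have hκ0 : S.kappa0 0 = 0 := by simp [kappa0_eq]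
  refine isAnalyticChart_of_quadratic (ψ := ψ) S.sliceOne ⟨h0U, by simp [inOne_eq], ?_⟩
    ⟨h0V, map_zero _⟩ hκ0 (fun x _ => S.analyticAt_kappa0 x) (fun Γ hΓ => ?_) (fun h hh => ?_)
    (hψ.analyticOn.mono fun x hx => hx.1) fun y hy => (hVU y hy.1).2
  · rw [hMC 0 h0U]
    simp [Ops.kur]
  · obtain ⟨h1, h2, h3⟩ := hΓ
    rw [hMC Γ h1] at h3
    have h4 := S.opsGr.slice_eq_kappa h2 h3
    rw [inOne_eq, opsGr_sliceQ_inOne, opsGr_kappa_inOne, ← map_add] at h4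
    have h5 := inDeg_injective 1 h4
    obtain ⟨h6, h7⟩ := hUV Γ h1
    rw [h5] at h6 h7
    refine ⟨⟨h6, ?_⟩, h7⟩
    apply inDeg_injective 1
    rw [← opsGr_harm_inOne, ← opsGr_kappa_inOne]
    exact H.harm_harm _
  · obtain ⟨h1, h2⟩ := hVU h hh.1
    have h3 : S.opsGr.harm (inDeg 𝒢 1 h) = inDeg 𝒢 1 h := by rw [opsGr_harm_inOne, hh.2]
    have h4 : inDeg 𝒢 1 (ψ h) + S.opsGr.sliceQ (inDeg 𝒢 1 (ψ h)) (inDeg 𝒢 1 (ψ h)) =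
        inDeg 𝒢 1 h := by
      rw [opsGr_sliceQ_inOne, ← map_add, h2]
    obtain ⟨h5, h6, h7⟩ := H.of_slice_eq h3 h4
    rw [opsGr_kappa_inOne] at h7
    exact ⟨⟨h1, h5, (hMC _ h1).mpr h6⟩, inDeg_injective 1 h7⟩

end Hodge

end DegreeOne

/-! ### Representability -/

section Representability

variable {𝕜 : Type u} [RCLike 𝕜] {G : Type w} [NormedAddCommGroup G] [NormedSpace 𝕜 G]
  {𝒢 : ℤ → Submodule 𝕜 G} [DirectSum.Decomposition 𝒢] {D : NormedDGLA 𝕜 𝒢} (S : Hodge D)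
  {ι : Type*} [Fintype ι]

theorem GradedArtin.DegreeZero.gr_eq_bot {B : GradedArtin.{u, v} 𝕜} (h : B.DegreeZero) {i : ℤ}
    (hi : i ≠ 0) : B.gr i = ⊥ := by
  rw [eq_bot_iff]
  intro x hx
  have hx0 : x ∈ B.gr 0 := by rw [h]; trivial
  rw [Submodule.mem_bot, ← DirectSum.decompose_of_mem_same B.gr hx0]
  exact DirectSum.decompose_of_mem_ne B.gr hx hi

namespace Hodge

/-- A functor of points whose coordinates parametrise `(H ⊗ m_B)¹` naturally, on the algebras `B`
satisfying `p`, represents the deformation functor there. -/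
theorem exists_mdef_representation {Pt : GradedArtin.{u, v} 𝕜 → Type*}
    {p : GradedArtin.{u, v} 𝕜 → Prop} {γ : ι → G} (coord : ∀ B, Pt B → ι → B)
    (map : ∀ {B B'}, GradedArtin.Hom B B' → Pt B → Pt B')
    (hmap : ∀ {B B'} (f : GradedArtin.Hom B B') φ α,
      coord B' (map f φ) α = f.toAlgHom (coord B φ α))
    (he : ∀ B, p B → ∃ e : Pt B ≃ S.HarmPts B,
      ∀ φ, (e φ : G ⊗[𝕜] B) = ∑ α, γ α ⊗ₜ[𝕜] coord B φ α) :
    ∃ Φ : ∀ B, p B → (Pt B ≃ S.MDef B),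
      (∀ (B B') (h : p B) (h' : p B') (f : GradedArtin.Hom B B') (φ : Pt B),
        Φ B' h' (map f φ) = Hodge.MDef.map S f (Φ B h φ)) ∧
      ∀ (B) (h : p B) (φ : Pt B) (Γ : S.MC B), Φ B h φ = Quot.mk _ Γ ↔
        (S.opsT B).kappa Γ = ∑ α, γ α ⊗ₜ[𝕜] coord B φ α := by
  choose e he using he
  have key : ∀ (B) (h : p B) (φ : Pt B) (Γ : S.MC B),
      ((e B h).trans (S.mdefEquiv B).symm) φ = Quot.mk _ Γ ↔
        (S.opsT B).kappa Γ = ∑ α, γ α ⊗ₜ[𝕜] coord B φ α := fun B h φ Γ => by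
    rw [Equiv.trans_apply, mdefEquiv_symm_eq_iff, he]
  refine ⟨fun B h => (e B h).trans (S.mdefEquiv B).symm, fun B B' h h' f φ => ?_, key⟩
  obtain ⟨Γ, hΓ⟩ := Quot.exists_rep (((e B h).trans (S.mdefEquiv B).symm) φ)
  rw [← hΓ]
  refine (key B' h' (map f φ) ⟨S.tmap f Γ, S.tmap_MC f Γ.2⟩).mpr ?_
  rw [← tmap_kappa, (key B h φ Γ).mp hΓ.symm, map_sum]
  exact Finset.sum_congr rfl fun α _ => by rw [hmap]; rfl

/-- The version with a complement of the coboundaries instead of a gauge equivalence. -/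
theorem exists_mdefC_representation {Pt : GradedArtin.{u, v} 𝕜 → Type*}
    {p : GradedArtin.{u, v} 𝕜 → Prop} {γ : ι → G} (coord : ∀ B, Pt B → ι → B)
    (map : ∀ {B B'}, GradedArtin.Hom B B' → Pt B → Pt B')
    (hmap : ∀ {B B'} (f : GradedArtin.Hom B B') φ α,
      coord B' (map f φ) α = f.toAlgHom (coord B φ α))
    (he : ∀ B, p B → ∃ e : Pt B ≃ S.HarmPts B,
      ∀ φ, (e φ : G ⊗[𝕜] B) = ∑ α, γ α ⊗ₜ[𝕜] coord B φ α)
    {C : Submodule 𝕜 G} (hC : S.IsComplement C) :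
    ∃ Φ : ∀ B, p B → (Pt B ≃ S.MDefC B C),
      (∀ (B B') (h : p B) (h' : p B') (f : GradedArtin.Hom B B') (φ : Pt B),
        Φ B' h' (map f φ) = Hodge.MDefC.map S C f (Φ B h φ)) ∧
      ∀ (B) (h : p B) (φ : Pt B),
        (S.opsT B).kappa (Φ B h φ) = ∑ α, γ α ⊗ₜ[𝕜] coord B φ α := by
  choose e he using he
  have key : ∀ (B) (h : p B) (φ : Pt B),
      (S.opsT B).kappa (((e B h).trans (S.mdefCEquiv hC B).symm) φ : S.MDefC B C) =
        ∑ α, γ α ⊗ₜ[𝕜] coord B φ α := fun B h φ => by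
    rw [← S.mdefCEquiv_apply hC, Equiv.trans_apply, Equiv.apply_symm_apply, he]
  refine ⟨fun B h => (e B h).trans (S.mdefCEquiv hC B).symm, fun B B' h h' f φ => ?_, key⟩
  refine (S.mdefCEquiv hC B').injective (Subtype.ext ?_)
  rw [S.mdefCEquiv_apply hC, S.mdefCEquiv_apply hC, key]
  change _ = (S.opsT B').kappa (S.tmap f _)
  rw [← tmap_kappa, key, map_sum]
  exact Finset.sum_congr rfl fun α _ => by rw [hmap]; rfl

/-- Points of the germ of `H[1]` are elements of `(H ⊗ m_B)¹`. -/
theorem exists_superPoint_equiv (b : Module.Basis ι 𝕜 S.harmonic) {δ : ι → ℤ}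
    (hδ : ∀ α, (b α : G) ∈ 𝒢 (δ α)) (B : GradedArtin.{u, v} 𝕜) :
    ∃ e : SuperPoint δ B ≃ S.HarmPts B,
      ∀ φ, (e φ : G ⊗[𝕜] B) = ∑ α, (b α : G) ⊗ₜ[𝕜] φ.1 (SuperGerm.t 𝕜 δ α) := by
  have hli : LinearIndependent 𝕜 fun α => (b α : G) :=
    b.linearIndependent.map' S.harmonic.subtype (Submodule.ker_subtype _)
  obtain ⟨e, he⟩ := S.exists_coordEquiv (B := B) hli hδ (fun α => (b α).2)
    fun i => Or.inr (S.harmonic_inf_le_span b hδ i)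
  exact ⟨(superPointEquiv δ B).trans e, fun φ => he _⟩

/-- For `B` in degree zero, points of the germ of `H¹` are elements of `(H ⊗ m_B)¹`. -/
theorem exists_germPoint_equiv (b : Module.Basis ι 𝕜 ↥(S.harmonic ⊓ 𝒢 1))
    {B : GradedArtin.{u, v} 𝕜} (hB : B.DegreeZero) :
    ∃ e : GermPoint ι B ≃ S.HarmPts B,
      ∀ φ, (e φ : G ⊗[𝕜] B) = ∑ α, (b α : G) ⊗ₜ[𝕜] φ.1 (Conv.X 𝕜 α) := by
  have hli : LinearIndependent 𝕜 fun α => (b α : G) :=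
    b.linearIndependent.map' (S.harmonic ⊓ 𝒢 1).subtype (Submodule.ker_subtype _)
  obtain ⟨e, he⟩ := S.exists_coordEquiv (B := B) (δ := fun _ => 1) hli (fun α => (b α).2.2)
    (fun α => (b α).2.1) fun i => by
      rcases eq_or_ne i 1 with rfl | hi
      · right
        intro x hx
        have h := congrArg (S.harmonic ⊓ 𝒢 1).subtype (b.sum_repr ⟨x, hx⟩)
        rw [map_sum] at h
        rw [show x = (S.harmonic ⊓ 𝒢 1).subtype ⟨x, hx⟩ from rfl, ← h]
        exact sum_mem fun α _ => Submodule.smul_mem _ _ (Submodule.subset_span ⟨α, rfl, rfl⟩)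
      · exact Or.inl (hB.gr_eq_bot (by omega))
  obtain ⟨g, hg⟩ := exists_germPointEquiv ι hB
  exact ⟨g.trans e, fun φ => by simp only [Equiv.trans_apply, he, hg]⟩

end Hodge

end Representability

end Kuranishi

open Kuranishi in
theorem mainTheorem4 {𝕜 : Type u} [RCLike 𝕜] {G : Type w} [NormedAddCommGroup G]
    [NormedSpace 𝕜 G] (𝒢 : ℤ → Submodule 𝕜 G) [DirectSum.Decomposition 𝒢]
    (D : NormedDGLA 𝕜 𝒢) (S : Hodge D) :
    -- the harmonic space realises the cohomology
    (∀ i, S.HarmonicRepresents i) ∧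
    -- `MDef^ℤ` is represented, through the Kuranishi map, by the analytic germ of `H*(𝔤)[1]` at `0`
    (∀ (ι : Type x) [Fintype ι] (δ : ι → ℤ) (b : Module.Basis ι 𝕜 S.harmonic),
      (∀ α, (b α : G) ∈ 𝒢 (δ α)) →
      (∃ Φ : ∀ B : GradedArtin.{u, v} 𝕜, SuperPoint δ B ≃ S.MDef B,
        (∀ (B B' : GradedArtin.{u, v} 𝕜) (f : GradedArtin.Hom B B') (φ : SuperPoint δ B),
          Φ B' (SuperPoint.map δ f φ) = Hodge.MDef.map S f (Φ B φ)) ∧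
        ∀ (B : GradedArtin.{u, v} 𝕜) (φ : SuperPoint δ B) (Γ : S.MC B),
          Φ B φ = Quot.mk _ Γ ↔
            (S.opsT B).kappa Γ = ∑ α, (b α : G) ⊗ₜ[𝕜] φ.1 (SuperGerm.t 𝕜 δ α)) ∧
      ∀ C : Submodule 𝕜 G, S.IsComplement C →
        ∃ Φ : ∀ B : GradedArtin.{u, v} 𝕜, SuperPoint δ B ≃ S.MDefC B C,
          (∀ (B B' : GradedArtin.{u, v} 𝕜) (f : GradedArtin.Hom B B') (φ : SuperPoint δ B),
            Φ B' (SuperPoint.map δ f φ) = Hodge.MDefC.map S C f (Φ B φ)) ∧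
          ∀ (B : GradedArtin.{u, v} 𝕜) (φ : SuperPoint δ B),
            (S.opsT B).kappa (Φ B φ) = ∑ α, (b α : G) ⊗ₜ[𝕜] φ.1 (SuperGerm.t 𝕜 δ α)) ∧
    -- the moduli superspace `M^ℤ` is smooth, the Kuranishi map is an analytic isomorphism of it with a
    -- neighbourhood of `0` in `H*(𝔤)[1]`, and its points over the base point are the values of `MDef^ℤ`
    (∀ h : S.ContinuousOps, FiniteDimensional 𝕜 S.harmonic →
      ∃ U V : Set (Completion G), IsOpen U ∧ 0 ∈ U ∧ IsOpen V ∧ 0 ∈ V ∧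
        ∀ B : GradedArtin.{u, v} 𝕜,
          IsAnalyticChart 𝕜 (Hodge.opsHatT h B).kappa (Hodge.ModZ h U B) (S.HarmZ V B) ∧
          ((Completion.toComplL : G →L[𝕜] Completion G).toLinearMap.rTensor B) ''
              S.MDefC B (LinearMap.ker (D.d ∘ₗ S.η)) =
            {Γ | Γ ∈ Hodge.ModZ h U B ∧ Γ ∈ S.degHat B}) ∧
    -- `MDef⁰` is represented, through the Kuranishi map, by the analytic germ of `H¹(𝔤)` at `0`
    (∀ (ι : Type x) [Fintype ι] (b : Module.Basis ι 𝕜 ↥(S.harmonic ⊓ 𝒢 1)),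
      (∃ Φ : ∀ B : GradedArtin.{u, v} 𝕜, B.DegreeZero → (GermPoint ι B ≃ S.MDef B),
        (∀ (B B' : GradedArtin.{u, v} 𝕜) (h : B.DegreeZero) (h' : B'.DegreeZero)
            (f : GradedArtin.Hom B B') (φ : GermPoint ι B),
          Φ B' h' (GermPoint.map f φ) = Hodge.MDef.map S f (Φ B h φ)) ∧
        ∀ (B : GradedArtin.{u, v} 𝕜) (h : B.DegreeZero) (φ : GermPoint ι B) (Γ : S.MC B),
          Φ B h φ = Quot.mk _ Γ ↔
            (S.opsT B).kappa Γ = ∑ α, (b α : G) ⊗ₜ[𝕜] φ.1 (Conv.X 𝕜 α)) ∧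
      ∀ C : Submodule 𝕜 G, S.IsComplement C →
        ∃ Φ : ∀ B : GradedArtin.{u, v} 𝕜, B.DegreeZero → (GermPoint ι B ≃ S.MDefC B C),
          (∀ (B B' : GradedArtin.{u, v} 𝕜) (h : B.DegreeZero) (h' : B'.DegreeZero)
              (f : GradedArtin.Hom B B') (φ : GermPoint ι B),
            Φ B' h' (GermPoint.map f φ) = Hodge.MDefC.map S C f (Φ B h φ)) ∧
          ∀ (B : GradedArtin.{u, v} 𝕜) (h : B.DegreeZero) (φ : GermPoint ι B),
            (S.opsT B).kappa (Φ B h φ) = ∑ α, (b α : G) ⊗ₜ[𝕜] φ.1 (Conv.X 𝕜 α)) ∧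
    -- the moduli space `M⁰` is smooth, and the Kuranishi map is an analytic isomorphism of it with a
    -- neighbourhood of `0` in `H¹(𝔤)`
    (FiniteDimensional 𝕜 ↥(S.harmonic ⊓ 𝒢 1) →
      ∃ U V : Set (Completion (𝒢 1)), IsOpen U ∧ 0 ∈ U ∧ IsOpen V ∧ 0 ∈ V ∧
        IsAnalyticChart 𝕜 S.kappa0 (S.Mod0 U) (S.Harm0 V)) ∧
    -- tangent spaces: for `B = 𝕜[ε]` with `ε` of degree `j`, the class of a cocycle `z` of degree
    -- `1 - j` goes to `z ⊗ ε`; for `j = 0` this is the tangent space `H¹(𝔤)` of `MDef⁰`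
    (∀ i j : ℤ, i + j = 1 → ∀ (B : GradedArtin.{u, v} 𝕜) (ε : B), ε ∈ B.gr j → ε ≠ 0 →
      B.max = Submodule.span 𝕜 {ε} →
      ∃ T : D.Cohomology i ≃ S.MDef B, ∀ z : ↥(𝒢 i ⊓ LinearMap.ker D.d),
        ∃ Γ : S.MC B, (Γ : G ⊗[𝕜] B) = (z : G) ⊗ₜ[𝕜] ε ∧ T (D.cls z) = Quot.mk _ Γ) := by
  refine ⟨S.harmonicRepresents, fun ι _ δ b hδ => ⟨?_, fun C hC => ?_⟩,
    fun h _ => S.exists_modZ_chart h, fun ι _ b => ⟨?_, fun C hC => ?_⟩,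
    fun _ => S.exists_mod0_chart,
    fun i j hij B ε hε hε0 hB => S.exists_tangent_equiv hij B hε hε0 hB⟩
  · obtain ⟨Φ, h1, h2⟩ := S.exists_mdef_representation (p := fun _ => True)
      (Pt := fun B => SuperPoint δ B) (γ := fun α => (b α : G))
      (fun B φ α => φ.1 (SuperGerm.t 𝕜 δ α)) (fun f φ => SuperPoint.map δ f φ) (fun f φ α => rfl)
      fun B _ => S.exists_superPoint_equiv b hδ B
    exact ⟨fun B => Φ B trivial, fun B B' f φ => h1 B B' trivial trivial f φ,
      fun B φ Γ => h2 B trivial φ Γ⟩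
  · obtain ⟨Φ, h1, h2⟩ := S.exists_mdefC_representation (p := fun _ => True)
      (Pt := fun B => SuperPoint δ B) (γ := fun α => (b α : G))
      (fun B φ α => φ.1 (SuperGerm.t 𝕜 δ α)) (fun f φ => SuperPoint.map δ f φ) (fun f φ α => rfl)
      (fun B _ => S.exists_superPoint_equiv b hδ B) hC
    exact ⟨fun B => Φ B trivial, fun B B' f φ => h1 B B' trivial trivial f φ,
      fun B φ => h2 B trivial φ⟩
  · exact S.exists_mdef_representation (γ := fun α => (b α : G)) (fun B φ α => φ.1 (Conv.X 𝕜 α))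
      (fun f φ => GermPoint.map f φ) (fun f φ α => rfl)
      fun B hB => S.exists_germPoint_equiv b hB
  · exact S.exists_mdefC_representation (γ := fun α => (b α : G)) (fun B φ α => φ.1 (Conv.X 𝕜 α))
      (fun f φ => GermPoint.map f φ) (fun f φ α => rfl)
      (fun B hB => S.exists_germPoint_equiv b hB) hC
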